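/- Let $K$ be a field, let $n\ge 4$, and let $S=K[x_1,\dots,x_n]$ with the standard grading. Let $C^n_{\mathbf w}$ be an edge-weighted $n$-cycle, that is, the cycle with vertices $x_1,\dots,x_n$ and edges $e_i=x_ix_{i+1}$ ($1\le i\le n$, $x_{n+1}=x_1$), together with weights $\mathbf w_i=\mathbf w(e_i)\in\mathbb Z_{>0}$. Let $$I=I(C^n_{\mathbf w})=\bigl((x_ix_{i+1})^{\mathbf w_i} : 1\le i\le n\bigr)\subset S$$ be its edge ideal. Assume that $C^n_{\mathbf w}$ is integrally closed, i.e. $I$ is an integrally closed ideal, and that exactly one edge is non-trivial, i.e. there is exactly one $i$ with $\mathbf w_i\ge 2$. Put $\omega=\max\{\mathbf w_1,\dots,\mathbf w_n\}$. Then for all $t\ge 1$ $$\operatorname{reg}(S/I^t)=2\omega t+\Bigl\lfloor \frac n3\Bigr\rfloor-2 .$$ Here $\operatorname{reg}(S/J)=\max\{\,j-i : \beta_{i,j}(S/J)\neq 0\,\}$, where $\beta_{i,j}(S/J)$ is the number of summands $S(-j)$ in homological degree $i$ of the minimal graded free resolution of $S/J$. -/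

import Mathlib

/-- `f` is integral over the ideal `I`: there are `k ≥ 1` and `c₁ ∈ I, c₂ ∈ I², …, c_k ∈ I^k` with
`f^k + c₁ f^(k-1) + ⋯ + c_(k-1) f + c_k = 0`. -/
def IsIntegralOverIdeal {R : Type*} [CommRing R] (I : Ideal R) (f : R) : Prop :=
  ∃ (k : ℕ) (c : ℕ → R), 1 ≤ k ∧ (∀ i ∈ Finset.Icc 1 k, c i ∈ I ^ i) ∧
    f ^ k + ∑ i ∈ Finset.Icc 1 k, c i * f ^ (k - i) = 0

/-- An ideal is integrally closed if it equals its integral closure, that is, if it contains every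
element that is integral over it (the elements of `I` are always integral over `I`). -/
def IsIntegrallyClosedIdeal {R : Type*} [CommRing R] (I : Ideal R) : Prop :=
  ∀ f : R, IsIntegralOverIdeal I f ↔ f ∈ I

/-- The edge ideal of the edge-weighted graph `(G, w)` in `K[x_v : v ∈ V]`, generated by the
monomials `x_u^(w(uv)) * x_v^(w(uv))` with `uv` an edge of `G`. -/
noncomputable def weightedEdgeIdeal (K : Type*) [Field K] {V : Type*} (G : SimpleGraph V)
    (w : G.edgeSet → ℕ+) : Ideal (MvPolynomial V K) :=
  Ideal.span {p | ∃ (u v : V) (h : G.Adj u v),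
    p = MvPolynomial.X u ^ (w ⟨s(u, v), h⟩ : ℕ) * MvPolynomial.X v ^ (w ⟨s(u, v), h⟩ : ℕ)}

/-- A graded free resolution
`⋯ → F₂ → F₁ → F₀ → S/J → 0` of `S/J`, where `S = K[x_v : v ∈ V]` has the standard grading.
The module `F_i = ⨁_k S(-shift i k)` is finitely generated free, with standard basis element `k`
in degree `shift i k`; all maps are homogeneous of degree `0`. -/
structure GradedFreeResolution {K : Type*} [Field K] {V : Type*}
    (J : Ideal (MvPolynomial V K)) where
  /-- the rank of `F_i` -/
  rank : ℕ → ℕ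
  /-- the degrees of the basis elements of `F_i` -/
  shift : (i : ℕ) → Fin (rank i) → ℕ
  /-- the augmentation `F₀ → S/J` -/
  aug : (Fin (rank 0) → MvPolynomial V K) →ₗ[MvPolynomial V K] (MvPolynomial V K ⧸ J)
  /-- the differentials `F_(i+1) → F_i` -/
  diff : (i : ℕ) → (Fin (rank (i + 1)) → MvPolynomial V K) →ₗ[MvPolynomial V K]
    (Fin (rank i) → MvPolynomial V K)
  aug_homogeneous : ∀ k, ∃ p : MvPolynomial V K, p.IsHomogeneous (shift 0 k) ∧
    aug (Pi.single k 1) = Ideal.Quotient.mk J p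
  diff_homogeneous : ∀ i k l, ∀ m ∈ (diff i (Pi.single k 1) l).support,
    m.degree + shift i l = shift (i + 1) k
  aug_surjective : Function.Surjective aug
  exact_zero : Function.Exact (diff 0) aug
  exact_succ : ∀ i, Function.Exact (diff (i + 1)) (diff i)

namespace GradedFreeResolution

variable {K : Type*} [Field K] {V : Type*} {J : Ideal (MvPolynomial V K)}

/-- A graded free resolution is minimal if every differential maps `F_(i+1)` into `𝔪 F_i`, where
`𝔪` is the ideal generated by the variables. -/
def IsMinimal (F : GradedFreeResolution J) : Prop :=
  ∀ i x l, F.diff i x l ∈ Ideal.span (Set.range (MvPolynomial.X : V → MvPolynomial V K))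

/-- The number of summands `S(-j)` of `F_i`. For a minimal resolution of `S/J` this is the
graded Betti number `β_{i,j}(S/J)`. -/
def betti (F : GradedFreeResolution J) (i j : ℕ) : ℕ :=
  (Finset.univ.filter fun k => F.shift i k = j).card

end GradedFreeResolution

/-- `reg(S/J) = r`: the quotient `S/J` has a minimal graded free resolution, and
`r = max {j - i | β_{i,j}(S/J) ≠ 0}`, the Betti numbers being read off from any minimal graded free
resolution. -/
def QuotientHasRegularity {K : Type*} [Field K] {V : Type*}
    (J : Ideal (MvPolynomial V K)) (r : ℤ) : Prop :=
  (∃ F : GradedFreeResolution J, F.IsMinimal) ∧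
    ∀ F : GradedFreeResolution J, F.IsMinimal →
      IsGreatest {a : ℤ | ∃ i j : ℕ, F.betti i j ≠ 0 ∧ a = (j : ℤ) - (i : ℤ)} r

/-! Let `i`, `i + 1` be the ends of the non-trivial edge, v = i + 1, u = i, f = (x_v x_u)^ω, and let
J be the edge ideal of the path v, i + 2, …, u made of the trivial edges. Then I^t = J^t + f J^(t-1)
+ ⋯ + f^t. Every ideal involved is monomial and is encoded by the lower set D of exponents outside
it. In multidegree α the Koszul complex of the quotient lives on the sets τ with α - τ ∈ D, and the
regularity is the largest |α| - i with nonzero homology in homological degree i.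

Powers of J are combinatorial: x^d ∈ J^c iff the b-matching number `pathNu` of d is at least c, and
by König duality this number is the least weight of a vertex cover of the path.

Upper bound (`monomialRegLE_cycleSet`): bring in the summands f^k J^(t-k) one at a time. Passing
from k to k + 1 divides out a copy, shifted by f^(k+1), of J^c / (J^c ∩ (J^(c+1) : x_v x_u)) with c
= t - k - 1. Only x_v x_u appears in the colon, not f: by duality, if x_v x_u does not enlarge the
matching then no power of it does (`pathNu_add_le_of_add_one_le`). Removing variables one by one
bounds the pieces (`monomialRegLE_path`, `monomialRegLE_ends`); after the shift each layer has
regularity at most 2ωt + ⌊n/3⌋ - 1, one above the target, which is what the kernel of a surjection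
may have.

Lower bound (`not_acyclic_cycleSet`): take ⌊n/3⌋ edges with no edge between any two of them, the
first being the non-trivial one, and let α be (tω - 1)(v + u) plus the sum of all their vertices.
The Koszul complex in multidegree α consists of the subsets of these vertices that meet every chosen
edge. It is a tensor product of copies of K → K², each with homology only in degree 1, so homology
survives in homological degree ⌊n/3⌋, and |α| - ⌊n/3⌋ = 2ωt + ⌊n/3⌋ - 2.

The Betti numbers of an arbitrary minimal resolution are compared with Koszul homology by chasing
through the double complex (`betti_eq_zero_of_acyclic`, `betti_ne_zero_of_not_acyclic`), and a
minimal resolution is built from minimal homogeneous generators of successive syzygies. -/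

set_option linter.unusedSectionVars false

/-! ### Koszul complexes on families of subsets, and their exact sequences. -/

section Koszul

variable {V : Type*} [Fintype V] [DecidableEq V]

/-- The sign `(-1)^#{u ∈ σ | ρ u < ρ v}` of the Koszul differential. -/
def koszulSign (ρ : V → ℕ) (v : V) (σ : Finset V) : ℤ :=
  (-1) ^ (σ.filter fun u => ρ u < ρ v).card

theorem koszulSign_mul_self (ρ : V → ℕ) (v : V) (σ : Finset V) :
    koszulSign ρ v σ * koszulSign ρ v σ = 1 := by
  unfold koszulSign
  rw [← mul_pow]; simp

theorem koszulSign_smul_smul {M : Type*} [AddCommGroup M] (ρ : V → ℕ) (v : V) (σ : Finset V)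
    (m : M) : koszulSign ρ v σ • koszulSign ρ v σ • m = m := by
  rw [smul_smul, koszulSign_mul_self, one_smul]

theorem koszulSign_insert {ρ : V → ℕ} {v w : V} {σ : Finset V} (hv : v ∉ σ) :
    koszulSign ρ w (insert v σ) = if ρ v < ρ w then -koszulSign ρ w σ else koszulSign ρ w σ := by
  unfold koszulSign
  rw [Finset.filter_insert]
  split_ifs with h
  · rw [Finset.card_insert_of_notMem (by simp [hv]), pow_succ]; ring
  · rfl

theorem koszulSign_swap {ρ : V → ℕ} (hρ : Function.Injective ρ) {v w : V} {σ : Finset V}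
    (hvw : v ≠ w) (hv : v ∉ σ) (hw : w ∉ σ) :
    koszulSign ρ v σ * koszulSign ρ w (insert v σ) =
      -(koszulSign ρ w σ * koszulSign ρ v (insert w σ)) := by
  rw [koszulSign_insert hv, koszulSign_insert hw]
  have : ρ v ≠ ρ w := fun h => hvw (hρ h)
  rcases lt_or_gt_of_ne this with h | h
  · rw [if_pos h, if_neg (by omega)]; ring
  · rw [if_neg (by omega), if_pos h]; ring

/-- The Koszul differential on the elements `x v`, on chains indexed by the subsets of `V`. -/
def koszulD {R M : Type*} [CommRing R] [AddCommGroup M] [Module R M] (ρ : V → ℕ) (x : V → R)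
    (c : Finset V → M) (σ : Finset V) : M :=
  ∑ v ∈ σᶜ, koszulSign ρ v σ • x v • c (insert v σ)

section Basic

variable {R M N : Type*} [CommRing R] [AddCommGroup M] [Module R M] [AddCommGroup N] [Module R N]

theorem koszulD_congr {ρ : V → ℕ} {x : V → R} {c c' : Finset V → M} {σ : Finset V}
    (h : ∀ v, v ∉ σ → c (insert v σ) = c' (insert v σ)) : koszulD ρ x c σ = koszulD ρ x c' σ := by
  unfold koszulD
  refine Finset.sum_congr rfl fun v hv => ?_
  rw [h v (by simpa using hv)]

theorem koszulD_eq_zero {ρ : V → ℕ} {x : V → R} {c : Finset V → M} {σ : Finset V}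
    (h : ∀ v, v ∉ σ → c (insert v σ) = 0) : koszulD ρ x c σ = 0 := by
  unfold koszulD
  refine Finset.sum_eq_zero fun v hv => ?_
  rw [h v (by simpa using hv)]; simp

theorem exists_of_koszulD_ne_zero {ρ : V → ℕ} {x : V → R} {c : Finset V → M} {σ : Finset V}
    (h : koszulD ρ x c σ ≠ 0) : ∃ v, v ∉ σ ∧ c (insert v σ) ≠ 0 := by
  by_contra! hc
  exact h (koszulD_eq_zero hc)

theorem koszulD_add (ρ : V → ℕ) (x : V → R) (c c' : Finset V → M) (σ : Finset V) :
    koszulD ρ x (c + c') σ = koszulD ρ x c σ + koszulD ρ x c' σ := by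
  simp [koszulD, Finset.sum_add_distrib]

theorem koszulD_sub (ρ : V → ℕ) (x : V → R) (c c' : Finset V → M) (σ : Finset V) :
    koszulD ρ x (c - c') σ = koszulD ρ x c σ - koszulD ρ x c' σ := by
  simp [koszulD, smul_sub, Finset.sum_sub_distrib]

theorem koszulD_map (ρ : V → ℕ) (x : V → R) (φ : M →ₗ[R] N) (c : Finset V → M) (σ : Finset V) :
    koszulD ρ x (fun τ => φ (c τ)) σ = φ (koszulD ρ x c σ) := by
  simp [koszulD, map_sum]

theorem koszulD_koszulD {ρ : V → ℕ} (hρ : Function.Injective ρ) (x : V → R) (c : Finset V → M)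
    (σ : Finset V) : koszulD ρ x (koszulD ρ x c) σ = 0 := by
  unfold koszulD
  simp only [Finset.smul_sum]
  rw [Finset.sum_sigma']
  -- The terms for (v, w) and (w, v) involve the same set and cancel by `koszulSign_swap`.
  refine Finset.sum_involution (fun a _ => ⟨a.2, a.1⟩) ?_ ?_ ?_ ?_
  · rintro ⟨v, w⟩ h
    simp only [Finset.mem_sigma, Finset.mem_compl, Finset.mem_insert, not_or] at h
    obtain ⟨hv, hwv, hw⟩ := h
    have e := koszulSign_swap hρ (Ne.symm hwv) hv hw
    rw [Finset.insert_comm v w σ]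
    simp only [smul_comm (x v) (koszulSign ρ w (insert v σ)),
      smul_comm (x w) (koszulSign ρ v (insert w σ)), smul_smul (M := ℤ)]
    rw [e, smul_comm (x w) (x v), neg_smul]
    abel
  · rintro ⟨v, w⟩ h _ he
    simp only [Finset.mem_sigma, Finset.mem_compl, Finset.mem_insert, not_or] at h
    have := congrArg Sigma.fst he
    exact h.2.1 this
  · rintro ⟨v, w⟩ h
    simp only [Finset.mem_sigma, Finset.mem_compl, Finset.mem_insert, not_or] at h ⊢
    exact ⟨h.2.2, Ne.symm h.2.1, h.1⟩
  · rintro ⟨v, w⟩ h; rfl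

theorem card_of_koszulD_ne_zero {ρ : V → ℕ} {x : V → R} {c : Finset V → M} {i : ℕ}
    (hc : ∀ τ, c τ ≠ 0 → τ.card = i + 1) {σ : Finset V} (h : koszulD ρ x c σ ≠ 0) :
    σ.card = i := by
  obtain ⟨v, hv, hne⟩ := exists_of_koszulD_ne_zero h
  have := hc _ hne
  rw [Finset.card_insert_of_notMem hv] at this
  omega

end Basic

section Acyclic

variable (K : Type*) [Field K] (ρ : V → ℕ)

/-- The chains supported on a family `Σ` of subsets of `V` have no Koszul homology in
homological degree `i`. -/
def KoszulAcyclic (F : Set (Finset V)) (i : ℕ) : Prop :=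
  ∀ c : Finset V → K, (∀ τ, c τ ≠ 0 → τ ∈ F ∧ τ.card = i) →
    (∀ σ ∈ F, koszulD ρ (1 : V → K) c σ = 0) →
      ∃ y : Finset V → K, (∀ τ, y τ ≠ 0 → τ ∈ F ∧ τ.card = i + 1) ∧
        ∀ τ ∈ F, koszulD ρ (1 : V → K) y τ = c τ

variable {K ρ}

theorem koszulD_indicator_diff {F G : Set (Finset V)}
    (hG : ∀ τ ∈ G, ∀ σ ∈ F, σ ⊆ τ → σ ∈ G) {c : Finset V → K} (hc : ∀ τ, c τ ≠ 0 → τ ∈ F)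
    {σ : Finset V} (hσ : σ ∈ F \ G) :
    koszulD ρ (1 : V → K) ((F \ G).indicator c) σ = koszulD ρ (1 : V → K) c σ := by
  refine koszulD_congr fun v _ => ?_
  by_cases h : insert v σ ∈ F \ G
  · rw [Set.indicator_of_mem h]
  · rw [Set.indicator_of_notMem h]
    by_contra hne
    have hF := hc _ (Ne.symm hne)
    have hGm : insert v σ ∈ G := by by_contra hn; exact h ⟨hF, hn⟩
    exact hσ.2 (hG _ hGm _ hσ.1 (Finset.subset_insert _ _))

theorem koszulD_indicator_koszulD (hρ : Function.Injective ρ) {F : Set (Finset V)}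
    (hF : F.OrdConnected) {c : Finset V → K} (hc : ∀ τ, c τ ≠ 0 → τ ∈ F)
    {σ : Finset V} (hσ : σ ∈ F) :
    koszulD ρ (1 : V → K) (F.indicator (koszulD ρ (1 : V → K) c)) σ = 0 := by
  rw [← koszulD_koszulD hρ (1 : V → K) c σ]
  refine koszulD_congr fun v hv => ?_
  by_cases h : insert v σ ∈ F
  · rw [Set.indicator_of_mem h]
  · rw [Set.indicator_of_notMem h]
    by_contra hne
    obtain ⟨w, _, hne⟩ := exists_of_koszulD_ne_zero (Ne.symm hne)
    exact h (hF.out hσ (hc _ hne) ⟨Finset.subset_insert _ _, Finset.subset_insert _ _⟩)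

theorem koszulD_eq_zero_of_diff {F G : Set (Finset V)}
    (hG : ∀ τ ∈ G, ∀ σ ∈ F, σ ⊆ τ → σ ∈ G) {c : Finset V → K} (hc : ∀ τ, c τ ≠ 0 → τ ∈ G)
    {σ : Finset V} (hσ : σ ∈ F) (hσ' : σ ∉ G) : koszulD ρ (1 : V → K) c σ = 0 := by
  by_contra hne
  obtain ⟨w, _, hne⟩ := exists_of_koszulD_ne_zero hne
  exact hσ' (hG _ (hc _ hne) _ hσ (Finset.subset_insert _ _))

/-- The differential removes elements, so `hG` makes the chains on `G` a subcomplex of those on `F`,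
with quotient the chains on `F \ G`; order convexity of `F` is what makes the restricted
differential square to zero. This lemma and the next two are the three vanishing statements from the
long exact homology sequence. -/
theorem KoszulAcyclic.extension (hρ : Function.Injective ρ) {F G : Set (Finset V)}
    (hF : F.OrdConnected) (hGF : G ⊆ F) (hG : ∀ τ ∈ G, ∀ σ ∈ F, σ ⊆ τ → σ ∈ G) {i : ℕ}
    (h₁ : KoszulAcyclic K ρ G i) (h₂ : KoszulAcyclic K ρ (F \ G) i) : KoszulAcyclic K ρ F i := by
  intro c hc hcyc
  have hcF : ∀ τ, c τ ≠ 0 → τ ∈ F := fun τ h => (hc τ h).1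
  obtain ⟨y₂, hy₂, hy₂c⟩ := h₂ ((F \ G).indicator c)
    (fun τ h => by
      have := Set.indicator_apply_ne_zero.1 h
      exact ⟨this.1, (hc τ this.2).2⟩)
    (fun σ hσ => by rw [koszulD_indicator_diff hG hcF hσ]; exact hcyc σ hσ.1)
  have hy₂F : ∀ τ, y₂ τ ≠ 0 → τ ∈ F := fun τ h => (hy₂ τ h).1.1
  have key : ∀ τ ∈ F, τ ∉ G → koszulD ρ (1 : V → K) y₂ τ = c τ := fun τ hτ hτ' => by
    rw [hy₂c τ ⟨hτ, hτ'⟩, Set.indicator_of_mem (show τ ∈ F \ G from ⟨hτ, hτ'⟩)]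
  obtain ⟨y₁, hy₁, hy₁c⟩ := h₁ (F.indicator (c - koszulD ρ (1 : V → K) y₂))
    (fun τ h => by
      have h' := Set.indicator_apply_ne_zero.1 h
      obtain ⟨hτ, hne⟩ := h'
      refine ⟨?_, ?_⟩
      · by_contra hn
        exact hne (by simp [key τ hτ hn])
      · by_cases h0 : c τ = 0
        · refine card_of_koszulD_ne_zero (fun τ h => (hy₂ τ h).2) (σ := τ) (ρ := ρ) (x := (1 : V → K)) ?_
          intro h1; exact hne (by simp [h0, h1])
        · exact (hc τ h0).2)
    (fun σ hσ => by
      have e : F.indicator (c - koszulD ρ (1 : V → K) y₂) =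
          c - F.indicator (koszulD ρ (1 : V → K) y₂) := by
        rw [Set.indicator_sub']
        congr 1
        ext τ
        by_cases h : τ ∈ F
        · simp [h]
        · simp only [Set.indicator_of_notMem h]
          by_contra h'; exact h (hcF τ (Ne.symm h'))
      rw [e, koszulD_sub, hcyc σ (hGF hσ), koszulD_indicator_koszulD hρ hF hy₂F (hGF hσ), sub_zero])
  refine ⟨y₁ + y₂, fun τ h => ?_, fun τ hτ => ?_⟩
  · by_cases h0 : y₁ τ = 0
    · have := hy₂ τ (fun h' => h (by simp [h0, h']))
      exact ⟨this.1.1, this.2⟩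
    · exact ⟨hGF (hy₁ τ h0).1, (hy₁ τ h0).2⟩
  · rw [koszulD_add]
    by_cases hτG : τ ∈ G
    · rw [hy₁c τ hτG, Set.indicator_of_mem hτ]; simp
    · rw [koszulD_eq_zero_of_diff hG (fun τ h => (hy₁ τ h).1) hτ hτG, key τ hτ hτG, zero_add]

/-- Exactness of H_i(F) → H_i(F \ G) → H_(i-1)(G); the condition on `G` is vacuous for i = 0. -/
theorem KoszulAcyclic.quotient (hρ : Function.Injective ρ) {F G : Set (Finset V)}
    (hF : F.OrdConnected) (hGF : G ⊆ F) (hG : ∀ τ ∈ G, ∀ σ ∈ F, σ ⊆ τ → σ ∈ G) {i : ℕ}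
    (h : KoszulAcyclic K ρ F i) (h₁ : ∀ k, i = k + 1 → KoszulAcyclic K ρ G k) :
    KoszulAcyclic K ρ (F \ G) i := by
  intro c hc hcyc
  have hcF : ∀ τ, c τ ≠ 0 → τ ∈ F := fun τ h => (hc τ h).1.1
  -- The boundary of `c` in `F` is a cycle of `G`. Filling it by `y'` inside `G` turns `c - y'` into
  -- a cycle of `F` with the same class in the quotient.
  obtain ⟨y', hy'G, hy'i, hy'⟩ : ∃ y' : Finset V → K, (∀ τ, y' τ ≠ 0 → τ ∈ G) ∧
      (∀ τ, y' τ ≠ 0 → τ.card = i) ∧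
      ∀ τ ∈ F, koszulD ρ (1 : V → K) y' τ = koszulD ρ (1 : V → K) c τ := by
    rcases i with _ | k
    · refine ⟨0, by simp, by simp, fun τ _ => ?_⟩
      rw [koszulD_eq_zero (by simp), koszulD_eq_zero]
      intro v hv
      by_contra hne
      have := (hc _ hne).2
      simp at this
    · obtain ⟨y', h1, h2⟩ := h₁ k rfl (F.indicator (koszulD ρ (1 : V → K) c))
        (fun τ hne => by
          obtain ⟨hτ, hne⟩ := Set.indicator_apply_ne_zero.1 hne
          refine ⟨?_, card_of_koszulD_ne_zero (fun τ h => (hc τ h).2) hne⟩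
          by_contra hn
          exact hne (hcyc τ ⟨hτ, hn⟩))
        (fun σ hσ => koszulD_indicator_koszulD hρ hF hcF (hGF hσ))
      refine ⟨y', fun τ h => (h1 τ h).1, fun τ h => (h1 τ h).2, fun τ hτ => ?_⟩
      by_cases hτG : τ ∈ G
      · rw [h2 τ hτG, Set.indicator_of_mem hτ]
      · rw [hcyc τ ⟨hτ, hτG⟩, koszulD_eq_zero_of_diff hG (fun τ h => (h1 τ h).1) hτ hτG]
  obtain ⟨y, hy, hyc⟩ := h (c - y')
    (fun τ hne => by
      by_cases h0 : c τ = 0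
      · have h1 : y' τ ≠ 0 := fun h' => hne (by simp [h0, h'])
        exact ⟨hGF (hy'G τ h1), hy'i τ h1⟩
      · exact ⟨hcF τ h0, (hc τ h0).2⟩)
    (fun σ hσ => by rw [koszulD_sub, hy' σ hσ, sub_self])
  refine ⟨(F \ G).indicator y, fun τ hne => ?_, fun τ hτ => ?_⟩
  · obtain ⟨hτ, hne⟩ := Set.indicator_apply_ne_zero.1 hne
    exact ⟨hτ, (hy τ hne).2⟩
  · rw [koszulD_indicator_diff hG (fun τ h => (hy τ h).1) hτ, hyc τ hτ.1]
    have : y' τ = 0 := by by_contra h0; exact hτ.2 (hy'G τ h0)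
    simp [this]

/-- Exactness of H_(i+1)(F \ G) → H_i(G) → H_i(F). -/
theorem KoszulAcyclic.sub (hρ : Function.Injective ρ) {F G : Set (Finset V)}
    (hF : F.OrdConnected) (hGF : G ⊆ F) (hG : ∀ τ ∈ G, ∀ σ ∈ F, σ ⊆ τ → σ ∈ G) {i : ℕ}
    (h : KoszulAcyclic K ρ F i) (h₂ : KoszulAcyclic K ρ (F \ G) (i + 1)) :
    KoszulAcyclic K ρ G i := by
  intro c hc hcyc
  have hcG : ∀ τ, c τ ≠ 0 → τ ∈ G := fun τ h => (hc τ h).1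
  obtain ⟨y, hy, hyc⟩ := h c (fun τ h => ⟨hGF (hc τ h).1, (hc τ h).2⟩) (fun σ hσ => by
    by_cases hσG : σ ∈ G
    · exact hcyc σ hσG
    · exact koszulD_eq_zero_of_diff hG hcG hσ hσG)
  have hyF : ∀ τ, y τ ≠ 0 → τ ∈ F := fun τ h => (hy τ h).1
  obtain ⟨w, hw, hwc⟩ := h₂ ((F \ G).indicator y)
    (fun τ hne => by
      obtain ⟨hτ, hne⟩ := Set.indicator_apply_ne_zero.1 hne
      exact ⟨hτ, (hy τ hne).2⟩)
    (fun σ hσ => by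
      rw [koszulD_indicator_diff hG hyF hσ, hyc σ hσ.1]
      by_contra h0; exact hσ.2 (hcG σ h0))
  have hwF : ∀ τ, w τ ≠ 0 → τ ∈ F := fun τ h => (hw τ h).1.1
  -- Outside `G` the chain `y` is the boundary of `w`, so subtracting that boundary pushes `y` into
  -- `G` without changing its own boundary.
  refine ⟨y - F.indicator (koszulD ρ (1 : V → K) w), fun τ hne => ?_, fun τ hτ => ?_⟩
  · have hτF : τ ∈ F := by
      by_contra hn
      apply hne
      have : y τ = 0 := by by_contra h0; exact hn (hyF τ h0)
      simp [this, hn]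
    refine ⟨?_, ?_⟩
    · by_contra hn
      apply hne
      have h1 := hwc τ ⟨hτF, hn⟩
      rw [Set.indicator_of_mem (show τ ∈ F \ G from ⟨hτF, hn⟩)] at h1
      simp [hτF, h1]
    · by_cases h0 : y τ = 0
      · refine card_of_koszulD_ne_zero (fun τ h => (hw τ h).2) (σ := τ) (ρ := ρ) (x := (1 : V → K)) ?_
        intro h1; exact hne (by simp [h0, h1])
      · exact (hy τ h0).2
  · rw [koszulD_sub, koszulD_indicator_koszulD hρ hF hwF (hGF hτ), sub_zero, hyc τ (hGF hτ)]

end Acyclic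

end Koszul

/-! ### Regularity bounds for modules with a monomial basis. -/

section MultigradedRegularity

variable {V : Type*} [Fintype V] [DecidableEq V]

/-- The exponent vector of the squarefree monomial with support `τ`. -/
noncomputable def expInd (τ : Finset V) : V →₀ ℕ := ∑ v ∈ τ, Finsupp.single v 1

theorem expInd_apply (τ : Finset V) (v : V) : expInd τ v = if v ∈ τ then 1 else 0 := by
  simp [expInd, Finsupp.finsetSum_apply, Finsupp.single_apply]

theorem expInd_insert {v : V} {τ : Finset V} (h : v ∉ τ) :
    expInd (insert v τ) = Finsupp.single v 1 + expInd τ := by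
  simp [expInd, Finset.sum_insert h]

theorem degree_expInd (τ : Finset V) : (expInd τ).degree = τ.card := by
  simp [expInd, map_sum]

theorem expInd_mono {σ τ : Finset V} (h : σ ⊆ τ) : expInd σ ≤ expInd τ := by
  intro v
  simp only [expInd_apply]
  split_ifs with h1 h2
  · exact le_rfl
  · exact absurd (h h1) h2
  · simp
  · exact le_rfl

/-- The subsets `τ` of `V` for which `α - τ` lies in `D`. -/
def koszulFamily (D : Set (V →₀ ℕ)) (α : V →₀ ℕ) : Set (Finset V) :=
  {τ | ∃ d ∈ D, d + expInd τ = α}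

variable (K : Type*) [Field K] (ρ : V → ℕ)

/-- The module with monomial basis `D` has all its multigraded Koszul homology in homological
degree `i` concentrated in degrees at most `r + i`. -/
def MonomialRegLE (D : Set (V →₀ ℕ)) (r : ℤ) : Prop :=
  ∀ (i : ℕ) (α : V →₀ ℕ), r < (α.degree : ℤ) - i → KoszulAcyclic K ρ (koszulFamily D α) i

variable {K ρ}

theorem koszulFamily_ordConnected {D : Set (V →₀ ℕ)} (hD : D.OrdConnected) (α : V →₀ ℕ) :
    (koszulFamily D α).OrdConnected := by
  refine ⟨?_⟩
  rintro σ ⟨d, hd, rfl⟩ τ ⟨e, he, heq⟩ υ ⟨h1, h2⟩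
  have hle : expInd υ ≤ d + expInd σ := by
    rw [← heq]; exact (expInd_mono h2).trans (le_add_of_nonneg_left (zero_le))
  refine ⟨d + expInd σ - expInd υ, hD.out he hd ⟨?_, ?_⟩, tsub_add_cancel_of_le hle⟩
  · rw [← heq]
    exact (le_tsub_iff_right (by rw [heq]; exact hle)).2 (add_le_add_right (expInd_mono h2) e)
  · exact tsub_le_iff_right.2 (add_le_add_right (expInd_mono h1) d)

theorem koszulFamily_diff (D D' : Set (V →₀ ℕ)) (α : V →₀ ℕ) :
    koszulFamily (D \ D') α = koszulFamily D α \ koszulFamily D' α := by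
  ext τ
  constructor
  · rintro ⟨d, hd, rfl⟩
    refine ⟨⟨d, hd.1, rfl⟩, ?_⟩
    rintro ⟨e, he, h⟩
    exact hd.2 (add_right_cancel h ▸ he)
  · rintro ⟨⟨d, hd, rfl⟩, h⟩
    exact ⟨d, ⟨hd, fun h' => h ⟨d, h', rfl⟩⟩, rfl⟩

theorem koszulFamily_mono {D D' : Set (V →₀ ℕ)} (h : D' ⊆ D) (α : V →₀ ℕ) :
    koszulFamily D' α ⊆ koszulFamily D α := by
  rintro τ ⟨d, hd, rfl⟩
  exact ⟨d, h hd, rfl⟩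

theorem koszulFamily_lower {D D' : Set (V →₀ ℕ)} (hD : ∀ d ∈ D', ∀ e ∈ D, d ≤ e → e ∈ D')
    (α : V →₀ ℕ) :
    ∀ τ ∈ koszulFamily D' α, ∀ σ ∈ koszulFamily D α, σ ⊆ τ → σ ∈ koszulFamily D' α := by
  rintro τ ⟨d, hd, rfl⟩ σ ⟨e, he, h⟩ hσ
  refine ⟨e, hD d hd e he ?_, h⟩
  have h1 : d + expInd σ ≤ e + expInd σ := by
    rw [h]; exact add_le_add_right (expInd_mono hσ) d
  exact le_of_add_le_add_right h1

theorem MonomialRegLE.mono {D : Set (V →₀ ℕ)} {r r' : ℤ} (h : MonomialRegLE K ρ D r)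
    (hr : r ≤ r') : MonomialRegLE K ρ D r' :=
  fun i α hi => h i α (hr.trans_lt hi)

theorem koszulAcyclic_empty (i : ℕ) : KoszulAcyclic K ρ (∅ : Set (Finset V)) i :=
  fun _ _ _ => ⟨0, by simp, by simp⟩

theorem monomialRegLE_empty (r : ℤ) : MonomialRegLE K ρ (∅ : Set (V →₀ ℕ)) r := by
  intro i α _
  have : koszulFamily (∅ : Set (V →₀ ℕ)) α = ∅ := by ext; simp [koszulFamily]
  rw [this]
  exact koszulAcyclic_empty i

section Exact

variable {D D' : Set (V →₀ ℕ)} (hρ : Function.Injective ρ) (hD : D.OrdConnected) (hsub : D' ⊆ D)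
  (hup : ∀ d ∈ D', ∀ e ∈ D, d ≤ e → e ∈ D')
include hρ hD hsub hup

/-- For the exact sequence 0 → D' → D → D \ D' → 0, where `hup` says that `D'` spans a submodule. In
the two lemmas that follow, the connecting map changes the homological degree by one at fixed
multidegree, which produces the r + 1 and the r - 1. -/
theorem MonomialRegLE.extension {r : ℤ} (h₁ : MonomialRegLE K ρ D' r)
    (h₂ : MonomialRegLE K ρ (D \ D') r) : MonomialRegLE K ρ D r := by
  intro i α hi
  refine KoszulAcyclic.extension hρ (koszulFamily_ordConnected hD α) (koszulFamily_mono hsub α)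
    (koszulFamily_lower hup α) (h₁ i α hi) ?_
  rw [← koszulFamily_diff]
  exact h₂ i α hi

theorem MonomialRegLE.quotient {r : ℤ} (h : MonomialRegLE K ρ D r)
    (h₁ : MonomialRegLE K ρ D' (r + 1)) : MonomialRegLE K ρ (D \ D') r := by
  intro i α hi
  rw [koszulFamily_diff]
  refine KoszulAcyclic.quotient hρ (koszulFamily_ordConnected hD α) (koszulFamily_mono hsub α)
    (koszulFamily_lower hup α) (h i α hi) ?_
  rintro k rfl
  exact h₁ k α (by push_cast at hi; linarith)

theorem MonomialRegLE.sub {r : ℤ} (h : MonomialRegLE K ρ D r)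
    (h₂ : MonomialRegLE K ρ (D \ D') (r - 1)) : MonomialRegLE K ρ D' r := by
  intro i α hi
  refine KoszulAcyclic.sub hρ (koszulFamily_ordConnected hD α) (koszulFamily_mono hsub α)
    (koszulFamily_lower hup α) (h i α hi) ?_
  rw [← koszulFamily_diff]
  exact h₂ (i + 1) α (by push_cast; linarith)

end Exact

theorem MonomialRegLE.shift {D : Set (V →₀ ℕ)} {r : ℤ} (h : MonomialRegLE K ρ D r) (m : V →₀ ℕ) :
    MonomialRegLE K ρ {d | ∃ e ∈ D, d = e + m} (r + m.degree) := by
  intro i α hi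
  by_cases hm : m ≤ α
  · obtain ⟨β, rfl⟩ := exists_add_of_le hm
    have : koszulFamily {d | ∃ e ∈ D, d = e + m} (m + β) = koszulFamily D β := by
      ext τ
      constructor
      · rintro ⟨_, ⟨e, he, rfl⟩, h⟩
        refine ⟨e, he, ?_⟩
        rw [add_comm e m, add_assoc] at h
        exact add_left_cancel h
      · rintro ⟨e, he, rfl⟩
        exact ⟨e + m, ⟨e, he, rfl⟩, by rw [add_comm e m, add_assoc]⟩
    rw [this]
    refine h i β ?_
    rw [map_add] at hi
    push_cast at hi
    linarith
  · have : koszulFamily {d | ∃ e ∈ D, d = e + m} α = ∅ := by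
      ext τ
      simp only [Set.mem_empty_iff_false, iff_false]
      rintro ⟨_, ⟨e, he, rfl⟩, h⟩
      apply hm
      rw [← h, add_comm e m, add_assoc]
      exact le_self_add
    rw [this]
    exact koszulAcyclic_empty i

theorem mem_koszulFamily_univ {α : V →₀ ℕ} {τ : Finset V} :
    τ ∈ koszulFamily Set.univ α ↔ ∀ v ∈ τ, 1 ≤ α v := by
  constructor
  · rintro ⟨d, -, rfl⟩ v hv
    simp [expInd_apply, hv]
  · intro h
    have hle : expInd τ ≤ α := by
      intro v
      rw [expInd_apply]
      split_ifs with hv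
      · exact h v hv
      · exact Nat.zero_le _
    exact ⟨α - expInd τ, trivial, tsub_add_cancel_of_le hle⟩

/-- If `v` occurs in α, adjoining `v` to a set keeps it in the family, and "insert v" is a
contracting homotopy. -/
theorem koszulAcyclic_univ (hρ : Function.Injective ρ) {α : V →₀ ℕ} (hα : α ≠ 0) (i : ℕ) :
    KoszulAcyclic K ρ (koszulFamily Set.univ α) i := by
  obtain ⟨v, hv⟩ := Finsupp.ne_iff.1 hα
  have hv1 : 1 ≤ α v := Nat.one_le_iff_ne_zero.2 hv
  intro c hc hcyc
  refine ⟨fun τ => if v ∈ τ then koszulSign ρ v (τ.erase v) • c (τ.erase v) else 0,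
    fun τ hτ => ?_, fun σ hσ => ?_⟩
  · by_cases hvτ : v ∈ τ
    · simp only [hvτ, if_true] at hτ
      have hne : c (τ.erase v) ≠ 0 := fun h => hτ (by simp [h])
      obtain ⟨h1, h2⟩ := hc _ hne
      refine ⟨mem_koszulFamily_univ.2 fun w hw => ?_, ?_⟩
      · by_cases hwv : w = v
        · rw [hwv]; exact hv1
        · exact mem_koszulFamily_univ.1 h1 w (Finset.mem_erase.2 ⟨hwv, hw⟩)
      · rw [Finset.card_erase_of_mem hvτ] at h2
        have := Finset.card_pos.2 ⟨v, hvτ⟩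
        omega
    · simp [hvτ] at hτ
  · by_cases hvσ : v ∈ σ
    · obtain ⟨σ', hvσ', rfl⟩ : ∃ σ', v ∉ σ' ∧ σ = insert v σ' :=
        ⟨σ.erase v, Finset.notMem_erase _ _, (Finset.insert_erase hvσ).symm⟩
      have hσ' : σ' ∈ koszulFamily Set.univ α :=
        mem_koszulFamily_univ.2 fun w hw =>
          mem_koszulFamily_univ.1 hσ w (Finset.mem_insert_of_mem hw)
      have hz := hcyc σ' hσ'
      unfold koszulD at hz ⊢
      have hcompl : σ'ᶜ = insert v (insert v σ')ᶜ := by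
        ext w
        simp only [Finset.mem_compl, Finset.mem_insert]
        by_cases hwv : w = v
        · subst hwv; simp [hvσ']
        · simp [hwv]
      rw [hcompl, Finset.sum_insert (by simp)] at hz
      have hsum : ∀ w ∈ (insert v σ')ᶜ, koszulSign ρ w (insert v σ') • (1 : V → K) w •
          (if v ∈ insert w (insert v σ') then
            koszulSign ρ v ((insert w (insert v σ')).erase v) •
              c ((insert w (insert v σ')).erase v) else 0) =
          -(koszulSign ρ v σ' • (koszulSign ρ w σ' • (1 : V → K) w • c (insert w σ'))) := by
        intro w hw
        simp only [Finset.mem_compl, Finset.mem_insert, not_or] at hw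
        have he : (insert w (insert v σ')).erase v = insert w σ' := by
          rw [Finset.insert_comm, Finset.erase_insert]
          simp [hvσ', Ne.symm hw.1]
        have hs : koszulSign ρ w (insert v σ') * koszulSign ρ v (insert w σ') =
            -(koszulSign ρ v σ' * koszulSign ρ w σ') := by
          have h1 := koszulSign_swap hρ (Ne.symm hw.1) hvσ' hw.2
          have h2 := koszulSign_mul_self ρ v σ'
          have h3 := koszulSign_mul_self ρ v (insert w σ')
          linear_combination (koszulSign ρ v σ' * koszulSign ρ v (insert w σ')) * h1 -
            (koszulSign ρ w (insert v σ') * koszulSign ρ v (insert w σ')) * h2 -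
            (koszulSign ρ v σ' * koszulSign ρ w σ') * h3
        rw [he, if_pos (by simp)]
        simp only [Pi.one_apply, one_smul, smul_smul]
        rw [hs, neg_smul]
      rw [Finset.sum_congr rfl hsum, Finset.sum_neg_distrib, ← Finset.smul_sum,
        eq_neg_of_add_eq_zero_right hz, smul_neg, neg_neg, koszulSign_smul_smul, Pi.one_apply,
        one_smul]
    · unfold koszulD
      rw [Finset.sum_eq_single v]
      · simp only [Finset.mem_insert_self, if_true, Finset.erase_insert hvσ, Pi.one_apply, one_smul]
        exact koszulSign_smul_smul ρ v σ (c σ)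
      · intro w _ hwv
        have : v ∉ insert w σ := by simp [hvσ, Ne.symm hwv]
        simp [this]
      · simp [hvσ]

theorem monomialRegLE_univ (hρ : Function.Injective ρ) :
    MonomialRegLE K ρ (Set.univ : Set (V →₀ ℕ)) 0 := by
  intro i α hi
  refine koszulAcyclic_univ hρ ?_ i
  rintro rfl
  simp at hi
  omega

theorem IsLowerSet.preimage_add {D : Set (V →₀ ℕ)} (hD : IsLowerSet D) (m : V →₀ ℕ) :
    IsLowerSet {d | d + m ∈ D} :=
  fun _ _ hab h => hD (add_le_add_left hab m) h

/-- Regularity bound from the colon by a variable and the quotient by that variable. -/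
theorem MonomialRegLE.of_variable (hρ : Function.Injective ρ) {D : Set (V →₀ ℕ)}
    (hD : IsLowerSet D) (v : V) {r : ℤ}
    (h₁ : MonomialRegLE K ρ {d | d + Finsupp.single v 1 ∈ D} (r - 1))
    (h₂ : MonomialRegLE K ρ {d | d v = 0 ∧ d ∈ D} r) : MonomialRegLE K ρ D r := by
  -- The multiples of x_v in S/I form the submodule x_v · S/I, a copy of S/(I : x_v) shifted by one
  -- degree.
  refine MonomialRegLE.extension (D' := {d | 1 ≤ d v ∧ d ∈ D}) hρ hD.ordConnected
    (fun d h => h.2) (fun d hd e he hle => ⟨hd.1.trans (hle v), he⟩) ?_ ?_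
  · have := h₁.shift (Finsupp.single v 1)
    rw [Finsupp.degree_single] at this
    convert this using 1
    · ext d
      constructor
      · rintro ⟨h1, h2⟩
        have hle : Finsupp.single v 1 ≤ d := by simpa using h1
        exact ⟨d - Finsupp.single v 1, by simpa [tsub_add_cancel_of_le hle] using h2,
          (tsub_add_cancel_of_le hle).symm⟩
      · rintro ⟨e, he, rfl⟩
        exact ⟨by simp, he⟩
    · push_cast; ring
  · convert h₂ using 1
    ext d
    simp only [Set.mem_sdiff, Set.mem_ofPred_eq]
    constructor
    · rintro ⟨h1, h2⟩
      refine ⟨?_, h1⟩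
      by_contra h0
      exact h2 ⟨Nat.one_le_iff_ne_zero.2 h0, h1⟩
    · rintro ⟨h1, h2⟩
      exact ⟨h2, fun h => by omega⟩

/-- Setting to zero a variable that does not occur does not increase the regularity. -/
theorem MonomialRegLE.kill (hρ : Function.Injective ρ) {D : Set (V →₀ ℕ)} (hD : IsLowerSet D)
    (v : V) {r : ℤ} (h : MonomialRegLE K ρ D r)
    (hv : ∀ d ∈ D, d + Finsupp.single v 1 ∈ D) : MonomialRegLE K ρ {d | d v = 0 ∧ d ∈ D} r := by
  have h1 := h.shift (Finsupp.single v 1)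
  rw [Finsupp.degree_single, Nat.cast_one] at h1
  have := MonomialRegLE.quotient (D' := {d | ∃ e ∈ D, d = e + Finsupp.single v 1}) hρ
    hD.ordConnected (fun d hd => by obtain ⟨e, he, rfl⟩ := hd; exact hv e he) ?_ h h1
  · convert this using 1
    ext d
    simp only [Set.mem_sdiff, Set.mem_ofPred_eq]
    constructor
    · rintro ⟨h1, h2⟩
      refine ⟨h2, ?_⟩
      rintro ⟨e, he, rfl⟩
      simp at h1
    · rintro ⟨h1, h2⟩
      refine ⟨?_, h1⟩
      by_contra h0
      have hle : Finsupp.single v 1 ≤ d := by simpa using Nat.one_le_iff_ne_zero.2 h0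
      exact h2 ⟨d - Finsupp.single v 1, hD tsub_le_self h1, (tsub_add_cancel_of_le hle).symm⟩
  · rintro _ ⟨e, he, rfl⟩ d hd hle
    have hle' : Finsupp.single v 1 ≤ d := (le_add_of_nonneg_left (zero_le)).trans hle
    exact ⟨d - Finsupp.single v 1, hD tsub_le_self hd, (tsub_add_cancel_of_le hle').symm⟩

end MultigradedRegularity

/-! ### Matchings of weighted paths and König duality. -/

section PathMatching

/-- The largest size of a `b`-matching of a path with vertex capacities `l`. -/
def pathMatch : List ℕ → ℕ
  | [] => 0
  | [_] => 0
  | a :: b :: l => min a b + pathMatch ((b - a) :: l)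
termination_by l => l.length

theorem pathMatch_nil : pathMatch [] = 0 := by simp [pathMatch]

theorem pathMatch_singleton (a : ℕ) : pathMatch [a] = 0 := by simp [pathMatch]

theorem pathMatch_cons_cons (a b : ℕ) (l : List ℕ) :
    pathMatch (a :: b :: l) = min a b + pathMatch ((b - a) :: l) := by
  rw [pathMatch]

theorem pathMatch_zero_cons (l : List ℕ) : pathMatch (0 :: l) = pathMatch l := by
  cases l <;> simp [pathMatch]

theorem pathMatch_cons_zero (a : ℕ) (l : List ℕ) : pathMatch (a :: 0 :: l) = pathMatch l := by
  simp [pathMatch_cons_cons, pathMatch_zero_cons]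

theorem pathMatch_succ_succ (a b : ℕ) (l : List ℕ) :
    pathMatch ((a + 1) :: (b + 1) :: l) = pathMatch (a :: b :: l) + 1 := by
  simp only [pathMatch_cons_cons, Nat.add_sub_add_right]
  omega

variable {V : Type*} [DecidableEq V]

/-- The largest size of a `b`-matching of the path `L` with vertex capacities `d`; a monomial lies
in the `c`-th power of the edge ideal of the path if and only if this number is at least `c`. -/
def pathNu (L : List V) (d : V →₀ ℕ) : ℕ := pathMatch (L.map d)

/-- The weight of the vertices of the path `L` that lie in `C`. -/
def coverWeight (C : V → Bool) (L : List V) (d : V →₀ ℕ) : ℕ :=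
  (L.map fun v => if C v then d v else 0).sum

/-- `C` is a vertex cover of the path `L`. -/
def IsPathCover (C : V → Bool) (L : List V) : Prop := L.IsChain fun u v => C u ∨ C v

theorem map_congr_of_notMem {L : List V} {d e : V →₀ ℕ} (h : ∀ v ∈ L, d v = e v) :
    L.map d = L.map e := List.map_congr_left h

theorem pathNu_congr {L : List V} {d e : V →₀ ℕ} (h : ∀ v ∈ L, d v = e v) :
    pathNu L d = pathNu L e := by
  unfold pathNu; rw [map_congr_of_notMem h]

theorem coverWeight_congr {C : V → Bool} {L : List V} {d e : V →₀ ℕ} (h : ∀ v ∈ L, d v = e v) :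
    coverWeight C L d = coverWeight C L e := by
  unfold coverWeight
  rw [List.map_congr_left fun v hv => by rw [h v hv]]

theorem coverWeight_add (C : V → Bool) (L : List V) (d e : V →₀ ℕ) :
    coverWeight C L (d + e) = coverWeight C L d + coverWeight C L e := by
  unfold coverWeight
  induction L with
  | nil => simp
  | cons a L ih =>
    simp only [List.map_cons, List.sum_cons, Finsupp.add_apply] at ih ⊢
    rw [ih]
    split_ifs <;> ring

theorem coverWeight_cons (C : V → Bool) (v : V) (L : List V) (d : V →₀ ℕ) :
    coverWeight C (v :: L) d = (if C v then d v else 0) + coverWeight C L d := by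
  simp [coverWeight]

theorem coverWeight_reverse (C : V → Bool) (L : List V) (d : V →₀ ℕ) :
    coverWeight C L.reverse d = coverWeight C L d := by
  unfold coverWeight
  rw [List.map_reverse, List.sum_reverse]

theorem coverWeight_single {C : V → Bool} {L : List V} (hL : L.Nodup) {v : V} (hv : v ∈ L)
    (k : ℕ) : coverWeight C L (Finsupp.single v k) = if C v then k else 0 := by
  induction L with
  | nil => simp at hv
  | cons a L ih =>
    rw [coverWeight_cons]
    rw [List.nodup_cons] at hL
    rcases List.mem_cons.1 hv with rfl | h
    · have : coverWeight C L (Finsupp.single v k) = coverWeight C L 0 := by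
        refine coverWeight_congr fun w hw => ?_
        have : v ≠ w := fun h => hL.1 (h ▸ hw)
        simp [this]
      rw [this]
      simp [coverWeight]
    · have hne : v ≠ a := fun h' => hL.1 (h' ▸ h)
      rw [ih hL.2 h]
      simp [hne]

theorem coverWeight_le_of_cover_ne {C C' : V → Bool} {L : List V} {d : V →₀ ℕ}
    (h : ∀ v ∈ L, C v = C' v) : coverWeight C L d = coverWeight C' L d := by
  unfold coverWeight
  rw [List.map_congr_left fun v hv => by rw [h v hv]]

theorem isPathCover_congr {C C' : V → Bool} {L : List V} (h : ∀ v ∈ L, C v = C' v) :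
    IsPathCover C L → IsPathCover C' L := by
  unfold IsPathCover
  intro hC
  rw [List.isChain_iff_getElem] at hC ⊢
  intro i hi
  rw [← h _ (List.getElem_mem _), ← h _ (List.getElem_mem _)]
  exact hC i hi

theorem pathNu_cons_cons {v w : V} {L : List V} (hw : w ∉ L) (d : V →₀ ℕ) :
    pathNu (v :: w :: L) d =
      min (d v) (d w) + pathNu (w :: L) (d.update w (d w - d v)) := by
  unfold pathNu
  simp only [List.map_cons, pathMatch_cons_cons]
  have : L.map (d.update w (d w - d v)) = L.map d :=
    map_congr_of_notMem fun u hu => by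
      have : u ≠ w := fun h => hw (h ▸ hu)
      simp [Finsupp.update_apply, this]
  rw [this]
  simp

theorem coverWeight_update {C : V → Bool} {w : V} {L : List V} (hw : w ∉ L) (d : V →₀ ℕ) (k : ℕ) :
    coverWeight C L (d.update w k) = coverWeight C L d :=
  coverWeight_congr fun u hu => by
    have : u ≠ w := fun h => hw (h ▸ hu)
    simp [Finsupp.update_apply, this]

/-- Weak duality: a `b`-matching is at most as large as a vertex cover. -/
theorem pathNu_le_coverWeight {C : V → Bool} {L : List V} (hL : L.Nodup) (hC : IsPathCover C L)
    (d : V →₀ ℕ) : pathNu L d ≤ coverWeight C L d := by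
  induction L generalizing d with
  | nil => simp [pathNu, pathMatch_nil]
  | cons v L ih =>
    rw [List.nodup_cons] at hL
    rcases L with _ | ⟨w, L⟩
    · simp [pathNu, pathMatch_singleton]
    · have hL' := hL.2
      rw [List.nodup_cons] at hL'
      have hC' : (C v ∨ C w) ∧ IsPathCover C (w :: L) := by
        simpa [IsPathCover, List.isChain_cons_cons] using hC
      have h := ih hL.2 hC'.2 (d.update w (d w - d v))
      rw [pathNu_cons_cons hL'.1]
      simp only [coverWeight_cons, coverWeight_update hL'.1] at h ⊢
      simp only [Finsupp.coe_update, Function.update_self] at h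
      rcases hC'.1 with h1 | h1 <;> simp only [h1, if_true] at h ⊢ <;> split_ifs at h ⊢ <;> omega

/-- Strong duality (König's theorem for paths). -/
theorem exists_coverWeight_eq {L : List V} (hL : L.Nodup) (d : V →₀ ℕ) :
    ∃ C : V → Bool, IsPathCover C L ∧ coverWeight C L d = pathNu L d := by
  induction L generalizing d with
  | nil => exact ⟨fun _ => false, List.isChain_nil, by simp [coverWeight, pathNu, pathMatch_nil]⟩
  | cons v L ih =>
    rw [List.nodup_cons] at hL
    rcases L with _ | ⟨w, L⟩
    · exact ⟨fun _ => false, List.isChain_singleton _,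
        by simp [coverWeight, pathNu, pathMatch_singleton]⟩
    · have hL' := hL.2
      rw [List.nodup_cons] at hL'
      obtain ⟨C, hC, hw⟩ := ih hL.2 (d.update w (d w - d v))
      rw [pathNu_cons_cons hL'.1, ← hw]
      have hvw : v ≠ w := fun h => hL.1 (by simp [h])
      have hvL : v ∉ L := fun h => hL.1 (by simp [h])
      -- The greedy step exhausts `v` or `w`. If `v` is exhausted first, whichever of `v`, `w` the
      -- old cover leaves to be chosen costs exactly min(d v, d w) more; otherwise `w` has residual
      -- capacity 0 and can be put into the cover in place of `v`.
      by_cases hlt : d v < d w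
      · by_cases hCw : C w
        · have hag : ∀ u ∈ w :: L, C u = Function.update C v false u := fun u hu => by
            have : u ≠ v := fun h => hL.1 (h ▸ hu)
            simp [this]
          refine ⟨Function.update C v false, ?_, ?_⟩
          · rw [IsPathCover, List.isChain_cons_cons]
            exact ⟨Or.inr (by simp [hvw.symm, hCw]), isPathCover_congr hag hC⟩
          · rw [coverWeight_cons, ← coverWeight_le_of_cover_ne hag]
            simp only [coverWeight_cons, coverWeight_update hL'.1, hCw, if_true,
              Finsupp.coe_update, Function.update_self]
            simp
            omega
        · have hag : ∀ u ∈ w :: L, C u = Function.update C v true u := fun u hu => by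
            have : u ≠ v := fun h => hL.1 (h ▸ hu)
            simp [this]
          refine ⟨Function.update C v true, ?_, ?_⟩
          · rw [IsPathCover, List.isChain_cons_cons]
            exact ⟨Or.inl (by simp), isPathCover_congr hag hC⟩
          · rw [coverWeight_cons, ← coverWeight_le_of_cover_ne hag]
            simp only [coverWeight_cons, coverWeight_update hL'.1, hCw,
              Finsupp.coe_update, Function.update_self]
            simp
            omega
      · have hag : ∀ u ∈ L, C u = Function.update (Function.update C w true) v false u :=
          fun u hu => by
            have h1 : u ≠ v := fun h => hvL (h ▸ hu)
            have h2 : u ≠ w := fun h => hL'.1 (h ▸ hu)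
            simp [h1, h2]
        refine ⟨Function.update (Function.update C w true) v false, ?_, ?_⟩
        · have hCL : IsPathCover C L := hC.tail
          rw [IsPathCover, List.isChain_cons_cons]
          refine ⟨Or.inr (by simp [hvw.symm]), ?_⟩
          have := isPathCover_congr hag hCL
          rw [List.isChain_cons]
          exact ⟨fun u _ => Or.inl (by simp [hvw.symm]), this⟩
        · rw [coverWeight_cons, coverWeight_cons, ← coverWeight_le_of_cover_ne hag]
          simp only [coverWeight_cons, coverWeight_update hL'.1,
              Finsupp.coe_update, Function.update_self]
          simp [hvw.symm, show d w - d v = 0 by omega, show min (d v) (d w) = d w by omega]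

section Consequences

variable {L : List V} {v w u y : V} {d e : V →₀ ℕ}

theorem pathNu_mono (hL : L.Nodup) (h : d ≤ e) : pathNu L d ≤ pathNu L e := by
  obtain ⟨C, hC, hw⟩ := exists_coverWeight_eq hL e
  obtain ⟨f, rfl⟩ := exists_add_of_le h
  rw [coverWeight_add] at hw
  have := pathNu_le_coverWeight hL hC d
  omega

/-- The greedy recursion is not symmetric, but the dual description by covers is. -/
theorem pathNu_reverse (hL : L.Nodup) (d : V →₀ ℕ) : pathNu L.reverse d = pathNu L d := by
  have aux : ∀ L : List V, L.Nodup → pathNu L.reverse d ≤ pathNu L d := by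
    intro L hL
    obtain ⟨C, hC, hw⟩ := exists_coverWeight_eq hL d
    rw [← hw, ← coverWeight_reverse]
    refine pathNu_le_coverWeight (List.nodup_reverse.2 hL) ?_ d
    unfold IsPathCover
    rw [List.isChain_reverse]
    exact hC.imp fun _ _ h => h.symm
  refine le_antisymm (aux L hL) ?_
  have := aux L.reverse (List.nodup_reverse.2 hL)
  rwa [List.reverse_reverse] at this

theorem pathNu_add_single_of_notMem (hv : v ∉ L) (d : V →₀ ℕ) (k : ℕ) :
    pathNu L (d + Finsupp.single v k) = pathNu L d :=
  pathNu_congr fun u hu => by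
    have : v ≠ u := fun h => hv (h ▸ hu)
    simp [this]

theorem pathNu_add_single_le (hL : L.Nodup) (v : V) (d : V →₀ ℕ) :
    pathNu L (d + Finsupp.single v 1) ≤ pathNu L d + 1 := by
  by_cases hv : v ∈ L
  · obtain ⟨C, hC, hw⟩ := exists_coverWeight_eq hL d
    have := pathNu_le_coverWeight hL hC (d + Finsupp.single v 1)
    rw [coverWeight_add, coverWeight_single hL hv] at this
    split_ifs at this <;> omega
  · rw [pathNu_add_single_of_notMem hv]; omega

theorem pathNu_cons_of_eq_zero (h : d v = 0) : pathNu (v :: L) d = pathNu L d := by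
  simp [pathNu, h, pathMatch_zero_cons]

theorem pathNu_cons_cons_of_eq_zero (h : d w = 0) : pathNu (v :: w :: L) d = pathNu L d := by
  simp [pathNu, h, pathMatch_cons_zero]

/-- An end edge may always be used by an optimal matching. In terms of ideals: J^(c+1) : x_v x_w =
J^c for an end edge v w, the identity behind every induction on the exponent. -/
theorem pathNu_cons_cons_add (hL : (v :: w :: L).Nodup) (d : V →₀ ℕ) :
    pathNu (v :: w :: L) (d + Finsupp.single v 1 + Finsupp.single w 1) =
      pathNu (v :: w :: L) d + 1 := by
  simp only [List.nodup_cons, List.mem_cons, not_or] at hL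
  unfold pathNu
  have h1 : L.map (d + Finsupp.single v 1 + Finsupp.single w 1 : V →₀ ℕ) = L.map d :=
    map_congr_of_notMem fun u hu => by
      have h1 : v ≠ u := fun h => hL.1.2 (h ▸ hu)
      have h2 : w ≠ u := fun h => hL.2.1 (h ▸ hu)
      simp [h1, h2]
  simp only [List.map_cons, h1]
  rw [← pathMatch_succ_succ]
  simp [hL.1.1, Ne.symm hL.1.1]

theorem pathNu_append_of_eq_zero (hL : (L ++ [u]).Nodup) (h : d u = 0) :
    pathNu (L ++ [u]) d = pathNu L d := by
  rw [← pathNu_reverse hL, List.reverse_append, ← pathNu_reverse hL.of_append_left]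
  exact pathNu_cons_of_eq_zero h

theorem pathNu_append_append_of_eq_zero (hL : (L ++ [y, u]).Nodup) (h : d y = 0) :
    pathNu (L ++ [y, u]) d = pathNu L d := by
  rw [← pathNu_reverse hL, List.reverse_append, ← pathNu_reverse hL.of_append_left]
  exact pathNu_cons_cons_of_eq_zero h

theorem pathNu_append_append_add (hL : (L ++ [y, u]).Nodup) (d : V →₀ ℕ) :
    pathNu (L ++ [y, u]) (d + Finsupp.single y 1 + Finsupp.single u 1) =
      pathNu (L ++ [y, u]) d + 1 := by
  rw [← pathNu_reverse hL, ← pathNu_reverse hL d, List.reverse_append, add_right_comm]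
  refine pathNu_cons_cons_add (L := L.reverse) ?_ d
  have := List.nodup_reverse.2 hL
  rwa [List.reverse_append] at this

/-- The edge v w enters only through the property that every cover contains one of its ends, so its
position in the list is irrelevant. -/
theorem pathNu_add_edge (hL : L.Nodup) (hv : v ∈ L) (hw : w ∈ L)
    (hvw : ∀ C : V → Bool, IsPathCover C L → C v ∨ C w) (d : V →₀ ℕ) :
    pathNu L d + 1 ≤ pathNu L (d + Finsupp.single v 1 + Finsupp.single w 1) := by
  obtain ⟨C, hC, hwt⟩ := exists_coverWeight_eq hL (d + Finsupp.single v 1 + Finsupp.single w 1)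
  rw [← hwt, coverWeight_add, coverWeight_add, coverWeight_single hL hv, coverWeight_single hL hw]
  have := pathNu_le_coverWeight hL hC d
  rcases hvw C hC with h | h <;> simp only [h, if_true] <;> omega

/-- If raising the capacities of `v` and `u` by one does not enlarge the matching, then raising
them arbitrarily does not enlarge it either. -/
theorem pathNu_add_le_of_add_one_le (hL : L.Nodup) (hv : v ∈ L) (hu : u ∈ L)
    (h : pathNu L (d + Finsupp.single v 1 + Finsupp.single u 1) ≤ pathNu L d) (p : ℕ) :
    pathNu L (d + Finsupp.single v p + Finsupp.single u p) ≤ pathNu L d := by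
  -- By `h` this optimal cover can contain neither `v` nor `u`, so its weight ignores any further
  -- increase at these vertices.
  obtain ⟨C, hC, hwt⟩ := exists_coverWeight_eq hL (d + Finsupp.single v 1 + Finsupp.single u 1)
  have h1 := pathNu_le_coverWeight hL hC d
  have h2 := pathNu_le_coverWeight hL hC (d + Finsupp.single v p + Finsupp.single u p)
  rw [coverWeight_add, coverWeight_add, coverWeight_single hL hv, coverWeight_single hL hu] at hwt h2
  split_ifs at hwt h2 <;> omega

end Consequences

end PathMatching

/-! ### Regularity for powers of path ideals and related colon ideals. -/

section PathRegularity

variable {V : Type*} [Fintype V] [DecidableEq V] {K : Type*} [Field K] {ρ : V → ℕ}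

theorem isLowerSet_pathNu_le {L : List V} (hL : L.Nodup) (m : V →₀ ℕ) (c : ℕ) :
    IsLowerSet {d : V →₀ ℕ | pathNu L (d + m) ≤ c} :=
  fun _ _ hab h => (pathNu_mono hL (add_le_add_left hab m)).trans h

theorem isLowerSet_pathNu_le' {L : List V} (hL : L.Nodup) (c : ℕ) :
    IsLowerSet {d : V →₀ ℕ | pathNu L d ≤ c} :=
  fun _ _ hab h => (pathNu_mono hL hab).trans h

theorem MonomialRegLE.of_iff {D D' : Set (V →₀ ℕ)} {r r' : ℤ} (h : MonomialRegLE K ρ D r)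
    (hD : ∀ d, d ∈ D' ↔ d ∈ D) (hr : r ≤ r') : MonomialRegLE K ρ D' r' := by
  rw [Set.ext hD]; exact h.mono hr

theorem monomialRegLE_of_subset_empty {D : Set (V →₀ ℕ)} (h : ∀ d, d ∉ D) (r : ℤ) :
    MonomialRegLE K ρ D r := by
  rw [Set.eq_empty_iff_forall_notMem.2 h]
  exact monomialRegLE_empty r

/-- The regularity of the powers of the edge ideal of a path is at most the expected value. -/
theorem monomialRegLE_path (hρ : Function.Injective ρ) (L : List V) (hL : L.Nodup) (c : ℕ) :
    MonomialRegLE K ρ {d | pathNu L d ≤ c} (2 * c + ((L.length + 1) / 3 : ℕ)) := by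
  induction hN : L.length + c using Nat.strong_induction_on generalizing L c with
  | _ N ih =>
  subst hN
  rcases L with _ | ⟨v, _ | ⟨w, L⟩⟩
  · have : {d : V →₀ ℕ | pathNu [] d ≤ c} = Set.univ := by
      ext d; simp [pathNu, pathMatch_nil]
    rw [this]
    exact (monomialRegLE_univ hρ).mono (by positivity)
  · have : {d : V →₀ ℕ | pathNu [v] d ≤ c} = Set.univ := by
      ext d; simp [pathNu, pathMatch_singleton]
    rw [this]
    exact (monomialRegLE_univ hρ).mono (by positivity)
  have hL' := hL
  simp only [List.nodup_cons, List.mem_cons, not_or] at hL'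
  obtain ⟨⟨hvw, hvL⟩, hwL, hLn⟩ := hL'
  have hlen : (v :: w :: L).length = L.length + 2 := rfl
  -- Branch on the second vertex `w`, then on `v`, then on the third vertex `x`. Setting `w` to zero
  -- removes two vertices. After a colon by `w` the bound has to drop by one: a further colon by a
  -- neighbour lowers `c`, and setting `v` and `x` to zero leaves a path with three vertices fewer,
  -- which lowers ⌊(length + 1)/3⌋ by exactly one.
  refine MonomialRegLE.of_variable hρ (isLowerSet_pathNu_le' hL c) w ?_ ?_
  · refine MonomialRegLE.of_variable hρ (isLowerSet_pathNu_le hL _ c) v ?_ ?_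
    · rcases c with _ | c
      · refine monomialRegLE_of_subset_empty (fun d h => ?_) _
        simp only [Set.mem_ofPred_eq, pathNu_cons_cons_add hL] at h
        omega
      · have : {d : V →₀ ℕ | d + Finsupp.single v 1 ∈
            {d | pathNu (v :: w :: L) (d + Finsupp.single w 1) ≤ c + 1}} =
            {d | pathNu (v :: w :: L) d ≤ c} := by
          ext d
          simp only [Set.mem_ofPred_eq, pathNu_cons_cons_add hL]
          omega
        rw [this]
        refine (ih _ ?_ _ hL c rfl).mono ?_
        · simp
        · push_cast; linarith
    · have hn : (w :: L).Nodup := by simp [hwL, hLn]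
      have : {d : V →₀ ℕ | d v = 0 ∧ d ∈
            {d | pathNu (v :: w :: L) (d + Finsupp.single w 1) ≤ c}} =
            {d | d v = 0 ∧ d ∈ {d | pathNu (w :: L) (d + Finsupp.single w 1) ≤ c}} := by
        ext d
        simp only [Set.mem_ofPred_eq]
        refine and_congr_right fun h => ?_
        rw [pathNu_cons_of_eq_zero (by simp [h, Ne.symm hvw])]
      rw [this]
      refine MonomialRegLE.kill hρ (isLowerSet_pathNu_le hn _ c) v ?_ ?_
      · rcases L with _ | ⟨x, L⟩
        · have : {d : V →₀ ℕ | pathNu [w] (d + Finsupp.single w 1) ≤ c} = Set.univ := by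
            ext d; simp [pathNu, pathMatch_singleton]
          rw [this]
          refine (monomialRegLE_univ hρ).mono ?_
          simp only [hlen, List.length_nil]
          norm_num
        · have hn' := hn
          simp only [List.nodup_cons, List.mem_cons, not_or] at hn'
          obtain ⟨⟨hwx, hwL⟩, hxL, hLn⟩ := hn'
          refine MonomialRegLE.of_variable hρ (isLowerSet_pathNu_le hn _ c) x ?_ ?_
          · rcases c with _ | c
            · refine monomialRegLE_of_subset_empty (fun d h => ?_) _
              simp only [Set.mem_ofPred_eq, add_right_comm d (Finsupp.single x 1),
                pathNu_cons_cons_add hn] at h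
              omega
            · have : {d : V →₀ ℕ | d + Finsupp.single x 1 ∈
                  {d | pathNu (w :: x :: L) (d + Finsupp.single w 1) ≤ c + 1}} =
                  {d | pathNu (w :: x :: L) d ≤ c} := by
                ext d
                simp only [Set.mem_ofPred_eq, add_right_comm d (Finsupp.single x 1),
                  pathNu_cons_cons_add hn]
                omega
              rw [this]
              refine (ih _ ?_ _ hn c rfl).mono ?_
              · simp; omega
              · simp only [List.length_cons]; omega
          · have : {d : V →₀ ℕ | d x = 0 ∧ d ∈
                  {d | pathNu (w :: x :: L) (d + Finsupp.single w 1) ≤ c}} =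
                  {d | d x = 0 ∧ d ∈ {d | pathNu L d ≤ c}} := by
              ext d
              simp only [Set.mem_ofPred_eq]
              refine and_congr_right fun h => ?_
              rw [pathNu_cons_cons_of_eq_zero (by simp [h, hwx]),
                pathNu_add_single_of_notMem hwL]
            rw [this]
            refine MonomialRegLE.kill hρ (isLowerSet_pathNu_le' hLn c) x ?_ ?_
            · refine (ih _ ?_ _ hLn c rfl).mono ?_
              · simp; omega
              · simp only [List.length_cons]; omega
            · intro d hd
              simpa [pathNu_add_single_of_notMem hxL] using hd
      · intro d hd
        simp only [Set.mem_ofPred_eq] at hd ⊢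
        rwa [add_right_comm, pathNu_add_single_of_notMem (by simp [hvw, hvL])]
  · have : {d : V →₀ ℕ | d w = 0 ∧ d ∈ {d | pathNu (v :: w :: L) d ≤ c}} =
        {d | d w = 0 ∧ d ∈ {d | pathNu L d ≤ c}} := by
      ext d
      simp only [Set.mem_ofPred_eq]
      refine and_congr_right fun h => ?_
      rw [pathNu_cons_cons_of_eq_zero h]
    rw [this]
    refine MonomialRegLE.kill hρ (isLowerSet_pathNu_le' hLn c) w ?_ ?_
    · refine (ih _ ?_ _ hLn c rfl).mono ?_
      · simp
      · simp only [List.length_cons]; omega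
    · intro d hd
      simpa [pathNu_add_single_of_notMem hwL] using hd

/-- The regularity of the colon of a power of the edge ideal of a path by an end vertex. -/
theorem monomialRegLE_path_colon_end (hρ : Function.Injective ρ) {u y : V} {L : List V}
    (hL : (u :: y :: L).Nodup) (c : ℕ) :
    MonomialRegLE K ρ {d | pathNu (u :: y :: L) (d + Finsupp.single u 1) ≤ c}
      (2 * c + ((L.length + 1) / 3 : ℕ)) := by
  have hL' := hL
  simp only [List.nodup_cons, List.mem_cons, not_or] at hL'
  obtain ⟨⟨huy, huL⟩, hyL, hLn⟩ := hL'
  rcases c with _ | c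
  -- Colon by the neighbour `y` completes the end edge and lowers the exponent (to the unit ideal
  -- here); setting `y` to zero isolates `u`.
  · refine MonomialRegLE.of_variable hρ (isLowerSet_pathNu_le hL _ _) y ?_ ?_
    · refine monomialRegLE_of_subset_empty (fun d h => ?_) _
      simp only [Set.mem_ofPred_eq, add_right_comm d (Finsupp.single y 1),
        pathNu_cons_cons_add hL] at h
      omega
    · have : {d : V →₀ ℕ | d y = 0 ∧ d ∈
            {d | pathNu (u :: y :: L) (d + Finsupp.single u 1) ≤ 0}} =
            {d | d y = 0 ∧ d ∈ {d | pathNu L d ≤ 0}} := by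
        ext d
        simp only [Set.mem_ofPred_eq]
        refine and_congr_right fun h => ?_
        rw [pathNu_cons_cons_of_eq_zero (by simp [h, huy]), pathNu_add_single_of_notMem huL]
      rw [this]
      refine MonomialRegLE.kill hρ (isLowerSet_pathNu_le' hLn _) y
        (monomialRegLE_path hρ L hLn _) fun d hd => ?_
      simpa [pathNu_add_single_of_notMem hyL] using hd
  · refine MonomialRegLE.of_variable hρ (isLowerSet_pathNu_le hL _ _) y ?_ ?_
    · have : {d : V →₀ ℕ | d + Finsupp.single y 1 ∈
          {d | pathNu (u :: y :: L) (d + Finsupp.single u 1) ≤ c + 1}} =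
          {d | pathNu (u :: y :: L) d ≤ c} := by
        ext d
        simp only [Set.mem_ofPred_eq, add_right_comm d (Finsupp.single y 1),
          pathNu_cons_cons_add hL]
        omega
      rw [this]
      refine MonomialRegLE.mono (monomialRegLE_path hρ _ hL c) ?_
      simp only [List.length_cons]; omega
    · have : {d : V →₀ ℕ | d y = 0 ∧ d ∈
            {d | pathNu (u :: y :: L) (d + Finsupp.single u 1) ≤ c + 1}} =
            {d | d y = 0 ∧ d ∈ {d | pathNu L d ≤ c + 1}} := by
        ext d
        simp only [Set.mem_ofPred_eq]
        refine and_congr_right fun h => ?_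
        rw [pathNu_cons_cons_of_eq_zero (by simp [h, huy]), pathNu_add_single_of_notMem huL]
      rw [this]
      refine MonomialRegLE.kill hρ (isLowerSet_pathNu_le' hLn _) y
        (monomialRegLE_path hρ L hLn _) fun d hd => ?_
      simpa [pathNu_add_single_of_notMem hyL] using hd

/-- Exponents of the monomials outside the ideal of all `m` with `pathNu L m ≥ c` and
`pathNu L (m * v * u) ≥ c + 1`. -/
def endsSet (L : List V) (v u : V) (c : ℕ) : Set (V →₀ ℕ) :=
  {d | c ≤ pathNu L d → pathNu L (d + Finsupp.single v 1 + Finsupp.single u 1) ≤ c}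

/-- Exponents of the monomials outside the ideal of all `m` with `pathNu L (m * x) ≥ c` and
`pathNu L (m * u) ≥ c`. -/
def colonEndsSet (L : List V) (x u : V) (c : ℕ) : Set (V →₀ ℕ) :=
  {d | c ≤ pathNu L (d + Finsupp.single x 1) → pathNu L (d + Finsupp.single u 1) < c}

theorem isLowerSet_endsSet {L : List V} (hL : L.Nodup) (v u : V) (c : ℕ) :
    IsLowerSet (endsSet L v u c) := by
  intro a b hab h hc
  exact (pathNu_mono hL (add_le_add_left (add_le_add_left hab _) _)).trans
    (h (hc.trans (pathNu_mono hL hab)))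

theorem isLowerSet_colonEndsSet {L : List V} (hL : L.Nodup) (x u : V) (c : ℕ) :
    IsLowerSet (colonEndsSet L x u c) := by
  intro a b hab h hc
  exact (pathNu_mono hL (add_le_add_left hab _)).trans_lt
    (h (hc.trans (pathNu_mono hL (add_le_add_left hab _))))

/-- The half of the induction for `monomialRegLE_ends` that removes the right end: `hW` is the bound
for the path without `u`. Branching on `y`, the colon by y u lowers `c`, the colon by `y` with u = 0
gives `endsSet` on the shorter path, and y = 0 leaves the power of the path ideal of `x :: M`. -/
theorem monomialRegLE_colonEnds (hρ : Function.Injective ρ) {x y u : V} {M : List V}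
    (hL : (x :: (M ++ [y, u])).Nodup)
    (hW : ∀ c, MonomialRegLE K ρ (endsSet (x :: (M ++ [y])) x y c)
      (2 * c + ((M.length + 2) / 3 : ℕ) - 1)) (c : ℕ) :
    MonomialRegLE K ρ (colonEndsSet (x :: (M ++ [y, u])) x u c)
      (2 * c + ((M.length + 4) / 3 : ℕ) - 2) := by
  have hL' := hL
  simp only [List.nodup_cons, List.mem_append, List.mem_cons, List.not_mem_nil, or_false,
    not_or, List.nodup_append] at hL'
  obtain ⟨⟨hxM, hxy, hxu⟩, hM, ⟨hyu, -⟩, hdis⟩ := hL'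
  have hyM : y ∉ M := fun h => hdis y h y (by simp) rfl
  have huM : u ∉ M := fun h => hdis u h u (by simp) rfl
  have hn : (x :: M).Nodup := by simp [hxM, hM]
  have happ : x :: (M ++ [y, u]) = (x :: M) ++ [y, u] := by simp
  have happ' : x :: (M ++ [y, u]) = (x :: (M ++ [y])) ++ [u] := by simp
  have hL₂ : (x :: M ++ [y, u]).Nodup := happ ▸ hL
  have hL₁ : (x :: (M ++ [y]) ++ [u]).Nodup := happ' ▸ hL
  have hn' : (x :: (M ++ [y])).Nodup := hL₁.of_append_left
  have hadd : ∀ d : V →₀ ℕ, pathNu (x :: (M ++ [y, u]))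
      (d + Finsupp.single y 1 + Finsupp.single u 1) = pathNu (x :: (M ++ [y, u])) d + 1 := by
    intro d; rw [happ, pathNu_append_append_add hL₂]
  induction c with
  | zero =>
    refine monomialRegLE_of_subset_empty (fun d h => ?_) _
    simpa using h (Nat.zero_le _)
  | succ c ih =>
    refine MonomialRegLE.of_variable hρ (isLowerSet_colonEndsSet hL _ _ _) y ?_ ?_
    · refine MonomialRegLE.of_variable hρ
        ((isLowerSet_colonEndsSet hL _ _ _).preimage_add _) u ?_ ?_
      · refine ih.of_iff (fun d => ?_) (by push_cast; linarith)
        simp only [colonEndsSet, Set.mem_ofPred_eq]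
        rw [show d + Finsupp.single u 1 + Finsupp.single y 1 + Finsupp.single x 1 =
          d + Finsupp.single x 1 + Finsupp.single y 1 + Finsupp.single u 1 by abel,
          show d + Finsupp.single u 1 + Finsupp.single y 1 + Finsupp.single u 1 =
          d + Finsupp.single u 1 + Finsupp.single y 1 + Finsupp.single u 1 by abel, hadd, hadd]
        simp
      · have : {d : V →₀ ℕ | d u = 0 ∧ d ∈ {d | d + Finsupp.single y 1 ∈
            colonEndsSet (x :: (M ++ [y, u])) x u (c + 1)}} =
            {d | d u = 0 ∧ d ∈ endsSet (x :: (M ++ [y])) x y c} := by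
          ext d
          simp only [colonEndsSet, endsSet, Set.mem_ofPred_eq]
          refine and_congr_right fun h => ?_
          rw [hadd, happ', pathNu_append_of_eq_zero hL₁ (by simp [h, hxu, hyu]),
            pathNu_append_of_eq_zero hL₁ (by simp [h]),
            add_right_comm d (Finsupp.single y 1)]
          omega
        rw [this]
        refine MonomialRegLE.kill hρ (isLowerSet_endsSet hn' _ _ _) u
          ((hW c).mono ?_) fun d hd => ?_
        · push_cast; omega
        · simp only [endsSet, Set.mem_ofPred_eq] at hd ⊢
          rw [show d + Finsupp.single u 1 + Finsupp.single x 1 + Finsupp.single y 1 =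
            d + Finsupp.single x 1 + Finsupp.single y 1 + Finsupp.single u 1 by abel]
          rwa [pathNu_add_single_of_notMem (by simp [Ne.symm hxu, Ne.symm hyu, huM]),
            pathNu_add_single_of_notMem (by simp [Ne.symm hxu, Ne.symm hyu, huM])]
    · have : {d : V →₀ ℕ | d y = 0 ∧ d ∈ colonEndsSet (x :: (M ++ [y, u])) x u (c + 1)} =
          {d | d y = 0 ∧ d ∈ {d | pathNu (x :: M) d ≤ c}} := by
        ext d
        simp only [colonEndsSet, Set.mem_ofPred_eq]
        refine and_congr_right fun h => ?_
        rw [happ, pathNu_append_append_of_eq_zero hL₂ (by simp [h, hxy]),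
          pathNu_append_append_of_eq_zero hL₂ (by simp [h, Ne.symm hyu]),
          pathNu_add_single_of_notMem (v := u) (by simp [huM, Ne.symm hxu])]
        -- With `u` isolated the second condition implies the first by monotonicity, so only the
        -- second one remains.
        have := pathNu_mono hn (d := d) (e := d + Finsupp.single x 1) le_self_add
        omega
      rw [this]
      refine MonomialRegLE.kill hρ (isLowerSet_pathNu_le' hn _) y
        ((monomialRegLE_path hρ _ hn c).mono ?_) fun d hd => ?_
      · simp only [List.length_cons]; push_cast; omega
      · simpa [pathNu_add_single_of_notMem
          (show y ∉ x :: M by simp [hyM, Ne.symm hxy])] using hd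

theorem add_mem_endsSet_succ {L : List V} {v x : V}
    (h : ∀ d : V →₀ ℕ, pathNu L (d + Finsupp.single v 1 + Finsupp.single x 1) = pathNu L d + 1)
    (u : V) (c : ℕ) (d : V →₀ ℕ) :
    d + Finsupp.single v 1 + Finsupp.single x 1 ∈ endsSet L v u (c + 1) ↔ d ∈ endsSet L v u c := by
  simp only [endsSet, Set.mem_ofPred_eq]
  rw [show d + Finsupp.single v 1 + Finsupp.single x 1 + Finsupp.single v 1 + Finsupp.single u 1 =
    d + Finsupp.single v 1 + Finsupp.single u 1 + Finsupp.single v 1 + Finsupp.single x 1 by abel,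
    h, h]
  omega

theorem add_notMem_endsSet_zero {L : List V} {v x : V}
    (h : ∀ d : V →₀ ℕ, pathNu L (d + Finsupp.single v 1 + Finsupp.single x 1) = pathNu L d + 1)
    (u : V) (d : V →₀ ℕ) : d + Finsupp.single v 1 + Finsupp.single x 1 ∉ endsSet L v u 0 := by
  intro hd
  have := hd (Nat.zero_le _)
  rw [show d + Finsupp.single v 1 + Finsupp.single x 1 + Finsupp.single v 1 + Finsupp.single u 1 =
    d + Finsupp.single v 1 + Finsupp.single u 1 + Finsupp.single v 1 + Finsupp.single x 1 by abel,
    h] at this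
  omega

theorem pathNu_pair (v u : V) (d : V →₀ ℕ) : pathNu [v, u] d = min (d v) (d u) := by
  simp [pathNu, pathMatch_cons_cons, pathMatch_singleton]

/-- Two-sided induction, since a round of reductions removes both `v` and `u`. Branch on the
neighbour `x` of `v`: the colon by x v lowers `c`; the colon by `x` with v = 0 gives `colonEndsSet`;
x = 0 gives a colon by the end vertex `u` of a path with three vertices on the left (`v`, `x` and
the edges at them) no longer contributing beyond `M`, `y`, `u`. The outcome involves ⌊n/3⌋, n the
number of vertices, where the path itself has ⌊(n + 1)/3⌋. -/
theorem monomialRegLE_ends (hρ : Function.Injective ρ) {v u : V} {M : List V}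
    (hL : (v :: (M ++ [u])).Nodup) (c : ℕ) :
    MonomialRegLE K ρ (endsSet (v :: (M ++ [u])) v u c)
      (2 * c + ((M.length + 2) / 3 : ℕ) - 1) := by
  induction M using List.bidirectionalRec generalizing v u c with
  | nil =>
    rcases c with _ | c
    · refine monomialRegLE_of_subset_empty (fun d h => ?_) _
      have := h (Nat.zero_le _)
      rw [List.nil_append, pathNu_cons_cons_add hL] at this
      omega
    · have : endsSet (v :: ([] ++ [u])) v u (c + 1) = {d | pathNu [v, u] d ≤ c} := by
        ext d
        simp only [endsSet, Set.mem_ofPred_eq, List.nil_append]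
        rw [pathNu_cons_cons_add hL]
        omega
      rw [this]
      exact (monomialRegLE_path hρ _ hL c).mono (by simp; linarith)
  | singleton z =>
    have hL' := hL
    simp at hL'
    obtain ⟨⟨hvz, hvu⟩, hzu⟩ := hL'
    have hn : [z, u].Nodup := by simp [hzu]
    have hadd : ∀ d : V →₀ ℕ, pathNu [v, z, u] (d + Finsupp.single v 1 + Finsupp.single z 1) =
        pathNu [v, z, u] d + 1 := pathNu_cons_cons_add hL
    induction c using Nat.strong_induction_on with
    | _ c ih₀ =>
    refine MonomialRegLE.of_variable hρ (isLowerSet_endsSet hL _ _ _) z ?_ ?_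
    · refine MonomialRegLE.of_variable hρ ((isLowerSet_endsSet hL _ _ _).preimage_add _) v ?_ ?_
      · rcases c with _ | c
        · exact monomialRegLE_of_subset_empty (fun d => add_notMem_endsSet_zero hadd u d) _
        · exact (ih₀ c (Nat.lt_succ_self c)).of_iff (add_mem_endsSet_succ hadd u c)
            (by push_cast; linarith)
      · refine MonomialRegLE.of_iff (D := {d | d v = 0 ∧ d ∈ {d | pathNu [z, u] d < c}})
          (MonomialRegLE.kill hρ ?_ v (r := 2 * c - 1) ?_ fun d hd => ?_) (fun d => ?_) ?_
        · exact fun a b hab h => (pathNu_mono hn hab).trans_lt h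
        · rcases c with _ | c
          · exact monomialRegLE_of_subset_empty (fun d h => by simp at h) _
          · refine (monomialRegLE_path hρ _ hn c).of_iff (fun d => ?_) ?_
            · simp
            · simp; linarith
        · simpa [pathNu_add_single_of_notMem (show v ∉ [z, u] by simp [hvz, hvu])] using hd
        · simp only [endsSet, Set.mem_ofPred_eq, List.cons_append, List.nil_append]
          refine and_congr_right fun h => ?_
          rw [show d + Finsupp.single z 1 + Finsupp.single v 1 + Finsupp.single u 1 =
            d + Finsupp.single u 1 + Finsupp.single v 1 + Finsupp.single z 1 by abel, hadd,
            pathNu_cons_of_eq_zero (v := v) (L := [z, u]) (by simp [h, Ne.symm hvz]),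
            pathNu_cons_of_eq_zero (v := v) (L := [z, u]) (by simp [h, Ne.symm hvu])]
          -- min(d z + 1, d u) and min(d z, d u + 1) are both at least `c` exactly when min(d z, d
          -- u) is.
          simp [pathNu_pair, hzu, Ne.symm hzu]
          omega
        · simp
    · refine MonomialRegLE.of_iff (D := {d | d z = 0 ∧ d ∈ Set.univ})
          (MonomialRegLE.kill hρ isLowerSet_univ z (monomialRegLE_univ hρ) fun d _ => trivial)
          (fun d => ?_) (by simp)
      simp only [endsSet, Set.mem_ofPred_eq, List.cons_append, List.nil_append]
      refine and_congr_right fun h => ?_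
      rw [pathNu_cons_cons_of_eq_zero (d := d + Finsupp.single v 1 + Finsupp.single u 1)
        (by simp [h, hvz, Ne.symm hzu])]
      simp [pathNu, pathMatch_singleton]
  | cons_append x M y ih =>
    have hLeq : v :: (x :: (M ++ [y]) ++ [u]) = v :: x :: (M ++ [y, u]) := by simp
    rw [hLeq] at hL ⊢
    have hL' := hL
    rw [List.nodup_cons, List.nodup_cons] at hL'
    obtain ⟨hvR, hxR, hR⟩ := hL'
    simp only [List.mem_append, List.mem_cons, List.not_mem_nil, or_false, not_or] at hvR hxR
    obtain ⟨hvx, hvM, hvy, hvu⟩ := hvR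
    obtain ⟨hxM, hxy, hxu⟩ := hxR
    have hxR : (x :: (M ++ [y, u])).Nodup := hL.of_cons
    have hxM' : (x :: (M ++ [y])).Nodup := by
      have : x :: (M ++ [y, u]) = (x :: (M ++ [y])) ++ [u] := by simp
      exact (this ▸ hxR).of_append_left
    have hlen : (x :: (M ++ [y])).length = M.length + 2 := by simp
    rw [hlen]
    have hadd : ∀ d : V →₀ ℕ, pathNu (v :: x :: (M ++ [y, u]))
        (d + Finsupp.single v 1 + Finsupp.single x 1) = pathNu (v :: x :: (M ++ [y, u])) d + 1 :=
      pathNu_cons_cons_add hL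
    induction c using Nat.strong_induction_on with
    | _ c ih₀ =>
    refine MonomialRegLE.of_variable hρ (isLowerSet_endsSet hL _ _ _) x ?_ ?_
    · refine MonomialRegLE.of_variable hρ ((isLowerSet_endsSet hL _ _ _).preimage_add _) v ?_ ?_
      · rcases c with _ | c
        · exact monomialRegLE_of_subset_empty (fun d => add_notMem_endsSet_zero hadd u d) _
        · exact (ih₀ c (Nat.lt_succ_self c)).of_iff (add_mem_endsSet_succ hadd u c)
            (by push_cast; linarith)
      · refine MonomialRegLE.of_iff
          (MonomialRegLE.kill hρ (isLowerSet_colonEndsSet hxR x u c) v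
            (monomialRegLE_colonEnds hρ hxR (ih hxM') c) fun d hd => ?_) (fun d => ?_) ?_
        · simp only [colonEndsSet, Set.mem_ofPred_eq] at hd ⊢
          rw [add_right_comm d _ (Finsupp.single x 1), add_right_comm d _ (Finsupp.single u 1),
            pathNu_add_single_of_notMem (v := v) (by simp [hvx, hvM, hvy, hvu]),
            pathNu_add_single_of_notMem (v := v) (by simp [hvx, hvM, hvy, hvu])]
          exact hd
        · simp only [colonEndsSet, endsSet, Set.mem_ofPred_eq]
          refine and_congr_right fun h => ?_
          rw [show d + Finsupp.single x 1 + Finsupp.single v 1 + Finsupp.single u 1 =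
            d + Finsupp.single u 1 + Finsupp.single v 1 + Finsupp.single x 1 by abel, hadd,
            pathNu_cons_of_eq_zero (v := v) (d := d + Finsupp.single x 1)
              (by simp [h, Ne.symm hvx]),
            pathNu_cons_of_eq_zero (v := v) (d := d + Finsupp.single u 1)
              (by simp [h, Ne.symm hvu])]
          omega
        · push_cast; omega
    · have hRr : (M ++ [y, u]).reverse = u :: y :: M.reverse := by simp
      have hRn : (u :: y :: M.reverse).Nodup := hRr ▸ List.nodup_reverse.2 hR
      have hrev : ∀ d : V →₀ ℕ, pathNu (M ++ [y, u]) d = pathNu (u :: y :: M.reverse) d := by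
        intro d; rw [← hRr, pathNu_reverse hR]
      refine MonomialRegLE.of_iff
          (MonomialRegLE.kill hρ (isLowerSet_pathNu_le hRn (Finsupp.single u 1) c) x
            (monomialRegLE_path_colon_end hρ hRn c) fun d hd => ?_) (fun d => ?_) ?_
      · simp only [Set.mem_ofPred_eq] at hd ⊢
        rw [add_right_comm, pathNu_add_single_of_notMem (v := x) (by simp [hxM, hxy, hxu])]
        exact hd
      · simp only [endsSet, Set.mem_ofPred_eq]
        refine and_congr_right fun h => ?_
        rw [pathNu_cons_cons_of_eq_zero h, pathNu_cons_cons_of_eq_zero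
            (d := d + Finsupp.single v 1 + Finsupp.single u 1)
            (by simp [h, hvx, Ne.symm hxu]), add_right_comm,
          pathNu_add_single_of_notMem (v := v) (by simp [hvM, hvy, hvu]), ← hrev]
        -- Since one variable raises the matching by at most one, `pathNu (d + u) ≤ c` holds
        -- automatically when `pathNu d < c`, so the premise in `endsSet` can be dropped.
        have := pathNu_add_single_le hR u d
        omega
      · simp only [List.length_reverse]; push_cast; omega

end PathRegularity

/-! ### The upper bound for the cycle, by filtration along powers of f. -/

section CycleRegularity

variable {V : Type*} [Fintype V] [DecidableEq V] {K : Type*} [Field K] {ρ : V → ℕ}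

/-- The exponent vector of `(v u)^p`. -/
noncomputable def endsExp (v u : V) (p : ℕ) : V →₀ ℕ := Finsupp.single v p + Finsupp.single u p

theorem endsExp_add (v u : V) (p q : ℕ) : endsExp v u (p + q) = endsExp v u p + endsExp v u q := by
  simp only [endsExp, Finsupp.single_add]; abel

theorem endsExp_mono (v u : V) {p q : ℕ} (h : p ≤ q) : endsExp v u p ≤ endsExp v u q := by
  obtain ⟨r, rfl⟩ := exists_add_of_le h
  rw [endsExp_add]; exact le_self_add

/-- Exponents of the monomials outside `J^t + f J^(t-1) + ⋯ + f^k J^(t-k)`, where `J` is the edge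
ideal of the path `L` and `f = (v u)^ω`. -/
def cycleSet (L : List V) (v u : V) (ω t k : ℕ) : Set (V →₀ ℕ) :=
  {d | ∀ j ≤ k, ∀ e, d = e + endsExp v u (j * ω) → pathNu L e + j < t}

theorem isLowerSet_cycleSet {L : List V} (hL : L.Nodup) (v u : V) (ω t k : ℕ) :
    IsLowerSet (cycleSet L v u ω t k) := by
  intro a b hab h j hj e he
  obtain ⟨f, rfl⟩ := exists_add_of_le hab
  have := h j hj (e + f) (by rw [he]; abel)
  have := pathNu_mono hL (d := e) (e := e + f) le_self_add
  omega

/-- A monomial f^(k+1) e with e ∈ J^c is new at level k + 1 iff e lies outside J^(c+1) : x_v x_u. If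
it is new, comparison with level k gives `pathNu (e + f) ≤ c`; conversely
`pathNu_add_le_of_add_one_le` passes from x_v x_u to all the powers of f needed for the levels j ≤
k. -/
theorem cycleSet_diff {L : List V} (hL : L.Nodup) {v u : V} (hv : v ∈ L) (hu : u ∈ L) {ω : ℕ}
    (hω : 1 ≤ ω) (c k : ℕ) (d : V →₀ ℕ) :
    (d ∈ cycleSet L v u ω (c + (k + 1)) k ∧ d ∉ cycleSet L v u ω (c + (k + 1)) (k + 1)) ↔
      ∃ e ∈ endsSet L v u c \ {d | pathNu L d < c}, d = e + endsExp v u ((k + 1) * ω) := by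
  constructor
  · rintro ⟨h1, h2⟩
    simp only [cycleSet, Set.mem_ofPred_eq, not_forall, not_lt] at h2
    obtain ⟨j, hj, e, rfl, h3⟩ := h2
    rcases Nat.le_succ_iff.1 hj with h | rfl
    · exact absurd (h1 j h e rfl) (by omega)
    refine ⟨e, ⟨fun _ => ?_, by simp only [Set.mem_ofPred_eq]; omega⟩, rfl⟩
    have h4 := h1 k le_rfl (e + endsExp v u ω) (by
      rw [Nat.succ_mul, endsExp_add]; abel)
    have h5 := pathNu_mono hL (add_le_add_right (endsExp_mono v u hω) e)
    simp only [endsExp] at h4 h5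
    rw [← add_assoc, ← add_assoc] at h5
    rw [← add_assoc] at h4
    omega
  · rintro ⟨e, ⟨h1, h2⟩, rfl⟩
    simp only [Set.mem_ofPred_eq, not_lt] at h2
    have h3 : pathNu L (e + Finsupp.single v 1 + Finsupp.single u 1) ≤ c := h1 h2
    refine ⟨fun j hj e' he' => ?_, fun h => ?_⟩
    · have h5 : e' = e + endsExp v u ((k + 1 - j) * ω) := by
        have : (k + 1) * ω = (k + 1 - j) * ω + j * ω := by
          rw [← Nat.add_mul]; congr 1; omega
        rw [this, endsExp_add, ← add_assoc] at he'
        exact (add_right_cancel he').symm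
      have h6 := pathNu_add_le_of_add_one_le hL hv hu (h3.trans h2) ((k + 1 - j) * ω)
      rw [add_assoc] at h6
      change pathNu L (e + endsExp v u _) ≤ _ at h6
      rw [← h5] at h6
      have h7 := pathNu_mono hL (d := e) (e := e + Finsupp.single v 1 + Finsupp.single u 1)
        (by rw [add_assoc]; exact le_self_add)
      omega
    · have := h (k + 1) le_rfl e rfl
      omega

theorem cycleSet_anti (L : List V) (v u : V) (ω t k : ℕ) :
    cycleSet L v u ω t (k + 1) ⊆ cycleSet L v u ω t k :=
  fun _ h j hj => h j (hj.trans (Nat.le_succ k))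

theorem degree_endsExp (v u : V) (p : ℕ) : (endsExp v u p).degree = 2 * p := by
  simp [endsExp]; ring

theorem monomialRegLE_cycleSet (hρ : Function.Injective ρ) {v u : V} {M : List V}
    (hL : (v :: (M ++ [u])).Nodup) {ω t : ℕ} (hω : 2 ≤ ω) (ht : 1 ≤ t) (k : ℕ) (hk : k ≤ t) :
    MonomialRegLE K ρ (cycleSet (v :: (M ++ [u])) v u ω t k)
      (2 * ω * t + ((M.length + 2) / 3 : ℕ) - 2) := by
  have hvu : v ∈ v :: (M ++ [u]) ∧ u ∈ v :: (M ++ [u]) := by simp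
  have hlen : (v :: (M ++ [u])).length = M.length + 2 := by simp
  set L := v :: (M ++ [u]) with hLdef
  have hωt : (t : ℤ) * 2 ≤ t * ω := by
    exact_mod_cast Nat.mul_le_mul_left t hω
  induction k with
  | zero =>
    obtain ⟨c, rfl⟩ : ∃ c, t = c + 1 := ⟨t - 1, by omega⟩
    -- The path bound has ⌊(n + 1)/3⌋, possibly one too many; 2 ≤ ω leaves room for it.
    refine (monomialRegLE_path hρ L hL c).of_iff (fun d => ?_) ?_
    · simp only [cycleSet, Set.mem_ofPred_eq, Nat.le_zero, forall_eq, Nat.zero_mul]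
      simp [endsExp]
    · rw [hlen]
      have : ((c + 1 : ℕ) : ℤ) * ω = ω * (c + 1 : ℕ) := mul_comm _ _
      rw [mul_assoc, ← this]
      push_cast at hωt ⊢
      omega
  | succ k ih =>
    obtain ⟨c, rfl⟩ : ∃ c, t = c + (k + 1) := ⟨t - (k + 1), by omega⟩
    have h1 := ih (by omega)
    have hle : (c : ℤ) * 2 ≤ c * ω := by exact_mod_cast Nat.mul_le_mul_left c hω
    -- With W = J^c ∩ (J^(c+1) : x_v x_u), this is the sequence 0 → J^c/W → S/W → S/J^c → 0.
    have hN : MonomialRegLE K ρ (endsSet L v u c \ {d | pathNu L d < c})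
        (2 * (c * ω) + ((M.length + 2) / 3 : ℕ) - 1) := by
      have hW := monomialRegLE_ends (K := K) hρ hL c
      have hdiff : endsSet L v u c \ (endsSet L v u c \ {d | pathNu L d < c}) =
          {d | pathNu L d < c} := by
        ext d
        simp only [Set.mem_sdiff, endsSet, Set.mem_ofPred_eq]
        constructor
        · rintro ⟨h1, h2⟩
          by_contra h3
          exact h2 ⟨h1, h3⟩
        · intro h1
          exact ⟨fun h2 => absurd h2 (by omega), fun h => h.2 h1⟩
      refine MonomialRegLE.sub hρ (isLowerSet_endsSet hL v u c).ordConnected Set.sdiff_subset ?_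
        (hW.mono (by linarith)) ?_
      · rintro d ⟨_, h2⟩ e he hde
        refine ⟨he, fun h3 => h2 ?_⟩
        exact (pathNu_mono hL hde).trans_lt h3
      · rw [hdiff]
        rcases c with _ | c
        · exact monomialRegLE_of_subset_empty (fun d h => by simp at h) _
        · refine (monomialRegLE_path hρ L hL c).of_iff (fun d => ?_) ?_
          · simp
          · rw [hlen]; push_cast at hle ⊢; omega
    -- The quotient of level k by the shifted layer is level k + 1. The shift adds 2(k + 1)ω, and c
    -- + k + 1 = t gives the admissible value r + 1.
    have hquot := MonomialRegLE.quotient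
      (D' := cycleSet L v u ω (c + (k + 1)) k \ cycleSet L v u ω (c + (k + 1)) (k + 1)) hρ
      (isLowerSet_cycleSet hL v u ω _ k).ordConnected Set.sdiff_subset ?_ h1 ?_
    · rwa [Set.sdiff_sdiff_cancel_left (cycleSet_anti L v u ω _ k)] at hquot
    · rintro d ⟨_, h2⟩ e he hde
      exact ⟨he, fun h3 => h2 (isLowerSet_cycleSet hL v u ω _ _ hde h3)⟩
    · refine (hN.shift (endsExp v u ((k + 1) * ω))).of_iff
        (cycleSet_diff hL hvu.1 hvu.2 (by omega) c k) ?_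
      rw [degree_endsExp]
      push_cast
      nlinarith

end CycleRegularity

/-! ### Polynomial Koszul chains split into multidegree strands. -/

section PolynomialStrands

open MvPolynomial

variable {V : Type*} [Fintype V] [DecidableEq V] {K : Type*} [Field K] {ρ : V → ℕ}

/-- The multidegree `α` part of a chain of polynomials. -/
noncomputable def strand (c : Finset V → MvPolynomial V K) (α : V →₀ ℕ) (τ : Finset V) : K :=
  if expInd τ ≤ α then coeff (α - expInd τ) (c τ) else 0

theorem expInd_le_insert_iff {α : V →₀ ℕ} {v : V} {σ : Finset V} (hv : v ∉ σ)
    (hσ : expInd σ ≤ α) : expInd (insert v σ) ≤ α ↔ v ∈ (α - expInd σ).support := by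
  rw [Finsupp.mem_support_iff, Finsupp.tsub_apply, expInd_apply, if_neg hv, Nat.sub_zero]
  constructor
  · intro h
    have := h v
    rw [expInd_apply, if_pos (Finset.mem_insert_self _ _)] at this
    omega
  · intro h u
    rw [expInd_apply]
    split_ifs with hu
    · rcases Finset.mem_insert.1 hu with rfl | hu
      · omega
      · have := hσ u
        rwa [expInd_apply, if_pos hu] at this
    · exact Nat.zero_le _

theorem koszulD_strand (c : Finset V → MvPolynomial V K) {α : V →₀ ℕ} {σ : Finset V}
    (hσ : expInd σ ≤ α) :
    koszulD ρ (1 : V → K) (strand c α) σ = strand (koszulD ρ (X : V → MvPolynomial V K) c) α σ := by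
  unfold koszulD
  rw [strand, if_pos hσ, coeff_sum]
  refine Finset.sum_congr rfl fun v hv => ?_
  have hv' : v ∉ σ := by simpa using hv
  rw [Pi.one_apply, one_smul, smul_eq_mul, ← Int.cast_smul_eq_zsmul K (koszulSign ρ v σ),
    ← Int.cast_smul_eq_zsmul K (koszulSign ρ v σ), coeff_smul, coeff_X_mul', strand]
  congr 1
  by_cases h : expInd (insert v σ) ≤ α
  · rw [if_pos h, if_pos ((expInd_le_insert_iff hv' hσ).1 h), expInd_insert hv', add_comm,
      tsub_add_eq_tsub_tsub]
  · rw [if_neg h, if_neg (fun h' => h ((expInd_le_insert_iff hv' hσ).2 h'))]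

theorem mem_koszulFamily_iff {D : Set (V →₀ ℕ)} {α : V →₀ ℕ} {τ : Finset V} :
    τ ∈ koszulFamily D α ↔ expInd τ ≤ α ∧ α - expInd τ ∈ D := by
  constructor
  · rintro ⟨d, hd, rfl⟩
    exact ⟨le_add_self, by rwa [add_tsub_cancel_right]⟩
  · rintro ⟨h1, h2⟩
    exact ⟨_, h2, tsub_add_cancel_of_le h1⟩

theorem koszulD_indicator_strand {D : Set (V →₀ ℕ)} (hD : IsLowerSet D)
    (c : Finset V → MvPolynomial V K) {α : V →₀ ℕ} {σ : Finset V} (hσ : σ ∈ koszulFamily D α) :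
    koszulD ρ (1 : V → K) ((koszulFamily D α).indicator (strand c α)) σ =
      strand (koszulD ρ (X : V → MvPolynomial V K) c) α σ := by
  obtain ⟨h1, h2⟩ := mem_koszulFamily_iff.1 hσ
  rw [← koszulD_strand c h1]
  refine koszulD_congr fun v hv => ?_
  by_cases h : insert v σ ∈ koszulFamily D α
  · rw [Set.indicator_of_mem h]
  · rw [Set.indicator_of_notMem h, strand, if_neg]
    intro h'
    exact h (mem_koszulFamily_iff.2 ⟨h', hD
      (tsub_le_tsub_left (expInd_mono (Finset.subset_insert _ _)) _) h2⟩)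

/-- Solves the boundary equation modulo the monomial ideal separately in each of the finitely many
multidegrees occurring in `c`, and reassembles. The last clause says that no new multidegrees
appear, which keeps track of homogeneity. -/
theorem exists_koszul_boundary {D : Set (V →₀ ℕ)} (hD : IsLowerSet D)
    {c : Finset V → MvPolynomial V K} {i : ℕ} (hc : ∀ τ, c τ ≠ 0 → τ.card = i)
    (hcyc : ∀ σ, ∀ m ∈ (koszulD ρ (X : V → MvPolynomial V K) c σ).support, m ∉ D)
    (hac : ∀ τ, ∀ m ∈ (c τ).support, KoszulAcyclic K ρ (koszulFamily D (m + expInd τ)) i) :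
    ∃ y : Finset V → MvPolynomial V K, (∀ τ, y τ ≠ 0 → τ.card = i + 1) ∧
      (∀ τ, ∀ m ∈ (c τ - koszulD ρ (X : V → MvPolynomial V K) y τ).support, m ∉ D) ∧
      ∀ τ, ∀ m ∈ (y τ).support, ∃ τ', ∃ m' ∈ (c τ').support,
        m' + expInd τ' = m + expInd τ := by
  classical
  let A : Finset (V →₀ ℕ) := Finset.univ.biUnion fun τ => (c τ).support.image (· + expInd τ)
  have hA : ∀ α, α ∈ A ↔ ∃ τ, ∃ m ∈ (c τ).support, m + expInd τ = α := by
    intro α; simp [A]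
  have hex : ∀ α, ∃ y : Finset V → K, α ∈ A →
      (∀ τ, y τ ≠ 0 → τ ∈ koszulFamily D α ∧ τ.card = i + 1) ∧
        ∀ τ ∈ koszulFamily D α, koszulD ρ (1 : V → K) y τ = strand c α τ := by
    intro α
    by_cases hα : α ∈ A
    · have hαc : KoszulAcyclic K ρ (koszulFamily D α) i := by
        obtain ⟨τ, m, hm, rfl⟩ := (hA α).1 hα
        exact hac τ m hm
      obtain ⟨y, hy1, hy2⟩ := hαc ((koszulFamily D α).indicator (strand c α))
        (fun τ h => by
          obtain ⟨h1, h2⟩ := Set.indicator_apply_ne_zero.1 h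
          refine ⟨h1, hc τ fun h0 => h2 ?_⟩
          simp [strand, h0])
        (fun σ hσ => by
          rw [koszulD_indicator_strand hD c hσ]
          obtain ⟨h1, h2⟩ := mem_koszulFamily_iff.1 hσ
          rw [strand, if_pos h1]
          by_contra hne
          exact hcyc σ _ (mem_support_iff.2 hne) h2)
      exact ⟨y, fun _ => ⟨hy1, fun τ hτ => by rw [hy2 τ hτ, Set.indicator_of_mem hτ]⟩⟩
    · exact ⟨0, fun h => absurd h hα⟩
  choose y hy using hex
  let Y : Finset V → MvPolynomial V K := fun τ =>
    ∑ α ∈ A, if expInd τ ≤ α then monomial (α - expInd τ) (y α τ) else 0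
  have hcoeff : ∀ τ m, coeff m (Y τ) = if m + expInd τ ∈ A then y (m + expInd τ) τ else 0 := by
    intro τ m
    have : ∀ α ∈ A, coeff m (if expInd τ ≤ α then monomial (α - expInd τ) (y α τ) else 0) =
        if m + expInd τ = α then y α τ else 0 := by
      intro α _
      by_cases h : expInd τ ≤ α
      · rw [if_pos h, coeff_monomial]
        refine if_congr ?_ rfl rfl
        rw [tsub_eq_iff_eq_add_of_le h, eq_comm]
      · rw [if_neg h, if_neg, coeff_zero]
        rintro rfl
        exact h le_add_self
    simp only [Y]
    rw [coeff_sum, Finset.sum_congr rfl this, Finset.sum_ite_eq]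
  refine ⟨Y, fun τ hτ => ?_, fun τ m hm hmD => ?_, fun τ m hm => ?_⟩
  · obtain ⟨m, hm⟩ := ne_zero_iff.1 hτ
    rw [hcoeff] at hm
    split_ifs at hm with h
    · exact (((hy _ h).1 τ hm).2)
    · exact absurd rfl hm
  · rw [mem_support_iff, coeff_sub] at hm
    apply hm
    have hτ : τ ∈ koszulFamily D (m + expInd τ) := ⟨m, hmD, rfl⟩
    have e1 : coeff m (koszulD ρ (X : V → MvPolynomial V K) Y τ) =
        strand (koszulD ρ (X : V → MvPolynomial V K) Y) (m + expInd τ) τ := by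
      rw [strand, if_pos le_add_self, add_tsub_cancel_right]
    have e2 : coeff m (c τ) = strand c (m + expInd τ) τ := by
      rw [strand, if_pos le_add_self, add_tsub_cancel_right]
    rw [e1, ← koszulD_strand Y le_add_self]
    have e3 : ∀ τ', strand Y (m + expInd τ) τ' =
        if m + expInd τ ∈ A then y (m + expInd τ) τ' else 0 := by
      intro τ'
      rw [strand]
      by_cases h : expInd τ' ≤ m + expInd τ
      · rw [if_pos h, hcoeff, tsub_add_cancel_of_le h]
      · rw [if_neg h]
        split_ifs with hmA
        · by_contra hne
          exact h (mem_koszulFamily_iff.1 ((hy _ hmA).1 τ' (Ne.symm hne)).1).1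
        · rfl
    rw [sub_eq_zero, e2]
    by_cases hmA : m + expInd τ ∈ A
    · rw [← (hy _ hmA).2 τ hτ]
      exact koszulD_congr fun v _ => by rw [e3, if_pos hmA]
    · rw [koszulD_eq_zero fun v _ => by rw [e3, if_neg hmA], ← e2]
      by_contra hne
      exact hmA ((hA _).2 ⟨τ, m, mem_support_iff.2 hne, rfl⟩)
  · rw [mem_support_iff, hcoeff] at hm
    split_ifs at hm with h
    · exact (hA _).1 h
    · exact absurd rfl hm

/-- Exactness of the Koszul complex of a free module in the multidegrees other than `0`. -/
theorem exists_koszul_boundary_free (hρ : Function.Injective ρ) {r : ℕ}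
    {c : Finset V → Fin r → MvPolynomial V K} {i : ℕ} (hc : ∀ τ, c τ ≠ 0 → τ.card = i)
    (hcyc : ∀ σ, koszulD ρ (X : V → MvPolynomial V K) c σ = 0)
    (h0 : ∀ τ l, ∀ m ∈ (c τ l).support, m + expInd τ ≠ 0) :
    ∃ y : Finset V → Fin r → MvPolynomial V K, (∀ τ, y τ ≠ 0 → τ.card = i + 1) ∧
      (∀ τ, koszulD ρ (X : V → MvPolynomial V K) y τ = c τ) ∧
      ∀ τ l, ∀ m ∈ (y τ l).support, ∃ τ', ∃ m' ∈ (c τ' l).support,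
        m' + expInd τ' = m + expInd τ := by
  have hl : ∀ l, ∃ y : Finset V → MvPolynomial V K, (∀ τ, y τ ≠ 0 → τ.card = i + 1) ∧
      (∀ τ, ∀ m ∈ (c τ l - koszulD ρ (X : V → MvPolynomial V K) y τ).support, m ∉ (Set.univ : Set (V →₀ ℕ))) ∧
      ∀ τ, ∀ m ∈ (y τ).support, ∃ τ', ∃ m' ∈ (c τ' l).support,
        m' + expInd τ' = m + expInd τ := by
    intro l
    refine exists_koszul_boundary isLowerSet_univ (c := fun τ => c τ l)
      (fun τ h => hc τ fun h' => h (by simp [h'])) (fun σ m hm => ?_)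
      (fun τ m hm => koszulAcyclic_univ hρ (h0 τ l m hm) i)
    have := koszulD_map ρ (X : V → MvPolynomial V K)
      (LinearMap.proj l : (Fin r → MvPolynomial V K) →ₗ[_] _) c σ
    simp only [LinearMap.proj_apply, hcyc σ, Pi.zero_apply] at this
    rw [this] at hm
    simp at hm
  choose y hy1 hy2 hy3 using hl
  refine ⟨fun τ l => y l τ, fun τ h => ?_, fun τ => ?_, fun τ l => hy3 l τ⟩
  · obtain ⟨l, h⟩ := Function.ne_iff.1 h
    exact hy1 l τ h
  · ext1 l
    have := koszulD_map ρ (X : V → MvPolynomial V K)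
      (LinearMap.proj l : (Fin r → MvPolynomial V K) →ₗ[_] _) (fun τ l => y l τ) τ
    simp only [LinearMap.proj_apply] at this
    rw [← this, eq_comm, ← sub_eq_zero, ← support_eq_empty, Finset.eq_empty_iff_forall_notMem]
    exact fun m hm => hy2 l τ m hm trivial

end PolynomialStrands

/-! ### Betti numbers of a resolution against Koszul homology. -/

section Comparison

open MvPolynomial

variable {V : Type*} [Fintype V] [DecidableEq V] {K : Type*} [Field K] {ρ : V → ℕ}

theorem LinearMap.apply_eq_sum_single {R M : Type*} [CommRing R] [AddCommGroup M] [Module R M]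
    {r : ℕ} (φ : (Fin r → R) →ₗ[R] M) (u : Fin r → R) :
    φ u = ∑ k, u k • φ (Pi.single k 1) := by
  have : u = ∑ k, u k • (Pi.single k (1 : R) : Fin r → R) := by
    ext l; simp [Finset.sum_apply, Pi.single_apply]
  conv_lhs => rw [this]
  simp [map_sum]

/-- The component of degree `e` of `f`, the unit being placed in degree `b`. -/
noncomputable def degComp (e b : ℕ) (f : MvPolynomial V K) : MvPolynomial V K :=
  if b ≤ e then homogeneousComponent (e - b) f else 0

theorem coeff_degComp (e b : ℕ) (f : MvPolynomial V K) (m : V →₀ ℕ) :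
    coeff m (degComp e b f) = if m.degree + b = e then coeff m f else 0 := by
  unfold degComp
  by_cases h : b ≤ e
  · rw [if_pos h, coeff_homogeneousComponent]
    refine if_congr ?_ rfl rfl
    omega
  · rw [if_neg h, if_neg (by omega), coeff_zero]

theorem degComp_mul {f g : MvPolynomial V K} {a b : ℕ} (e : ℕ)
    (hg : ∀ m ∈ g.support, m.degree + b = a) : degComp e b (f * g) = degComp e a f * g := by
  classical
  ext m
  rw [coeff_degComp, coeff_mul, coeff_mul]
  have : ∀ x ∈ Finset.HasAntidiagonal.antidiagonal m, coeff x.1 (degComp e a f) * coeff x.2 g =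
      if m.degree + b = e then coeff x.1 f * coeff x.2 g else 0 := by
    intro x hx
    rw [Finset.HasAntidiagonal.mem_antidiagonal] at hx
    rw [coeff_degComp]
    by_cases h : coeff x.2 g = 0
    · simp [h]
    · have h1 := hg x.2 (mem_support_iff.2 h)
      have h2 : m.degree = x.1.degree + x.2.degree := by rw [← hx, map_add]
      rw [ite_mul, zero_mul]
      refine if_congr ?_ rfl rfl
      omega
  rw [Finset.sum_congr rfl this]
  split_ifs <;> simp

theorem degComp_sum {ι : Type*} (s : Finset ι) (e b : ℕ) (f : ι → MvPolynomial V K) :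
    degComp e b (∑ i ∈ s, f i) = ∑ i ∈ s, degComp e b (f i) := by
  ext m
  simp only [coeff_degComp, coeff_sum]
  split_ifs <;> simp

theorem degComp_map {r : ℕ} {φ : (Fin r → MvPolynomial V K) →ₗ[MvPolynomial V K] MvPolynomial V K}
    {a : Fin r → ℕ} {b : ℕ} (h : ∀ k, ∀ m ∈ (φ (Pi.single k 1)).support, m.degree + b = a k)
    (e : ℕ) (u : Fin r → MvPolynomial V K) :
    degComp e b (φ u) = φ fun k => degComp e (a k) (u k) := by
  rw [LinearMap.apply_eq_sum_single φ u, LinearMap.apply_eq_sum_single φ fun k => _, degComp_sum]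
  exact Finset.sum_congr rfl fun k _ => degComp_mul e (h k)

theorem degree_of_mem_support_map {r : ℕ}
    {φ : (Fin r → MvPolynomial V K) →ₗ[MvPolynomial V K] MvPolynomial V K}
    {a : Fin r → ℕ} {b : ℕ} (h : ∀ k, ∀ m ∈ (φ (Pi.single k 1)).support, m.degree + b = a k)
    {s j : ℕ} {u : Fin r → MvPolynomial V K}
    (hu : ∀ k, ∀ m ∈ (u k).support, m.degree + s + a k = j) {m : V →₀ ℕ}
    (hm : m ∈ (φ u).support) : m.degree + s + b = j := by
  classical
  rw [LinearMap.apply_eq_sum_single φ u] at hm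
  obtain ⟨k, -, hk⟩ := Finset.mem_biUnion.1 (support_sum hm)
  obtain ⟨m₁, h₁, m₂, h₂, rfl⟩ := Finset.mem_add.1 (support_mul _ _ hk)
  have := hu k m₁ h₁
  have := h k m₂ h₂
  rw [map_add]
  omega

/-- A chain in the Koszul complex of a graded free module that is homogeneous of degree `j`. -/
def HomogChain {r : ℕ} (a : Fin r → ℕ) (j : ℕ) (z : Finset V → Fin r → MvPolynomial V K) : Prop :=
  ∀ τ l, ∀ m ∈ (z τ l).support, m.degree + τ.card + a l = j

theorem koszulD_apply {r : ℕ} (z : Finset V → Fin r → MvPolynomial V K) (σ : Finset V)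
    (l : Fin r) : koszulD ρ (X : V → MvPolynomial V K) z σ l =
      koszulD ρ (X : V → MvPolynomial V K) (fun τ => z τ l) σ :=
  (koszulD_map ρ (X : V → MvPolynomial V K)
    (LinearMap.proj l : (Fin r → MvPolynomial V K) →ₗ[_] _) z σ).symm

theorem mem_support_koszulD {c : Finset V → MvPolynomial V K} {σ : Finset V} {m : V →₀ ℕ}
    (hm : m ∈ (koszulD ρ (X : V → MvPolynomial V K) c σ).support) :
    ∃ v, v ∉ σ ∧ ∃ m' ∈ (c (insert v σ)).support, m = Finsupp.single v 1 + m' := by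
  classical
  unfold koszulD at hm
  obtain ⟨v, hv, hm⟩ := Finset.mem_biUnion.1 (support_sum hm)
  refine ⟨v, by simpa using hv, ?_⟩
  rw [← Int.cast_smul_eq_zsmul K] at hm
  have h1 := support_smul hm
  rw [smul_eq_mul, support_X_mul, Finset.mem_map] at h1
  obtain ⟨m', hm', rfl⟩ := h1
  exact ⟨m', hm', rfl⟩

theorem HomogChain.koszulD {r : ℕ} {a : Fin r → ℕ} {j : ℕ}
    {z : Finset V → Fin r → MvPolynomial V K} (hz : HomogChain a j z) :
    HomogChain a j (koszulD ρ (X : V → MvPolynomial V K) z) := by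
  intro σ l m hm
  rw [koszulD_apply] at hm
  obtain ⟨v, hv, m', hm', rfl⟩ := mem_support_koszulD hm
  have := hz _ l m' hm'
  rw [Finset.card_insert_of_notMem hv] at this
  rw [map_add, Finsupp.degree_single]
  omega

theorem constantCoeff_koszulD {r : ℕ} (z : Finset V → Fin r → MvPolynomial V K) (σ : Finset V)
    (l : Fin r) : constantCoeff (koszulD ρ (X : V → MvPolynomial V K) z σ l) = 0 := by
  rw [koszulD_apply]
  by_contra h
  obtain ⟨v, -, m', -, h⟩ := mem_support_koszulD (mem_support_iff.2 h)
  have := DFunLike.congr_fun h v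
  simp at this
  omega

theorem constantCoeff_of_mem_span {f : MvPolynomial V K}
    (hf : f ∈ Ideal.span (Set.range (X : V → MvPolynomial V K))) : constantCoeff f = 0 := by
  have : Ideal.span (Set.range (X : V → MvPolynomial V K)) ≤
      RingHom.ker (constantCoeff (R := K) (σ := V)) := by
    rw [Ideal.span_le]
    rintro _ ⟨v, rfl⟩
    simp [RingHom.mem_ker]
  exact RingHom.mem_ker.1 (this hf)

namespace GradedFreeResolution

variable {J : Ideal (MvPolynomial V K)} (F : GradedFreeResolution J)

/-- A lift of the augmentation to the polynomial ring. -/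
noncomputable def augLift : (Fin (F.rank 0) → MvPolynomial V K) →ₗ[MvPolynomial V K]
    MvPolynomial V K :=
  Fintype.linearCombination _ fun k => (F.aug_homogeneous k).choose

theorem augLift_single (k : Fin (F.rank 0)) :
    F.augLift (Pi.single k 1) = (F.aug_homogeneous k).choose := by
  simp [augLift]

theorem degree_augLift (k : Fin (F.rank 0)) :
    ∀ m ∈ (F.augLift (Pi.single k 1)).support, m.degree + 0 = F.shift 0 k := by
  intro m hm
  rw [augLift_single] at hm
  have := (F.aug_homogeneous k).choose_spec.1 (mem_support_iff.1 hm)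
  rw [add_zero, Finsupp.degree_eq_weight_one]
  exact this

theorem mk_augLift (u : Fin (F.rank 0) → MvPolynomial V K) :
    Ideal.Quotient.mk J (F.augLift u) = F.aug u := by
  rw [LinearMap.apply_eq_sum_single F.augLift u, LinearMap.apply_eq_sum_single F.aug u, map_sum]
  refine Finset.sum_congr rfl fun k _ => ?_
  rw [augLift_single, smul_eq_mul, map_mul, ← (F.aug_homogeneous k).choose_spec.2]

  rfl

theorem augLift_mem_iff (u : Fin (F.rank 0) → MvPolynomial V K) :
    F.augLift u ∈ J ↔ ∃ u', F.diff 0 u' = u := by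
  rw [← Ideal.Quotient.eq_zero_iff_mem, mk_augLift]
  exact F.exact_zero u

theorem exists_augLift_sub_mem (f : MvPolynomial V K) : ∃ u, F.augLift u - f ∈ J := by
  obtain ⟨u, hu⟩ := F.aug_surjective (Ideal.Quotient.mk J f)
  exact ⟨u, by rw [← Ideal.Quotient.eq, mk_augLift, hu]⟩

theorem diff_diff (q : ℕ) (u) : F.diff q (F.diff (q + 1) u) = 0 :=
  (F.exact_succ q _).2 ⟨u, rfl⟩

theorem homogChain_diff {q j : ℕ} {z : Finset V → Fin (F.rank (q + 1)) → MvPolynomial V K}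
    (hz : HomogChain (F.shift (q + 1)) j z) :
    HomogChain (F.shift q) j fun τ => F.diff q (z τ) := fun τ l _ hm =>
  degree_of_mem_support_map (φ := LinearMap.proj l ∘ₗ F.diff q) (a := F.shift (q + 1))
    (fun k => F.diff_homogeneous q k l) (s := τ.card) (u := z τ) (hz τ) hm

variable {F} in
-- Staircase in the double complex of the Koszul complex and `F`. A chain `z` in bidegree (p, q + 1)
-- is replaced by a Koszul primitive of its image under the differential, in bidegree (p + 1, q),
-- until q = 0, where the hypothesis on S/J applies.
theorem exists_boundary_of_acyclic (hρ : Function.Injective ρ) (hF : F.IsMinimal)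
    {D : Set (V →₀ ℕ)} (hD : IsLowerSet D) (hJ : ∀ p, p ∈ J ↔ ∀ m ∈ p.support, m ∉ D) {j : ℕ}
    (q p : ℕ) (hac : ∀ α : V →₀ ℕ, α.degree = j → KoszulAcyclic K ρ (koszulFamily D α) (p + q))
    (z : Finset V → Fin (F.rank q) → MvPolynomial V K) (hz : ∀ τ, z τ ≠ 0 → τ.card = p)
    (hzj : HomogChain (F.shift q) j z)
    (hcyc : ∀ σ, ∃ u, F.diff q u = koszulD ρ (X : V → MvPolynomial V K) z σ) :
    ∃ (y : Finset V → Fin (F.rank q) → MvPolynomial V K)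
      (y' : Finset V → Fin (F.rank (q + 1)) → MvPolynomial V K),
      ∀ τ, z τ = koszulD ρ (X : V → MvPolynomial V K) y τ + F.diff q (y' τ) := by
  induction q generalizing p with
  | zero =>
    obtain ⟨y₀, -, hy₀, -⟩ := exists_koszul_boundary (ρ := ρ) hD (c := fun τ => F.augLift (z τ))
      (i := p) (fun τ h => hz τ fun h' => h (by rw [h', map_zero]))
      (fun σ => by
        rw [koszulD_map]
        exact (hJ _).1 ((F.augLift_mem_iff _).2 (hcyc σ)))
      (fun τ _ hm => hac _ (by
        have := degree_of_mem_support_map F.degree_augLift (s := τ.card) (j := j)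
          (fun k m hm => hzj τ k m hm) hm
        rw [map_add, degree_expInd]; omega))
    choose y hy using fun τ => F.exists_augLift_sub_mem (y₀ τ)
    have hmem : ∀ τ, F.augLift (z τ - koszulD ρ (X : V → MvPolynomial V K) y τ) ∈ J := by
      intro τ
      rw [map_sub, ← koszulD_map]
      have h1 := (hJ _).2 (hy₀ τ)
      have h2 : koszulD ρ (X : V → MvPolynomial V K)
          ((fun τ => F.augLift (y τ)) - y₀) τ ∈ J := by
        unfold _root_.koszulD
        refine J.sum_mem fun v _ => ?_
        exact zsmul_mem (J.mul_mem_left _ (hy _)) _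
      rw [koszulD_sub] at h2
      have := J.sub_mem h1 h2
      rwa [sub_sub, add_sub_cancel] at this
    choose y' hy' using fun τ => (F.augLift_mem_iff _).1 (hmem τ)
    exact ⟨y, y', fun τ => by rw [hy', add_sub_cancel]⟩
  | succ q ih =>
    obtain ⟨z', hz'1, hz'2, hz'3⟩ := exists_koszul_boundary_free hρ
      (c := fun τ => F.diff q (z τ)) (i := p)
      (fun τ h => hz τ fun h' => h (by rw [h', map_zero]))
      (fun σ => by
        rw [koszulD_map]
        obtain ⟨u, hu⟩ := hcyc σ
        rw [← hu, F.diff_diff])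
      -- Multidegree 0 is the only obstruction to exactness; minimality excludes it, as entries in
      -- the image of the differential have no constant term.
      (fun τ l m hm h0 => by
        have hm0 : m = 0 := by
          rw [add_eq_zero] at h0; exact h0.1
        rw [hm0, mem_support_iff] at hm
        exact hm (constantCoeff_of_mem_span (hF q (z τ) l)))
    obtain ⟨y, y', hy⟩ := ih (p + 1) (fun α hα => by
        have := hac α hα
        rwa [show p + 1 + q = p + (q + 1) by omega]) z' hz'1
      (fun τ l m hm => by
        obtain ⟨τ', m', hm', he⟩ := hz'3 τ l m hm
        have h1 := F.homogChain_diff hzj τ' l m' hm'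
        have h2 := congrArg Finsupp.degree he
        rw [map_add, map_add, degree_expInd, degree_expInd] at h2
        omega)
      (fun σ => ⟨z σ, (hz'2 σ).symm⟩)
    have hker : ∀ τ, F.diff q (z τ - koszulD ρ (X : V → MvPolynomial V K) y' τ) = 0 := by
      intro τ
      rw [map_sub, ← koszulD_map, ← hz'2 τ, sub_eq_zero]
      have h1 : z' = koszulD ρ (X : V → MvPolynomial V K) y + fun τ => F.diff q (y' τ) :=
        funext hy
      conv_lhs => rw [h1]
      rw [koszulD_add, koszulD_koszulD hρ, zero_add]
    choose y'' hy'' using fun τ => (F.exact_succ q _).1 (hker τ)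
    exact ⟨y', y'', fun τ => by rw [hy'', add_sub_cancel]⟩

variable {F} in
/-- A summand `S(-j)` in homological degree `i` of a minimal resolution is detected by the Koszul
homology of `S/J`. -/
theorem betti_eq_zero_of_acyclic (hρ : Function.Injective ρ) (hF : F.IsMinimal)
    {D : Set (V →₀ ℕ)} (hD : IsLowerSet D) (hJ : ∀ p, p ∈ J ↔ ∀ m ∈ p.support, m ∉ D) {i j : ℕ}
    (hac : ∀ α : V →₀ ℕ, α.degree = j → KoszulAcyclic K ρ (koszulFamily D α) i) :
    F.betti i j = 0 := by
  unfold betti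
  rw [Finset.card_eq_zero, Finset.filter_eq_empty_iff]
  intro k _ hk
  -- A basis element of degree j, placed at the empty set, would be a Koszul boundary plus an image
  -- of the differential; both have zero constant term, while the basis element has constant term 1.
  obtain ⟨y, y', h⟩ := exists_boundary_of_acyclic hρ hF hD hJ i 0 (j := j) (by simpa using hac)
    (fun τ => if τ = ∅ then Pi.single k 1 else 0)
    (fun τ h => by
      by_cases hτ : τ = ∅
      · simp [hτ]
      · simp [hτ] at h)
    (fun τ l m hm => by
      by_cases hτ : τ = ∅
      · simp only [if_pos hτ, Pi.single_apply] at hm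
        split_ifs at hm with hl
        · rw [mem_support_iff, coeff_one] at hm
          have : m = 0 := by by_contra h; exact hm (if_neg fun h' => h h'.symm)
          rw [this, hl, hτ, ← hk]; simp
        · simp at hm
      · simp [hτ] at hm)
    (fun σ => ⟨0, by
      rw [map_zero, koszulD_eq_zero]
      intro v _
      simp⟩)
  have h1 := congrArg constantCoeff (congrFun (h ∅) k)
  rw [if_pos rfl, Pi.single_eq_same, Pi.add_apply, map_add, constantCoeff_koszulD,
    constantCoeff_of_mem_span (hF i _ k)] at h1
  simp at h1

variable {F} in
-- The staircase in the opposite direction, from (p, q) to (p - 1, q + 1). At p = 0 a chain of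
-- degree j has no constant entries, because no basis element has degree j, and so it is a Koszul
-- boundary.
theorem exists_boundary_of_shift_ne (hρ : Function.Injective ρ) {j : ℕ} (p q : ℕ)
    (hne : ∀ k, F.shift (p + q) k ≠ j)
    (z : Finset V → Fin (F.rank q) → MvPolynomial V K) (hz : ∀ τ, z τ ≠ 0 → τ.card = p)
    (hzj : HomogChain (F.shift q) j z)
    (hcyc : ∀ σ, ∃ u, F.diff q u = koszulD ρ (X : V → MvPolynomial V K) z σ) :
    ∃ (y : Finset V → Fin (F.rank q) → MvPolynomial V K)
      (y' : Finset V → Fin (F.rank (q + 1)) → MvPolynomial V K),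
      (∀ τ, y τ ≠ 0 → τ.card = p + 1) ∧
      ∀ τ, z τ = koszulD ρ (X : V → MvPolynomial V K) y τ + F.diff q (y' τ) := by
  induction p generalizing q with
  | zero =>
    rw [zero_add] at hne
    obtain ⟨y, hy1, hy2, -⟩ := exists_koszul_boundary_free hρ (c := z) hz
      (fun σ => koszulD_eq_zero fun v _ => by
        by_contra h
        have := hz _ h
        simp at this)
      (fun τ l m hm h0 => by
        have h := hzj τ l m hm
        have h1 := congrArg Finsupp.degree h0
        rw [map_add, degree_expInd, map_zero] at h1
        exact hne l (by omega))
    exact ⟨y, 0, hy1, fun τ => by simp [hy2]⟩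
  | succ p ih =>
    choose u hu using hcyc
    have hdz := hzj.koszulD (ρ := ρ)
    -- The chosen preimages need not be homogeneous, so only their component of total degree j is
    -- kept.
    let z' : Finset V → Fin (F.rank (q + 1)) → MvPolynomial V K := fun σ =>
      if σ.card = p then fun k => degComp (j - p) (F.shift (q + 1) k) (u σ k) else 0
    have hcard : ∀ σ, koszulD ρ (X : V → MvPolynomial V K) z σ ≠ 0 → σ.card = p := fun σ h =>
      card_of_koszulD_ne_zero hz h
    have hz' : ∀ σ, σ.card = p → p ≤ j →
        F.diff q (z' σ) = koszulD ρ (X : V → MvPolynomial V K) z σ := by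
      intro σ hσ hpj
      simp only [z', if_pos hσ]
      ext1 l
      have h1 := degComp_map (φ := LinearMap.proj l ∘ₗ F.diff q) (a := F.shift (q + 1))
        (fun k => F.diff_homogeneous q k l) (j - p) (u σ)
      simp only [LinearMap.comp_apply, LinearMap.proj_apply] at h1
      rw [← h1, hu]
      ext m
      rw [coeff_degComp]
      split_ifs with h
      · rfl
      · by_contra hne0
        have := hdz σ l m (mem_support_iff.2 (Ne.symm hne0))
        omega
    by_cases hpj : p ≤ j
    · have hz'' : ∀ σ, F.diff q (z' σ) = koszulD ρ (X : V → MvPolynomial V K) z σ := by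
        intro σ
        by_cases hσ : σ.card = p
        · exact hz' σ hσ hpj
        · simp only [z', if_neg hσ, map_zero]
          by_contra h
          exact hσ (hcard σ (Ne.symm h))
      obtain ⟨y, y', hy1, hy2⟩ := ih (q + 1)
        (by rwa [show p + (q + 1) = p + 1 + q by omega]) z'
        (fun τ h => by
          by_contra hn
          exact h (if_neg hn))
        (fun τ l m hm => by
          by_cases hτ : τ.card = p
          · simp only [z', if_pos hτ] at hm
            rw [mem_support_iff, coeff_degComp] at hm
            split_ifs at hm with h
            · omega
            · exact absurd rfl hm
          · simp [z', hτ] at hm)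
        (fun σ => (F.exact_succ q _).1 (by
          rw [← koszulD_map]
          simp only [hz'']
          exact koszulD_koszulD hρ _ z σ))
      have hker : ∀ σ, koszulD ρ (X : V → MvPolynomial V K)
          (z - fun τ => F.diff q (y τ)) σ = 0 := by
        intro σ
        rw [koszulD_sub, koszulD_map, ← hz'' σ, hy2 σ, map_add, F.diff_diff, add_zero, sub_self]
      have hcz : ∀ τ, (z - fun τ => F.diff q (y τ)) τ ≠ 0 → τ.card = p + 1 := by
        intro τ h
        by_cases h0 : z τ = 0
        · refine hy1 τ fun h1 => h ?_
          simp [h0, h1]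
        · exact hz τ h0
      obtain ⟨w, hw1, hw2, -⟩ := exists_koszul_boundary_free hρ hcz hker
        (fun τ l m hm h0 => by
          have h1 := hcz τ fun h => by
            rw [h] at hm; simp at hm
          have h2 := congrArg Finsupp.degree h0
          rw [map_add, degree_expInd, map_zero] at h2
          omega)
      exact ⟨w, y, hw1, fun τ => by rw [hw2]; simp⟩
    · refine ⟨0, 0, by simp, fun τ => ?_⟩
      have : z τ = 0 := by
        by_contra h
        obtain ⟨l, h⟩ := Function.ne_iff.1 h
        obtain ⟨m, hm⟩ := ne_zero_iff.1 h
        have h1 := hzj τ l m (mem_support_iff.2 hm)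
        have h2 := hz τ fun h0 => h (by rw [h0])
        omega
      rw [this, koszulD_eq_zero (by simp)]
      simp

variable {F} in
/-- Nonzero Koszul homology of `S/J` forces a summand in every graded free resolution. -/
theorem betti_ne_zero_of_not_acyclic (hρ : Function.Injective ρ)
    {D : Set (V →₀ ℕ)} (hD : IsLowerSet D) (hJ : ∀ p, p ∈ J ↔ ∀ m ∈ p.support, m ∉ D) {i : ℕ}
    {α : V →₀ ℕ} (hac : ¬ KoszulAcyclic K ρ (koszulFamily D α) i) :
    F.betti i α.degree ≠ 0 := by
  intro hb
  unfold betti at hb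
  rw [Finset.card_eq_zero, Finset.filter_eq_empty_iff] at hb
  apply hac
  intro c hc hcyc
  let C : Finset V → MvPolynomial V K := fun τ => monomial (α - expInd τ) (c τ)
  have hCs : ∀ τ, strand C α τ = c τ := by
    intro τ
    simp only [strand, C, coeff_monomial, if_true]
    split_ifs with h
    · rfl
    · by_contra hne
      exact h (mem_koszulFamily_iff.1 (hc τ (Ne.symm hne)).1).1
  have hCD : ∀ τ m, m ∈ (C τ).support → m + expInd τ = α ∧ τ.card = i := by
    intro τ m hm
    have hne : c τ ≠ 0 := fun h => by simp [C, h] at hm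
    simp only [C, mem_support_iff, coeff_monomial] at hm
    split_ifs at hm with h
    · rw [← h]
      exact ⟨tsub_add_cancel_of_le (mem_koszulFamily_iff.1 (hc τ hne).1).1, (hc τ hne).2⟩
    · exact absurd rfl hm
  have hCcyc : ∀ σ, koszulD ρ (X : V → MvPolynomial V K) C σ ∈ J := by
    intro σ
    rw [hJ]
    intro m hm hmD
    obtain ⟨v, hv, m', hm', rfl⟩ := mem_support_koszulD hm
    have h1 := (hCD _ _ hm').1
    rw [expInd_insert hv, ← add_assoc, add_comm m'] at h1
    have hσ : σ ∈ koszulFamily D α := ⟨_, hmD, h1⟩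
    have h2 := hcyc σ hσ
    rw [← koszulD_congr fun v _ => hCs _, koszulD_strand C (mem_koszulFamily_iff.1 hσ).1, strand,
      if_pos (mem_koszulFamily_iff.1 hσ).1, ← h1, add_tsub_cancel_right] at h2
    exact (mem_support_iff.1 hm) h2
  choose u hu using fun τ => F.exists_augLift_sub_mem (C τ)
  -- The lift of the given cycle to F₀, cut down to total degree |α|.
  let z : Finset V → Fin (F.rank 0) → MvPolynomial V K := fun τ =>
    if τ.card = i then fun k => degComp (α.degree - i) (F.shift 0 k) (u τ k) else 0
  by_cases hi : i ≤ α.degree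
  swap
  · refine ⟨0, by simp, fun τ _ => ?_⟩
    rw [koszulD_eq_zero (by simp)]
    by_contra h
    obtain ⟨⟨d, -, rfl⟩, h2⟩ := hc τ (Ne.symm h)
    rw [map_add, degree_expInd] at hi
    omega
  have hz : ∀ τ, F.augLift (z τ) - C τ ∈ J := by
    intro τ
    by_cases hτ : τ.card = i
    · simp only [z, if_pos hτ]
      rw [← degComp_map F.degree_augLift]
      have : C τ = degComp (α.degree - i) 0 (C τ) := by
        ext m
        rw [coeff_degComp]
        split_ifs with h
        · rfl
        · by_contra hne
          have h1 := (hCD τ m (mem_support_iff.2 hne)).1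
          rw [← h1, map_add, degree_expInd] at h
          omega
      rw [this, hJ]
      intro m hm
      rw [mem_support_iff, coeff_sub, coeff_degComp, coeff_degComp] at hm
      split_ifs at hm with h
      · exact (hJ _).1 (hu τ) m (by rwa [mem_support_iff, coeff_sub])
      · simp at hm
    · have : C τ = 0 := by
        have : c τ = 0 := by
          by_contra h; exact hτ (hc τ h).2
        simp [C, this]
      simp [z, if_neg hτ, this]
  obtain ⟨y, y', hy1, hy2⟩ := exists_boundary_of_shift_ne (F := F) hρ i 0
    (fun k hk => hb (Finset.mem_univ k) hk) z
    (fun τ h => by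
      by_contra hn
      exact h (if_neg hn))
    (fun τ l m hm => by
      by_cases hτ : τ.card = i
      · simp only [z, if_pos hτ] at hm
        rw [mem_support_iff, coeff_degComp] at hm
        split_ifs at hm with h
        · omega
        · exact absurd rfl hm
      · simp [z, hτ] at hm)
    (fun σ => (F.augLift_mem_iff _).1 (by
      rw [← koszulD_map]
      have h2 : koszulD ρ (X : V → MvPolynomial V K)
          ((fun τ => F.augLift (z τ)) - C) σ ∈ J := by
        unfold _root_.koszulD
        refine J.sum_mem fun v _ => ?_
        exact zsmul_mem (J.mul_mem_left _ (hz _)) _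
      rw [koszulD_sub] at h2
      exact (J.sub_mem_iff_left (hCcyc σ)).1 h2))
  let Y : Finset V → MvPolynomial V K := fun τ => F.augLift (y τ)
  refine ⟨(koszulFamily D α).indicator (strand Y α), fun τ h => ?_, fun τ hτ => ?_⟩
  · obtain ⟨h1, h2⟩ := Set.indicator_apply_ne_zero.1 h
    refine ⟨h1, hy1 τ fun h0 => h2 ?_⟩
    simp [strand, Y, h0]
  · rw [koszulD_indicator_strand hD Y hτ, ← hCs τ]
    obtain ⟨h1, h2⟩ := mem_koszulFamily_iff.1 hτ
    rw [strand, strand, if_pos h1, if_pos h1, eq_comm, ← sub_eq_zero, ← coeff_sub]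
    have hmem : C τ - koszulD ρ (X : V → MvPolynomial V K) Y τ ∈ J := by
      have h3 : F.augLift (F.diff 0 (y' τ)) ∈ J := (F.augLift_mem_iff _).2 ⟨_, rfl⟩
      have h4 := hz τ
      rw [hy2 τ, map_add, ← koszulD_map] at h4
      have h5 := J.sub_mem h3 h4
      have e : F.augLift (F.diff 0 (y' τ)) - (koszulD ρ (X : V → MvPolynomial V K) Y τ +
          F.augLift (F.diff 0 (y' τ)) - C τ) =
          C τ - koszulD ρ (X : V → MvPolynomial V K) Y τ := by ring
      rwa [e] at h5
    by_contra hne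
    exact (hJ _).1 hmem _ (mem_support_iff.2 hne) h2

end GradedFreeResolution

end Comparison

/-! ### Existence of minimal graded free resolutions. -/

section MinimalResolution

open MvPolynomial

variable {V : Type*} [Fintype V] [DecidableEq V] {K : Type*} [Field K]

/-- The component of degree `e` of a vector of polynomials, basis element `l` being in degree
`a l`. -/
noncomputable def vecComp {r : ℕ} (a : Fin r → ℕ) (e : ℕ) (u : Fin r → MvPolynomial V K) :
    Fin r → MvPolynomial V K := fun l => degComp e (a l) (u l)

theorem vecComp_map {r r' : ℕ}
    {φ : (Fin r' → MvPolynomial V K) →ₗ[MvPolynomial V K] (Fin r → MvPolynomial V K)}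
    {a : Fin r → ℕ} {a' : Fin r' → ℕ}
    (h : ∀ k l, ∀ m ∈ (φ (Pi.single k 1) l).support, m.degree + a l = a' k) (e : ℕ)
    (u : Fin r' → MvPolynomial V K) : vecComp a e (φ u) = φ (vecComp a' e u) := by
  ext1 l
  exact degComp_map (φ := LinearMap.proj l ∘ₗ φ) (a := a') (fun k => h k l) e u

theorem degree_of_mem_support_vecComp {r : ℕ} {a : Fin r → ℕ} {e : ℕ}
    {u : Fin r → MvPolynomial V K} {l : Fin r} {m : V →₀ ℕ}
    (hm : m ∈ (vecComp a e u l).support) : m.degree + a l = e := by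
  rw [mem_support_iff, vecComp, coeff_degComp] at hm
  by_contra h
  exact hm (if_neg h)

theorem exists_sum_vecComp {r : ℕ} (a : Fin r → ℕ) (u : Fin r → MvPolynomial V K) :
    ∃ N, ∀ N' ≥ N, u = ∑ e ∈ Finset.range N', vecComp a e u := by
  classical
  refine ⟨(Finset.univ.biUnion fun l => (u l).support.image fun m => m.degree + a l).sup id + 1,
    fun N' hN' => ?_⟩
  ext l m
  rw [Finset.sum_apply, coeff_sum]
  simp only [vecComp, coeff_degComp]
  rw [Finset.sum_ite_eq]
  split_ifs with h
  · rfl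
  · by_contra hne
    apply h
    rw [Finset.mem_range]
    refine lt_of_lt_of_le (Nat.lt_succ_of_le ?_) hN'
    refine Finset.le_sup (f := id) (b := m.degree + a l) ?_
    exact Finset.mem_biUnion.2 ⟨l, Finset.mem_univ _,
      Finset.mem_image.2 ⟨m, mem_support_iff.2 hne, rfl⟩⟩

theorem exists_homogeneous_generators {r : ℕ} (a : Fin r → ℕ)
    (Z : Submodule (MvPolynomial V K) (Fin r → MvPolynomial V K))
    (hZ : ∀ u ∈ Z, ∀ e, vecComp a e u ∈ Z) :
    ∃ (n : ℕ) (a' : Fin n → ℕ) (g : Fin n → Fin r → MvPolynomial V K),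
      (∀ k l, ∀ m ∈ (g k l).support, m.degree + a l = a' k) ∧
        Submodule.span (MvPolynomial V K) (Set.range g) = Z := by
  obtain ⟨n, g₀, hg₀⟩ := Submodule.fg_iff_exists_fin_generating_family.1
    (IsNoetherian.noetherian Z)
  choose N hN using fun k => exists_sum_vecComp a (g₀ k)
  let N' := Finset.univ.sup N
  refine ⟨n * N', fun k => (finProdFinEquiv.symm k).2,
    fun k => vecComp a (finProdFinEquiv.symm k).2 (g₀ (finProdFinEquiv.symm k).1),
    fun k l m hm => degree_of_mem_support_vecComp hm, ?_⟩
  have hmem : ∀ k, g₀ k ∈ Z := fun k => hg₀ ▸ Submodule.subset_span ⟨k, rfl⟩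
  apply le_antisymm
  · rw [Submodule.span_le]
    rintro _ ⟨k, rfl⟩
    exact hZ _ (hmem _) _
  · conv_lhs => rw [← hg₀]
    rw [Submodule.span_le]
    rintro _ ⟨k, rfl⟩
    rw [hN k N' (Finset.le_sup (Finset.mem_univ k))]
    refine Submodule.sum_mem _ fun e he => Submodule.subset_span ?_
    refine ⟨finProdFinEquiv (k, ⟨e, Finset.mem_range.1 he⟩), ?_⟩
    simp

/-- Graded Nakayama: take the fewest homogeneous generators. A relation whose coefficient at `k₀`
has a nonzero constant term has, in degree `a' k₀`, a scalar coefficient there, so that generator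
would be superfluous. -/
theorem exists_minimal_homogeneous_generators {r : ℕ} (a : Fin r → ℕ)
    (Z : Submodule (MvPolynomial V K) (Fin r → MvPolynomial V K))
    (hZ : ∀ u ∈ Z, ∀ e, vecComp a e u ∈ Z) :
    ∃ (n : ℕ) (a' : Fin n → ℕ)
      (φ : (Fin n → MvPolynomial V K) →ₗ[MvPolynomial V K] (Fin r → MvPolynomial V K)),
      (∀ k l, ∀ m ∈ (φ (Pi.single k 1) l).support, m.degree + a l = a' k) ∧
        LinearMap.range φ = Z ∧ ∀ u, φ u = 0 → ∀ k, constantCoeff (u k) = 0 := by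
  classical
  have hex := exists_homogeneous_generators a Z hZ
  obtain ⟨a', g, hg, hspan⟩ := Nat.find_spec hex
  have hmin := fun m (hm : m < Nat.find hex) => Nat.find_min hex hm
  generalize Nat.find hex = n at a' g hmin
  have hsingle : ∀ k, Fintype.linearCombination (MvPolynomial V K) g (Pi.single k 1) = g k := by
    intro k; simp
  have hdeg : ∀ k l, ∀ m ∈ (Fintype.linearCombination (MvPolynomial V K) g
      (Pi.single k 1) l).support, m.degree + a l = a' k := by
    intro k l; rw [hsingle]; exact hg k l
  refine ⟨n, a', Fintype.linearCombination (MvPolynomial V K) g, hdeg, ?_, fun u hu k₀ => ?_⟩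
  · rw [Fintype.range_linearCombination, hspan]
  · by_contra hc
    rcases n with _ | n
    · exact k₀.elim0
    apply hmin n (Nat.lt_succ_self n)
    refine ⟨fun k => a' (k₀.succAbove k), fun k => g (k₀.succAbove k), fun k => hg _, ?_⟩
    have h1 := vecComp_map hdeg (a' k₀) u
    rw [hu] at h1
    have h0 : vecComp a (a' k₀) (0 : Fin r → MvPolynomial V K) = 0 := by
      ext l m; simp [vecComp, coeff_degComp]
    rw [h0, Fintype.linearCombination_apply, Fin.sum_univ_succAbove _ k₀] at h1
    have h2 : vecComp a' (a' k₀) u k₀ = C (constantCoeff (u k₀)) := by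
      ext m
      rw [vecComp, coeff_degComp, coeff_C]
      by_cases hm : m = 0
      · subst hm; simp [constantCoeff_eq]
      · rw [if_neg, if_neg (Ne.symm hm)]
        intro h
        apply hm
        rw [← Finsupp.degree_eq_zero_iff]
        omega
    have h3 : g k₀ ∈ Submodule.span (MvPolynomial V K)
        (Set.range fun k => g (k₀.succAbove k)) := by
      have h4 : g k₀ = -(C (constantCoeff (u k₀))⁻¹ : MvPolynomial V K) •
          ∑ i, vecComp a' (a' k₀) u (k₀.succAbove i) • g (k₀.succAbove i) := by
        rw [h2] at h1
        rw [← neg_eq_of_add_eq_zero_right h1.symm, smul_neg, neg_smul, neg_neg, smul_smul,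
          ← map_mul, inv_mul_cancel₀ hc, map_one, one_smul]
      rw [h4]
      exact Submodule.smul_mem _ _ (Submodule.sum_mem _ fun i _ =>
        Submodule.smul_mem _ _ (Submodule.subset_span ⟨i, rfl⟩))
    rw [← hspan]
    apply le_antisymm
    · refine Submodule.span_mono ?_
      rintro _ ⟨k, rfl⟩
      exact ⟨_, rfl⟩
    · rw [Submodule.span_le]
      rintro _ ⟨k, rfl⟩
      rcases Fin.eq_self_or_eq_succAbove k₀ k with rfl | ⟨i, rfl⟩
      · exact h3
      · exact Submodule.subset_span ⟨i, rfl⟩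

variable (V K) in
/-- A graded submodule, contained in the product with the maximal ideal, of a graded free module:
a syzygy module in a minimal graded free resolution. -/
structure SyzygyStage where
  /-- the rank of the free module -/
  rank : ℕ
  /-- the degrees of the basis elements -/
  shift : Fin rank → ℕ
  /-- the submodule -/
  sub : Submodule (MvPolynomial V K) (Fin rank → MvPolynomial V K)
  graded : ∀ u ∈ sub, ∀ e, vecComp shift e u ∈ sub
  small : ∀ u ∈ sub, ∀ k, constantCoeff (u k) = 0

namespace SyzygyStage

/-- The rank of the free module that covers the submodule. -/
noncomputable def nextRank (s : SyzygyStage V K) : ℕ :=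
  (exists_minimal_homogeneous_generators s.shift s.sub s.graded).choose

/-- The degrees of the basis elements of the free module that covers the submodule. -/
noncomputable def nextShift (s : SyzygyStage V K) : Fin s.nextRank → ℕ :=
  (exists_minimal_homogeneous_generators s.shift s.sub s.graded).choose_spec.choose

/-- The minimal free cover of the submodule. -/
noncomputable def cover (s : SyzygyStage V K) :
    (Fin s.nextRank → MvPolynomial V K) →ₗ[MvPolynomial V K] (Fin s.rank → MvPolynomial V K) :=
  (exists_minimal_homogeneous_generators s.shift s.sub s.graded).choose_spec.choose_spec.choose

theorem cover_spec (s : SyzygyStage V K) :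
    (∀ k l, ∀ m ∈ (s.cover (Pi.single k 1) l).support, m.degree + s.shift l = s.nextShift k) ∧
      LinearMap.range s.cover = s.sub ∧ ∀ u, s.cover u = 0 → ∀ k, constantCoeff (u k) = 0 :=
  (exists_minimal_homogeneous_generators s.shift s.sub s.graded).choose_spec.choose_spec.choose_spec

/-- The next syzygy module. -/
noncomputable def next (s : SyzygyStage V K) : SyzygyStage V K where
  rank := s.nextRank
  shift := s.nextShift
  sub := LinearMap.ker s.cover
  graded u hu e := by
    rw [LinearMap.mem_ker] at hu ⊢
    rw [← vecComp_map s.cover_spec.1, hu]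
    ext l m; simp [vecComp, coeff_degComp]
  small u hu := s.cover_spec.2.2 u hu

/-- The sequence of syzygy modules. -/
noncomputable def iter (s : SyzygyStage V K) : ℕ → SyzygyStage V K
  | 0 => s
  | i + 1 => (s.iter i).next

end SyzygyStage

theorem mem_span_range_X_of_constantCoeff {f : MvPolynomial V K} (hf : constantCoeff f = 0) :
    f ∈ Ideal.span (Set.range (X : V → MvPolynomial V K)) := by
  rw [← Set.image_univ, mem_ideal_span_X_image]
  intro m hm
  by_contra! h
  have : m = 0 := by ext v; simpa using h v (Set.mem_univ v)
  subst this
  exact mem_support_iff.1 hm hf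

/-- A proper ideal that contains the homogeneous components of its elements has a minimal graded
free resolution. -/
theorem exists_isMinimal_gradedFreeResolution (J : Ideal (MvPolynomial V K))
    (hJ : ∀ f ∈ J, ∀ e, degComp e 0 f ∈ J) (hJ' : ∀ f ∈ J, constantCoeff f = 0) :
    ∃ F : GradedFreeResolution J, F.IsMinimal := by
  -- F₀ = S with first syzygy module J; all later stages are kernels of minimal covers.
  let s : SyzygyStage V K :=
    { rank := 1
      shift := fun _ => 0
      sub := Submodule.comap (LinearMap.proj (0 : Fin 1)) J
      graded := fun u hu e => hJ _ hu e
      small := fun u hu k => by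
        rw [Fin.fin_one_eq_zero k]
        exact hJ' _ hu }
  let F : GradedFreeResolution J :=
    { rank := fun i => (s.iter i).rank
      shift := fun i => (s.iter i).shift
      aug := Algebra.linearMap (MvPolynomial V K) (MvPolynomial V K ⧸ J) ∘ₗ LinearMap.proj (0 : Fin 1)
      diff := fun i => (s.iter i).cover
      aug_homogeneous := fun k => ⟨1, isHomogeneous_one V K, by
        have : ∀ k : Fin 1, Ideal.Quotient.mk J
            ((Pi.single k 1 : Fin 1 → MvPolynomial V K) 0) = Ideal.Quotient.mk J 1 := fun k => by
          rw [Fin.fin_one_eq_zero k, Pi.single_eq_same]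
        exact this k⟩
      diff_homogeneous := fun i => (s.iter i).cover_spec.1
      aug_surjective := fun x => by
        obtain ⟨f, rfl⟩ := Ideal.Quotient.mk_surjective x
        exact ⟨fun _ => f, rfl⟩
      exact_zero := fun u => by
        change Ideal.Quotient.mk J (u (0 : Fin 1)) = 0 ↔ u ∈ LinearMap.range s.cover
        rw [s.cover_spec.2.1, Ideal.Quotient.eq_zero_iff_mem]
        rfl
      exact_succ := fun i u => by
        change _ ↔ u ∈ LinearMap.range (s.iter i).next.cover
        rw [(s.iter i).next.cover_spec.2.1]
        rfl }
  refine ⟨F, fun i x l => mem_span_range_X_of_constantCoeff ?_⟩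
  refine (s.iter i).small _ ?_ l
  rw [← (s.iter i).cover_spec.2.1]
  exact ⟨x, rfl⟩

/-- The regularity of a monomial ideal, computed from multigraded Koszul homology. -/
theorem quotientHasRegularity_of_koszul {ρ : V → ℕ} (hρ : Function.Injective ρ)
    (J : Ideal (MvPolynomial V K)) {D : Set (V →₀ ℕ)} (hD : IsLowerSet D)
    (hJ : ∀ p, p ∈ J ↔ ∀ m ∈ p.support, m ∉ D) {r : ℤ} (hr : MonomialRegLE K ρ D r)
    {i : ℕ} {α : V →₀ ℕ} (hα : (α.degree : ℤ) - i = r)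
    (hac : ¬ KoszulAcyclic K ρ (koszulFamily D α) i) : QuotientHasRegularity J r := by
  have h0 : (0 : V →₀ ℕ) ∈ D := by
    by_contra h0
    apply hac
    have : koszulFamily D α = ∅ := by
      ext τ
      simp only [Set.mem_empty_iff_false, iff_false]
      rintro ⟨d, hd, -⟩
      exact h0 (hD (zero_le) hd)
    rw [this]
    exact koszulAcyclic_empty i
  refine ⟨exists_isMinimal_gradedFreeResolution J (fun f hf e => ?_) (fun f hf => ?_),
    fun F hF => ⟨⟨i, α.degree, F.betti_ne_zero_of_not_acyclic hρ hD hJ hac, hα.symm⟩, ?_⟩⟩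
  · rw [hJ] at hf ⊢
    intro m hm
    rw [mem_support_iff, coeff_degComp] at hm
    refine hf m (mem_support_iff.2 fun h => hm ?_)
    rw [h, ite_self]
  · by_contra h
    exact (hJ f).1 hf 0 (mem_support_iff.2 h) h0
  · rintro _ ⟨i, j, hb, rfl⟩
    by_contra! hlt
    refine hb (F.betti_eq_zero_of_acyclic hρ hF hD hJ fun β hβ => hr i β ?_)
    rwa [hβ]

end MinimalResolution

/-! ### Monomials in powers of the cycle ideal. -/

section CycleIdeal

open MvPolynomial

variable {V : Type*} [Fintype V] [DecidableEq V] {K : Type*} [Field K]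

/-- The greedy matching is realised by splitting off (x_v x_w)^min(d v, d w), which leaves `w` with
its residual capacity. -/
theorem monomial_mem_pow_pathNu {I : Ideal (MvPolynomial V K)} {L : List V} (hL : L.Nodup)
    (hI : L.IsChain fun a b => monomial (Finsupp.single a 1 + Finsupp.single b 1) (1 : K) ∈ I)
    (d : V →₀ ℕ) : monomial d (1 : K) ∈ I ^ pathNu L d := by
  induction L generalizing d with
  | nil => simp [pathNu, pathMatch_nil]
  | cons v L ih =>
    rcases L with _ | ⟨w, L⟩
    · simp [pathNu, pathMatch_singleton]
    · rw [List.nodup_cons] at hL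
      have hwL := (List.nodup_cons.1 hL.2).1
      rw [List.isChain_cons_cons] at hI
      have hvw : v ≠ w := fun h => hL.1 (by simp [h])
      rw [pathNu_cons_cons hwL]
      obtain ⟨k, hk⟩ : ∃ k, k = min (d v) (d w) := ⟨_, rfl⟩
      rw [← hk]
      have hle : endsExp v w k ≤ d := by
        intro x
        simp only [endsExp, Finsupp.add_apply, Finsupp.single_apply]
        split_ifs with h1 h2 h2
        · exact absurd (h1.trans h2.symm) hvw
        · subst h1; simp [hk]
        · subst h2; simp [hk]
        · simp
      obtain ⟨e, rfl⟩ := exists_add_of_le hle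
      have hnu : pathNu (w :: L) ((endsExp v w k + e).update w
          ((endsExp v w k + e) w - (endsExp v w k + e) v)) = pathNu (w :: L) e := by
        refine pathNu_congr fun x hx => ?_
        have hxv : v ≠ x := fun h => hL.1 (h ▸ hx)
        rw [Finsupp.update_apply]
        simp only [endsExp, Finsupp.add_apply, Finsupp.single_apply, hvw, hvw.symm, if_true,
          if_false] at hk ⊢
        split_ifs with h1 h2
        · subst h1
          omega
        · exact absurd h2.symm h1
        · simp
      rw [hnu, pow_add]
      have h1 : monomial (endsExp v w k + e) (1 : K) =
          monomial (Finsupp.single v 1 + Finsupp.single w 1) (1 : K) ^ k * monomial e 1 := by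
        rw [monomial_pow, monomial_mul, one_pow, one_mul]
        congr 2
        simp [endsExp]
      rw [h1]
      exact Ideal.mul_mem_mul (Ideal.pow_mem_pow hI.1 k) (ih hL.2 hI.2 e)

/-- Exponents of the generators of the edge ideal of a cycle with one non-trivial edge `v u`,
the other edges being given by `E`. -/
def cycleGenerators (E : V → V → Prop) (v u : V) (ω : ℕ) : Set (V →₀ ℕ) :=
  {d | d = endsExp v u ω ∨ ∃ a b, E a b ∧ d = Finsupp.single a 1 + Finsupp.single b 1}

variable {L : List V} {E : V → V → Prop} {v u : V} {ω : ℕ}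

/-- A generator either raises the power of f or, being an edge of the path, raises `pathNu`; this is
the inductive step for one inclusion in `mem_cycleIdeal_pow_iff`. -/
theorem add_notMem_cycleSet (hL : L.Nodup) (hmem : ∀ x, x ∈ L)
    (hE : ∀ C, IsPathCover C L → ∀ a b, E a b → C a ∨ C b) {t : ℕ} {m g : V →₀ ℕ}
    (hm : m ∉ cycleSet L v u ω t t) (hg : g ∈ cycleGenerators E v u ω) :
    m + g ∉ cycleSet L v u ω (t + 1) (t + 1) := by
  simp only [cycleSet, Set.mem_ofPred_eq, not_forall, not_lt] at hm ⊢
  obtain ⟨j, hj, e, rfl, h⟩ := hm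
  rcases hg with rfl | ⟨a, b, hab, rfl⟩
  · refine ⟨j + 1, by omega, e, ?_, by omega⟩
    rw [Nat.succ_mul, endsExp_add, add_assoc]
  · refine ⟨j, by omega, e + Finsupp.single a 1 + Finsupp.single b 1, by abel, ?_⟩
    have := pathNu_add_edge hL (hmem a) (hmem b) (fun C hC => hE C hC a b hab) e
    omega

theorem mem_cycleIdeal_pow_iff (hL : L.Nodup) (hmem : ∀ x, x ∈ L)
    (hE : ∀ C, IsPathCover C L → ∀ a b, E a b → C a ∨ C b) (hchain : L.IsChain E) (t : ℕ)
    (p : MvPolynomial V K) :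
    p ∈ Ideal.span ((fun d => monomial d (1 : K)) '' cycleGenerators E v u ω) ^ t ↔
      ∀ m ∈ p.support, m ∉ cycleSet L v u ω t t := by
  classical
  set I := Ideal.span ((fun d => monomial d (1 : K)) '' cycleGenerators E v u ω) with hI
  have hsub : ∀ d ∈ cycleGenerators E v u ω, monomial d (1 : K) ∈ I := fun d hd =>
    Ideal.subset_span (Set.mem_image_of_mem (fun d => monomial d (1 : K)) hd)
  constructor
  · induction t generalizing p with
    | zero =>
      intro _ m _ h
      exact absurd (h 0 le_rfl m (by simp [endsExp])) (Nat.not_lt_zero _)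
    | succ t ih =>
      intro hp
      rw [pow_succ] at hp
      refine Submodule.mul_induction_on hp (fun f hf g hg m hm => ?_) fun f g hf hg m hm => ?_
      · obtain ⟨m₁, h₁, m₂, h₂, rfl⟩ := Finset.mem_add.1 (support_mul _ _ hm)
        obtain ⟨s, hs, hle⟩ := mem_ideal_span_monomial_image.1 hg m₂ h₂
        intro h
        exact add_notMem_cycleSet hL hmem hE (ih f hf m₁ h₁) hs
          (isLowerSet_cycleSet hL v u ω _ _ (add_le_add_right hle m₁) h)
      · rcases Finset.mem_union.1 (support_add hm) with h | h
        · exact hf m h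
        · exact hg m h
  · intro h
    rw [← support_sum_monomial_coeff p]
    refine Ideal.sum_mem _ fun m hm => ?_
    have hm' := h m hm
    simp only [cycleSet, Set.mem_ofPred_eq, not_forall, not_lt] at hm'
    obtain ⟨j, hj, e, rfl, hle⟩ := hm'
    have h1 : monomial (endsExp v u ω) (1 : K) ∈ I :=  hsub _ (Or.inl rfl)
    have h2 : monomial e (1 : K) ∈ I ^ pathNu L e :=
      monomial_mem_pow_pathNu hL (hchain.imp fun a b hab =>
        hsub _ (Or.inr ⟨a, b, hab, rfl⟩)) e
    have h3 := Ideal.mul_mem_mul h2 (Ideal.pow_mem_pow h1 j)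
    rw [← pow_add] at h3
    have h4 := Ideal.mul_mem_left _ (C (coeff (e + endsExp v u (j * ω)) p))
      (Ideal.pow_le_pow_right hle h3)
    rw [monomial_pow, monomial_mul, C_mul_monomial] at h4
    convert h4 using 2
    · simp [endsExp]
    · simp

end CycleIdeal

/-! ### Nonvanishing homology for subsets meeting all blocks. -/

section NonAcyclic

variable {V : Type*} [Fintype V] [DecidableEq V] {K : Type*} [Field K] {ρ : V → ℕ}

/-- The transversal of the blocks `{p k false, p k true}` selected by `χ`. -/
def transversal {s : ℕ} (p : Fin (s + 1) → Bool → V) (χ : Fin (s + 1) → Bool) : Finset V :=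
  Finset.univ.image fun k => p k (χ k)

/-- The sets that are contained in the union of the blocks `{p k false, p k true}` and meet all
of them. -/
def blockFamily {s : ℕ} (p : Fin (s + 1) → Bool → V) : Set (Finset V) :=
  {τ | (∀ x ∈ τ, ∃ k β, x = p k β) ∧ ∀ k, ∃ β, p k β ∈ τ}

variable {s : ℕ} {p : Fin (s + 1) → Bool → V}

theorem transversal_mem (p : Fin (s + 1) → Bool → V) (χ : Fin (s + 1) → Bool) :
    transversal p χ ∈ blockFamily p := by
  refine ⟨fun x hx => ?_, fun k => ⟨χ k, Finset.mem_image_of_mem _ (Finset.mem_univ k)⟩⟩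
  obtain ⟨k, -, rfl⟩ := Finset.mem_image.1 hx
  exact ⟨k, χ k, rfl⟩

section Blocks

variable (hp : ∀ k β k' β', p k β = p k' β' → k = k' ∧ β = β')
include hp

theorem card_transversal (χ : Fin (s + 1) → Bool) : (transversal p χ).card = s + 1 := by
  rw [transversal, Finset.card_image_of_injective _ fun k k' h => (hp _ _ _ _ h).1,
    Finset.card_univ, Fintype.card_fin]

theorem le_card_of_mem_blockFamily {τ : Finset V} (hτ : τ ∈ blockFamily p) : s + 1 ≤ τ.card := by
  choose χ hχ using hτ.2
  rw [← card_transversal hp χ]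
  refine Finset.card_le_card fun x hx => ?_
  obtain ⟨k, -, rfl⟩ := Finset.mem_image.1 hx
  exact hχ k

theorem mem_transversal_iff (χ : Fin (s + 1) → Bool) (k : Fin (s + 1)) (β : Bool) :
    p k β ∈ transversal p χ ↔ β = χ k := by
  constructor
  · intro h
    obtain ⟨k', -, h⟩ := Finset.mem_image.1 h
    obtain ⟨rfl, rfl⟩ := hp _ _ _ _ h
    rfl
  · rintro rfl
    exact Finset.mem_image_of_mem _ (Finset.mem_univ k)

theorem koszulD_transversal {y : Finset V → K} (hy : ∀ τ, y τ ≠ 0 → τ ∈ blockFamily p)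
    (χ : Fin (s + 1) → Bool) :
    koszulD ρ (1 : V → K) y (transversal p χ) =
      ∑ k, koszulSign ρ (p k (!χ k)) (transversal p χ) •
        y (insert (p k (!χ k)) (transversal p χ)) := by
  unfold koszulD
  rw [← Finset.sum_image (s := Finset.univ) (g := fun k => p k (!χ k))
    (f := fun x => koszulSign ρ x (transversal p χ) • y (insert x (transversal p χ)))
    fun k _ k' _ h => (hp _ _ _ _ h).1]
  symm
  refine (Finset.sum_subset (fun x hx => ?_) fun x hx hx' => ?_).trans
    (Finset.sum_congr rfl fun x _ => by simp)
  · obtain ⟨k, -, rfl⟩ := Finset.mem_image.1 hx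
    rw [Finset.mem_compl, mem_transversal_iff hp]
    simp
  · rw [Finset.mem_compl] at hx
    by_contra hne
    have : y (insert x (transversal p χ)) ≠ 0 := fun h => hne (by rw [h, smul_zero])
    obtain ⟨k, β, rfl⟩ := (hy _ this).1 x (Finset.mem_insert_self _ _)
    rw [mem_transversal_iff hp] at hx
    apply hx'
    refine Finset.mem_image.2 ⟨k, Finset.mem_univ _, ?_⟩
    have : β = !χ k := by
      revert hx; cases β <;> cases χ k <;> simp
    rw [this]

/-- Transversals have the least possible size, so each is a cycle. The sum of the coefficients over
all transversals vanishes on boundaries but equals 1 on a single transversal. `hadj` says that ρ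
separates the two points of a block by no point of another block, so flipping one block reverses the
sign. -/
theorem not_acyclic_blockFamily (hρ : Function.Injective ρ)
    (hadj : ∀ k k' β, k ≠ k' → (ρ (p k' β) < ρ (p k true) ↔ ρ (p k' β) < ρ (p k false))) :
    ¬ KoszulAcyclic K ρ (blockFamily p) (s + 1) := by
  classical
  intro h
  let τ₀ := transversal p fun _ => true
  obtain ⟨y, hy1, hy2⟩ := h (Pi.single τ₀ 1)
    (fun τ hτ => by
      by_cases h : τ = τ₀
      · subst h; exact ⟨transversal_mem p _, card_transversal hp _⟩
      · exact absurd (Pi.single_eq_of_ne h _) hτ)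
    (fun σ hσ => by
      refine koszulD_eq_zero fun v hv => ?_
      refine Pi.single_eq_of_ne (fun h => ?_) _
      have h1 := congrArg Finset.card h
      rw [Finset.card_insert_of_notMem hv, card_transversal hp] at h1
      have := le_card_of_mem_blockFamily hp hσ
      omega)
  have hsum : ∑ χ, koszulD ρ (1 : V → K) y (transversal p χ) = 0 := by
    rw [Finset.sum_congr rfl fun χ _ => koszulD_transversal hp (fun τ h => (hy1 τ h).1) χ,
      Finset.sum_comm]
    refine Finset.sum_eq_zero fun k _ => ?_
    have hflip : ∀ χ : Fin (s + 1) → Bool, ∃ σ : Finset V, p k true ∉ σ ∧ p k false ∉ σ ∧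
        (∀ x ∈ σ, ∃ k' β, k ≠ k' ∧ x = p k' β) ∧
        transversal p χ = insert (p k (χ k)) σ ∧
        transversal p (Function.update χ k (!χ k)) = insert (p k (!χ k)) σ := by
      intro χ
      refine ⟨(Finset.univ.erase k).image fun k' => p k' (χ k'), ?_, ?_, ?_, ?_, ?_⟩
      · intro h
        obtain ⟨k', hk', h⟩ := Finset.mem_image.1 h
        exact (Finset.mem_erase.1 hk').1 (hp _ _ _ _ h).1
      · intro h
        obtain ⟨k', hk', h⟩ := Finset.mem_image.1 h
        exact (Finset.mem_erase.1 hk').1 (hp _ _ _ _ h).1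
      · intro x hx
        obtain ⟨k', hk', rfl⟩ := Finset.mem_image.1 hx
        exact ⟨k', χ k', (Finset.mem_erase.1 hk').1.symm, rfl⟩
      · rw [transversal, ← Finset.insert_erase (Finset.mem_univ k), Finset.image_insert,
          Finset.erase_insert (Finset.notMem_erase _ _)]
      · rw [transversal, ← Finset.insert_erase (Finset.mem_univ k), Finset.image_insert,
          Function.update_self, Finset.erase_insert (Finset.notMem_erase _ _)]
        congr 1
        refine Finset.image_congr fun k' hk' => ?_
        simp only [Finset.coe_erase, Finset.coe_univ, Set.mem_sdiff, Set.mem_singleton_iff] at hk'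
        simp [hk'.2]
    refine Finset.sum_involution (fun χ _ => Function.update χ k (!χ k)) ?_ ?_ ?_ ?_
    · intro χ _
      obtain ⟨σ, h1, h2, h3, h4, h5⟩ := hflip χ
      simp only [Function.update_self, Bool.not_not]
      rw [h4, h5, Finset.insert_comm (p k (!χ k))]
      have hs : koszulSign ρ (p k true) σ = koszulSign ρ (p k false) σ := by
        unfold koszulSign
        congr 2
        refine Finset.filter_congr fun x hx => ?_
        obtain ⟨k', β, hkk', rfl⟩ := h3 x hx
        exact hadj k k' β hkk'
      have hne : ρ (p k true) ≠ ρ (p k false) := fun h => by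
        have := (hp _ _ _ _ (hρ h)).2
        simp at this
      rw [← add_smul]
      refine smul_eq_zero_of_left ?_ _
      rcases hχ : χ k with _ | _
      · simp only [Bool.not_false]
        rw [koszulSign_insert h2, koszulSign_insert h1, hs]
        split_ifs <;> omega
      · simp only [Bool.not_true]
        rw [koszulSign_insert h2, koszulSign_insert h1, hs]
        split_ifs <;> omega
    · intro χ _ _ h
      have := congrFun h k
      simp at this
    · intro χ _; exact Finset.mem_univ _
    · intro χ _
      simp
  rw [Finset.sum_congr rfl fun χ _ => hy2 _ (transversal_mem p χ),
    Finset.sum_eq_single (fun _ => true)] at hsum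
  · simp [τ₀] at hsum
  · intro χ _ hχ
    refine Pi.single_eq_of_ne (fun h => hχ ?_) _
    funext k
    have : p k (χ k) ∈ τ₀ := h ▸ Finset.mem_image_of_mem _ (Finset.mem_univ k)
    exact (mem_transversal_iff hp _ _ _).1 this
  · intro h; exact absurd (Finset.mem_univ _) h

end Blocks

end NonAcyclic

/-! ### A multidegree with nonzero Koszul homology. -/

section LowerBound

variable {V : Type*} [Fintype V] [DecidableEq V] {K : Type*} [Field K] {ρ : V → ℕ}

variable {s : ℕ} {p : Fin (s + 1) → Bool → V}

/-- The union of the blocks `{p k false, p k true}`. -/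
def blockUnion (p : Fin (s + 1) → Bool → V) : Finset V :=
  Finset.univ.image fun q : Fin (s + 1) × Bool => p q.1 q.2

theorem mem_blockUnion {x : V} : x ∈ blockUnion p ↔ ∃ k β, x = p k β := by
  simp [blockUnion, eq_comm]

theorem card_blockUnion (hp : ∀ k β k' β', p k β = p k' β' → k = k' ∧ β = β') :
    (blockUnion p).card = 2 * (s + 1) := by
  rw [blockUnion, Finset.card_image_of_injective]
  · simp [mul_comm]
  · rintro ⟨k, β⟩ ⟨k', β'⟩ h
    obtain ⟨rfl, rfl⟩ := hp _ _ _ _ h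
    rfl

theorem endsExp_block_zero (hp : ∀ k β k' β', p k β = p k' β' → k = k' ∧ β = β') (q : ℕ) (β : Bool) :
    endsExp (p 0 true) (p 0 false) q (p 0 β) = q := by
  have h : p 0 true ≠ p 0 false := fun h => by simpa using (hp _ _ _ _ h).2
  cases β <;> simp [endsExp, h, h.symm]

theorem endsExp_block_ne (hp : ∀ k β k' β', p k β = p k' β' → k = k' ∧ β = β') (q : ℕ)
    {k : Fin (s + 1)} (hk : k ≠ 0) (β : Bool) :
    endsExp (p 0 true) (p 0 false) q (p k β) = 0 := by
  have h : ∀ γ, p 0 γ ≠ p k β := fun γ h => hk (hp _ _ _ _ h).1.symm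
  simp [endsExp, h]

theorem endsExp_of_notMem {x : V} (hx : x ∉ blockUnion p) (q : ℕ) :
    endsExp (p 0 true) (p 0 false) q x = 0 := by
  have h : ∀ γ, p 0 γ ≠ x := fun γ h => hx (mem_blockUnion.2 ⟨_, _, h.symm⟩)
  simp [endsExp, h]

/-- Removing τ from α leaves I^t exactly when τ meets every block: a missed block 0 leaves f^t as a
divisor, and any other missed block leaves its edge times f^(t-1). -/
theorem koszulFamily_cycleSet_blockUnion
    (hp : ∀ k β k' β', p k β = p k' β' → k = k' ∧ β = β')
    {L : List V} (hL : L.Nodup) (hmem : ∀ x, x ∈ L) {E : V → V → Prop} (hchain : L.IsChain E)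
    (hE : ∀ C, IsPathCover C L → ∀ a b, E a b → C a ∨ C b)
    (hpE : ∀ k, k ≠ 0 → E (p k false) (p k true))
    (hEp : ∀ k β k' β', E (p k β) (p k' β') → k = k' ∧ k ≠ 0 ∧ β ≠ β')
    {ω t : ℕ} (hω : 1 ≤ ω) (ht : 1 ≤ t) :
    koszulFamily (cycleSet L (p 0 true) (p 0 false) ω t t)
      (endsExp (p 0 true) (p 0 false) (t * ω - 1) + expInd (blockUnion p)) = blockFamily p := by
  have htω : 1 ≤ t * ω := Nat.mul_pos ht hω
  set α := endsExp (p 0 true) (p 0 false) (t * ω - 1) + expInd (blockUnion p) with hα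
  have hα0 : ∀ β, α (p 0 β) = t * ω := fun β => by
    rw [hα, Finsupp.add_apply, endsExp_block_zero hp, expInd_apply,
      if_pos (mem_blockUnion.2 ⟨_, _, rfl⟩)]
    omega
  have hαk : ∀ k, k ≠ 0 → ∀ β, α (p k β) = 1 := fun k hk β => by
    rw [hα, Finsupp.add_apply, endsExp_block_ne hp _ hk, expInd_apply,
      if_pos (mem_blockUnion.2 ⟨_, _, rfl⟩)]
  have hαn : ∀ x, x ∉ blockUnion p → α x = 0 := fun x hx => by
    rw [hα, Finsupp.add_apply, endsExp_of_notMem hx, expInd_apply, if_neg hx]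
  ext τ
  rw [mem_koszulFamily_iff]
  constructor
  · rintro ⟨hle, hd⟩
    refine ⟨fun x hx => ?_, fun k => ?_⟩
    · by_contra hne
      have h1 := hle x
      rw [expInd_apply, if_pos hx, hαn x fun h => hne (mem_blockUnion.1 h)] at h1
      omega
    · by_contra! hk
      have hval : ∀ β, (α - expInd τ) (p k β) = α (p k β) := fun β => by
        rw [Finsupp.tsub_apply, expInd_apply, if_neg (hk β), Nat.sub_zero]
      by_cases hk0 : k = 0
      · subst hk0
        have hge : endsExp (p 0 true) (p 0 false) (t * ω) ≤ α - expInd τ := by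
          intro x
          by_cases hx : ∃ β, x = p 0 β
          · obtain ⟨β, rfl⟩ := hx
            rw [endsExp_block_zero hp, hval, hα0]
          · push Not at hx
            simp [endsExp, (hx true).symm, (hx false).symm]
        have := hd t le_rfl _ (tsub_add_cancel_of_le hge).symm
        omega
      · have hge : 0 + Finsupp.single (p k false) 1 + Finsupp.single (p k true) 1 +
            endsExp (p 0 true) (p 0 false) ((t - 1) * ω) ≤ α - expInd τ := by
          intro x
          have hft : p k false ≠ p k true := fun h => by simpa using (hp _ _ _ _ h).2
          by_cases hx : ∃ β, x = p k β
          · obtain ⟨β, rfl⟩ := hx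
            rw [hval, hαk k hk0, Finsupp.add_apply, endsExp_block_ne hp _ hk0]
            cases β <;> simp [hft, hft.symm]
          · push Not at hx
            have h1 : (α - expInd τ) x ≥ endsExp (p 0 true) (p 0 false) (t * ω - 1) x := by
              rw [hα, Finsupp.tsub_apply, Finsupp.add_apply, expInd_apply, expInd_apply]
              have h2 := hle x
              by_cases hxB : x ∈ blockUnion p
              · rw [if_pos hxB]; split_ifs <;> omega
              · rw [endsExp_of_notMem hxB]; omega
            have h2 : endsExp (p 0 true) (p 0 false) ((t - 1) * ω) x ≤
                endsExp (p 0 true) (p 0 false) (t * ω - 1) x := by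
              refine endsExp_mono _ _ ?_ x
              obtain ⟨t, rfl⟩ := Nat.exists_eq_add_of_le' ht
              rw [Nat.add_sub_cancel, Nat.succ_mul]
              omega
            simpa [(hx true).symm, (hx false).symm] using h2.trans h1
        have h1 := pathNu_add_edge hL (hmem (p k false)) (hmem (p k true))
          (fun C hC => hE C hC _ _ (hpE k hk0)) 0
        have h2 := isLowerSet_cycleSet hL _ _ _ _ _ hge hd (t - 1) (by omega) _ rfl
        omega
  · intro hτ
    have hτB : τ ⊆ blockUnion p := fun x hx => mem_blockUnion.2 (hτ.1 x hx)
    refine ⟨(expInd_mono hτB).trans (le_add_of_nonneg_left (zero_le)), ?_⟩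
    intro j hj e he
    have hjt : j < t := by
      obtain ⟨β, hβ⟩ := hτ.2 0
      have h1 := DFunLike.congr_fun he (p 0 β)
      rw [Finsupp.tsub_apply, hα0, expInd_apply, if_pos hβ, Finsupp.add_apply,
        endsExp_block_zero hp] at h1
      have h2 : j * ω < t * ω := by omega
      exact lt_of_mul_lt_mul_right h2 (Nat.zero_le _)
    have hle : ∀ x, e x ≤ α x - expInd τ x := fun x => by
      rw [← Finsupp.tsub_apply, he]
      exact Nat.le_add_right _ _
    have hB : ∀ x, e x ≠ 0 → x ∈ blockUnion p := fun x hx => by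
      by_contra hxB
      have := hle x
      rw [hαn x hxB] at this
      omega
    -- No trivial edge joins distinct blocks and τ meets each block, so the support of `e` is
    -- independent in the path; its complement is a cover of weight 0, whence `pathNu L e = 0`.
    have hcov : IsPathCover (fun x => decide (e x = 0)) L := by
      refine hchain.imp fun a b hab => ?_
      by_contra! hne
      simp only [decide_eq_true_eq, ne_eq] at hne
      obtain ⟨k, β, rfl⟩ := mem_blockUnion.1 (hB a hne.1)
      obtain ⟨k', β', rfl⟩ := mem_blockUnion.1 (hB b hne.2)
      obtain ⟨rfl, hk, hββ⟩ := hEp _ _ _ _ hab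
      obtain ⟨γ, hγ⟩ := hτ.2 k
      have h1 := hle (p k γ)
      rw [hαk k hk, expInd_apply, if_pos hγ] at h1
      have : γ = β ∨ γ = β' := by
        revert hββ; cases γ <;> cases β <;> cases β' <;> simp
      rcases this with rfl | rfl
      · exact hne.1 (by omega)
      · exact hne.2 (by omega)
    have h3 := pathNu_le_coverWeight hL hcov e
    have h4 : coverWeight (fun x => decide (e x = 0)) L e = 0 := by
      unfold coverWeight
      refine List.sum_eq_zero fun y hy => ?_
      obtain ⟨x, -, rfl⟩ := List.mem_map.1 hy
      simp
    omega

theorem degree_endsExp_add_blockUnion (hp : ∀ k β k' β', p k β = p k' β' → k = k' ∧ β = β')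
    (v u : V) (q : ℕ) :
    (endsExp v u q + expInd (blockUnion p)).degree = 2 * q + 2 * (s + 1) := by
  rw [map_add, degree_endsExp, degree_expInd, card_blockUnion hp]

end LowerBound

/-! ### The cycle on `Fin (m + 2)`, cut open at its non-trivial edge. -/

section CycleGraph

open MvPolynomial

variable {m : ℕ}

/-- The edges `a, a + 1` of the cycle on `Fin (m + 2)` other than `i, i + 1`. -/
def TrivialEdge (i a b : Fin (m + 2)) : Prop := b = a + 1 ∧ a ≠ i

/-- The vertices of the cycle other than `i`, `i + 1`, starting at `i + 2`. -/
def innerVertices (i : Fin (m + 2)) : List (Fin (m + 2)) :=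
  List.ofFn fun k : Fin m => i + 1 + k.castSucc.succ

theorem cons_innerVertices (i : Fin (m + 2)) :
    (i + 1) :: (innerVertices i ++ [i]) = List.ofFn fun k : Fin (m + 2) => i + 1 + k := by
  rw [List.ofFn_succ, List.ofFn_succ', List.concat_eq_append, add_zero, Fin.succ_last,
    innerVertices]
  have : i + 1 + Fin.last (m + 1) = i := by
    rw [add_assoc, add_comm 1, Fin.last_add_one, add_zero]
  rw [this]

theorem nodup_cons_innerVertices (i : Fin (m + 2)) : ((i + 1) :: (innerVertices i ++ [i])).Nodup := by
  rw [cons_innerVertices]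
  exact List.nodup_ofFn.2 (add_right_injective _)

theorem mem_cons_innerVertices (i x : Fin (m + 2)) : x ∈ (i + 1) :: (innerVertices i ++ [i]) := by
  rw [cons_innerVertices, List.mem_ofFn]
  exact ⟨x - (i + 1), add_sub_cancel _ _⟩

theorem fin_mk_succ (k : ℕ) (hk : k + 1 < m + 2) :
    (⟨k + 1, hk⟩ : Fin (m + 2)) = ⟨k, by omega⟩ + 1 := by
  ext
  rw [Fin.val_add_one_of_lt]
  rw [Fin.lt_def, Fin.val_last]
  simp only
  omega

theorem isChain_innerVertices (i : Fin (m + 2)) :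
    ((i + 1) :: (innerVertices i ++ [i])).IsChain (TrivialEdge i) := by
  rw [cons_innerVertices, List.isChain_iff_getElem]
  intro k hk
  rw [List.length_ofFn] at hk
  simp only [List.getElem_ofFn]
  refine ⟨by rw [fin_mk_succ, add_assoc _ _ (1 : Fin (m + 2))], fun h => ?_⟩
  rw [add_assoc, add_eq_left, add_comm (1 : Fin (m + 2)), ← fin_mk_succ k hk, Fin.ext_iff] at h
  simp at h

/-- Each trivial edge joins consecutive entries of the list: only a = i sits at the last position.
-/
theorem trivialEdge_cover {i : Fin (m + 2)} (C : Fin (m + 2) → Bool)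
    (hC : IsPathCover C ((i + 1) :: (innerVertices i ++ [i]))) (a b : Fin (m + 2))
    (h : TrivialEdge i a b) : C a ∨ C b := by
  obtain ⟨rfl, ha⟩ := h
  unfold IsPathCover at hC
  rw [cons_innerVertices, List.isChain_iff_getElem] at hC
  have hlt : (a - (i + 1)).val + 1 < m + 2 := by
    have h1 := (a - (i + 1)).isLt
    by_contra h2
    have h3 : a - (i + 1) = Fin.last (m + 1) := by
      ext; rw [Fin.val_last]; omega
    apply ha
    rw [sub_eq_iff_eq_add] at h3
    rw [h3, add_comm i, ← add_assoc, Fin.last_add_one, zero_add]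
  have := hC (a - (i + 1)).val (by rw [List.length_ofFn]; exact hlt)
  simp only [List.getElem_ofFn] at this
  rw [fin_mk_succ _ hlt, Fin.eta, ← add_assoc, add_sub_cancel] at this
  exact this

/-- The vertices `i + 3 k` and `i + 3 k + 1`. -/
def cycleBlocks (i : Fin (m + 2)) (s : ℕ) (hs : 3 * s + 1 ≤ m) (k : Fin (s + 1)) (β : Bool) :
    Fin (m + 2) :=
  i + ⟨3 * k + β.toNat, by have := k.isLt; have := β.toNat_le; omega⟩

variable {i : Fin (m + 2)} {s : ℕ} {hs : 3 * s + 1 ≤ m}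

theorem cycleBlocks_sub (k : Fin (s + 1)) (β : Bool) :
    (cycleBlocks i s hs k β - i).val = 3 * k + β.toNat := by
  rw [cycleBlocks, add_sub_cancel_left]

theorem cycleBlocks_zero_false : cycleBlocks i s hs 0 false = i := by
  unfold cycleBlocks
  rw [add_eq_left, Fin.ext_iff]
  simp

theorem cycleBlocks_true (k : Fin (s + 1)) :
    cycleBlocks i s hs k true = cycleBlocks i s hs k false + 1 := by
  have h := fin_mk_succ (m := m) (3 * (k : ℕ)) (by omega)
  unfold cycleBlocks
  rw [add_assoc]
  simpa using h

theorem cycleBlocks_injective (k : Fin (s + 1)) (β : Bool) (k' : Fin (s + 1)) (β' : Bool)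
    (h : cycleBlocks i s hs k β = cycleBlocks i s hs k' β') : k = k' ∧ β = β' := by
  have h1 := congrArg (fun x => (x - i).val) h
  simp only [cycleBlocks_sub] at h1
  have h2 := β.toNat_le
  have h3 := β'.toNat_le
  refine ⟨Fin.ext (by omega), ?_⟩
  have h4 : β.toNat = β'.toNat := by omega
  cases β <;> cases β' <;> simp at h4 ⊢

theorem trivialEdge_cycleBlocks {k : Fin (s + 1)} (hk : k ≠ 0) :
    TrivialEdge i (cycleBlocks i s hs k false) (cycleBlocks i s hs k true) :=
  ⟨cycleBlocks_true k, fun h => hk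
    (cycleBlocks_injective k false 0 false (h.trans cycleBlocks_zero_false.symm)).1⟩

theorem eq_of_trivialEdge_cycleBlocks {k : Fin (s + 1)} {β : Bool} {k' : Fin (s + 1)} {β' : Bool}
    (h : TrivialEdge i (cycleBlocks i s hs k β) (cycleBlocks i s hs k' β')) :
    k = k' ∧ k ≠ 0 ∧ β ≠ β' := by
  obtain ⟨h1, h2⟩ := h
  have hb := β.toNat_le
  have hb' := β'.toNat_le
  have h3 : 3 * (k' : ℕ) + β'.toNat = 3 * k + β.toNat + 1 := by
    have h4 := congrArg (fun x => (x - i).val) h1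
    simp only [cycleBlocks_sub] at h4
    rw [add_sub_right_comm, cycleBlocks, add_sub_cancel_left,
      ← fin_mk_succ _ (by have := k.isLt; omega)] at h4
    exact h4
  have h4 : k = k' := Fin.ext (by omega)
  subst h4
  refine ⟨rfl, ?_, fun h => by subst h; omega⟩
  rintro rfl
  have h5 : β = false := by
    cases β
    · rfl
    · rw [Bool.toNat_true] at h3; omega
  subst h5
  exact h2 cycleBlocks_zero_false

/-- Ordering the vertices by their distance from `i` makes the two points of every block neighbours,
as the sign argument requires. -/
theorem not_acyclic_cycleSet {K : Type*} [Field K] {ω t : ℕ} (hω : 1 ≤ ω) (ht : 1 ≤ t) :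
    ¬ KoszulAcyclic K (fun x : Fin (m + 2) => (x - i).val)
      (koszulFamily (cycleSet ((i + 1) :: (innerVertices i ++ [i])) (i + 1) i ω t t)
        (endsExp (i + 1) i (t * ω - 1) + expInd (blockUnion (cycleBlocks i s hs)))) (s + 1) := by
  have h := koszulFamily_cycleSet_blockUnion (p := cycleBlocks i s hs) cycleBlocks_injective
    (nodup_cons_innerVertices i) (mem_cons_innerVertices i) (isChain_innerVertices i)
    trivialEdge_cover (fun k hk => trivialEdge_cycleBlocks hk)
    (fun k β k' β' h => eq_of_trivialEdge_cycleBlocks h) hω ht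
  rw [cycleBlocks_true, cycleBlocks_zero_false] at h
  rw [h]
  refine not_acyclic_blockFamily cycleBlocks_injective
    (fun x y h => sub_left_injective (Fin.ext h)) fun k k' β hk => ?_
  simp only [cycleBlocks_sub]
  have h2 := β.toNat_le
  have h3 : (k : ℕ) ≠ k' := fun h => hk (Fin.ext h)
  simp only [Bool.toNat_true, Bool.toNat_false]
  omega

theorem weightedEdgeIdeal_cycleGraph_eq (K : Type*) [Field K] (hm : 1 ≤ m)
    {w : (SimpleGraph.cycleGraph (m + 2)).edgeSet → ℕ+} {ω : ℕ}
    (hi : (SimpleGraph.cycleGraph (m + 2)).Adj i (i + 1)) (hω : (w ⟨s(i, i + 1), hi⟩ : ℕ) = ω)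
    (hone : ∀ e, e ≠ ⟨s(i, i + 1), hi⟩ → (w e : ℕ) = 1) :
    weightedEdgeIdeal K (SimpleGraph.cycleGraph (m + 2)) w =
      Ideal.span ((fun d => monomial d (1 : K)) '' cycleGenerators (TrivialEdge i) (i + 1) i ω) := by
  have hX : ∀ (a b : Fin (m + 2)) (q : ℕ),
      (X a ^ q * X b ^ q : MvPolynomial (Fin (m + 2)) K) = monomial (endsExp a b q) 1 :=
    fun a b q => by simp [endsExp, X_pow_eq_monomial, monomial_mul]
  unfold weightedEdgeIdeal
  congr 1
  ext f
  simp only [hX, Set.mem_ofPred_eq, Set.mem_image]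
  constructor
  · rintro ⟨a, b, h, rfl⟩
    by_cases he : (⟨s(a, b), h⟩ : (SimpleGraph.cycleGraph (m + 2)).edgeSet) = ⟨s(i, i + 1), hi⟩
    · refine ⟨_, Or.inl rfl, ?_⟩
      rw [he, hω]
      have he' := congrArg Subtype.val he
      simp only [Sym2.eq_iff] at he'
      rcases he' with ⟨rfl, rfl⟩ | ⟨rfl, rfl⟩
      · exact congrArg (fun d => monomial d (1 : K)) (add_comm _ _)
      · rfl
    · rw [hone _ he]
      rcases SimpleGraph.cycleGraph_adj.1 h with hab | hab
      · obtain rfl : a = b + 1 := by rw [← hab, add_sub_cancel]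
        refine ⟨_, Or.inr ⟨b, b + 1, ⟨rfl, fun hb => he ?_⟩, rfl⟩, ?_⟩
        · subst hb
          exact Subtype.ext Sym2.eq_swap
        · exact congrArg (fun d => monomial d (1 : K)) (add_comm _ _)
      · obtain rfl : b = a + 1 := by rw [← hab, add_sub_cancel]
        refine ⟨_, Or.inr ⟨a, a + 1, ⟨rfl, fun hb => he ?_⟩, rfl⟩, rfl⟩
        subst hb
        rfl
  · rintro ⟨d, hd | ⟨a, b, ⟨rfl, ha⟩, hd⟩, rfl⟩
    · subst hd
      refine ⟨i + 1, i, hi.symm, ?_⟩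
      have : (⟨s(i + 1, i), hi.symm⟩ : (SimpleGraph.cycleGraph (m + 2)).edgeSet) =
        ⟨s(i, i + 1), hi⟩ := Subtype.ext Sym2.eq_swap
      rw [this, hω]
    · subst hd
      have hadj : (SimpleGraph.cycleGraph (m + 2)).Adj a (a + 1) :=
        SimpleGraph.cycleGraph_adj.2 (Or.inr (add_sub_cancel_left _ _))
      refine ⟨a, a + 1, hadj, ?_⟩
      rw [hone]
      · rfl
      · intro he
        have he' := congrArg Subtype.val he
        simp only [Sym2.eq_iff] at he'
        rcases he' with ⟨h, -⟩ | ⟨rfl, h⟩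
        · exact ha h
        -- The reversed identification would give i + 2 = i, impossible with at least three
        -- vertices.
        · rw [add_assoc, add_eq_left] at h
          have := congrArg Fin.val h
          rw [Fin.val_add, Fin.val_one, Nat.mod_eq_of_lt (by omega)] at this
          simp at this

end CycleGraph

theorem mainTheorem2 (K : Type*) [Field K] (n : ℕ) (hn : 4 ≤ n)
    (w : (SimpleGraph.cycleGraph n).edgeSet → ℕ+)
    (hclosed : IsIntegrallyClosedIdeal (weightedEdgeIdeal K (SimpleGraph.cycleGraph n) w))
    (hone : ∃! e : (SimpleGraph.cycleGraph n).edgeSet, 2 ≤ (w e : ℕ))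
    (ω : ℕ) (hω : IsGreatest (Set.range fun e => (w e : ℕ)) ω)
    (t : ℕ) (ht : 1 ≤ t) :
    QuotientHasRegularity (weightedEdgeIdeal K (SimpleGraph.cycleGraph n) w ^ t)
      (2 * (ω : ℤ) * (t : ℤ) + ((n / 3 : ℕ) : ℤ) - 2) := by
  obtain ⟨m, rfl⟩ : ∃ m, n = m + 2 := ⟨n - 2, by omega⟩
  obtain ⟨e₀, he₀, huniq⟩ := hone
  have hedge : ∃ (i : Fin (m + 2)) (hi : (SimpleGraph.cycleGraph (m + 2)).Adj i (i + 1)),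
      e₀ = ⟨s(i, i + 1), hi⟩ := by
    obtain ⟨e, he⟩ := e₀
    induction e using Sym2.ind with
    | _ a b =>
      have hab : (SimpleGraph.cycleGraph (m + 2)).Adj a b := he
      rcases SimpleGraph.cycleGraph_adj.1 hab with h | h
      · obtain rfl : a = b + 1 := by rw [← h, add_sub_cancel]
        exact ⟨b, hab.symm, Subtype.ext Sym2.eq_swap⟩
      · obtain rfl : b = a + 1 := by rw [← h, add_sub_cancel]
        exact ⟨a, hab, rfl⟩
  obtain ⟨i, hi, rfl⟩ := hedge
  have hw : (w ⟨s(i, i + 1), hi⟩ : ℕ) = ω := by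
    obtain ⟨e, he⟩ := hω.1
    have h1 : (w ⟨s(i, i + 1), hi⟩ : ℕ) ≤ ω := hω.2 ⟨_, rfl⟩
    have h2 : 2 ≤ (w e : ℕ) := by
      have : (w e : ℕ) = ω := he
      omega
    rw [← huniq e h2]
    exact he
  have hω2 : 2 ≤ ω := hw ▸ he₀
  rw [weightedEdgeIdeal_cycleGraph_eq K (by omega) hi hw fun e he => ?_]
  swap
  · have h1 := (w e).pos
    have h2 : ¬ 2 ≤ (w e : ℕ) := fun h => he (huniq e h)
    omega
  -- There are s + 1 = ⌊n/3⌋ blocks, and the last one stays clear of `i` around the cycle.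
  have hs : 3 * ((m + 2) / 3 - 1) + 1 ≤ m := by omega
  have hinj : Function.Injective fun x : Fin (m + 2) => (x - i).val :=
    fun x y h => sub_left_injective (Fin.ext h)
  have hreg := monomialRegLE_cycleSet (K := K) hinj (nodup_cons_innerVertices i) hω2 ht t le_rfl
  rw [show (innerVertices i).length = m by simp [innerVertices]] at hreg
  refine quotientHasRegularity_of_koszul hinj _
    (isLowerSet_cycleSet (nodup_cons_innerVertices i) (i + 1) i ω t t)
    (mem_cycleIdeal_pow_iff (nodup_cons_innerVertices i) (mem_cons_innerVertices i)
      trivialEdge_cover (isChain_innerVertices i) t) hreg ?_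
    (not_acyclic_cycleSet (hs := hs) (by omega) ht)
  rw [degree_endsExp_add_blockUnion cycleBlocks_injective]
  have h1 : 1 ≤ t * ω := Nat.mul_pos ht (by omega)
  have h2 : (2 : ℤ) * ω * t = 2 * ((t * ω : ℕ) : ℤ) := by push_cast; ring
  rw [h2]
  omega
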